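/- Links are oriented links in $S^3$, represented by oriented link diagrams up to Reidemeister moves. Let $D$ be a diagram of a link $L'$ and $p$ a crossing of $D$. A diagram $D'$ is obtained from $D$ by \emph{lassoing} at $p$ if the crossing at $p$ is changed and one adds a new component, a small loop (with either orientation) encircling $p$ once and meeting each of the four arcs that emanate from $p$ in one crossing, such that the diagram is alternating there: the loop passes over both arcs of the strand that is the over-strand at $p$ after the crossing change, and under both arcs of the other strand. The link with diagram $D'$ is then said to be obtained from $L'$ by a lassoing. A link $L$ is obtained from $L'$ by $r$-iterated lassoings if it results from $L'$ by $r$ successive lassoings, each at some crossing of some diagram of the link at hand. Let $\nabla(L)\in\mathbb{Z}[z]$ be the Conway polynomial, the invariant of oriented links with $\nabla(\text{trivial knot})=1$ and $\nabla(L_+)-\nabla(L_-)=z\nabla(L_0)$ for every skein triple. It is computed from any diagram $D$ by the state sum $\sum_S\prod_{c\in S}\operatorname{sign}(c)\,z^{|S|}$ over the sets $S$ of crossings of $D$ such that the oriented smoothing of $D$ at $S$ is a single closed curve and, walking along this curve from a fixed base point of $D$, one arrives at each $c\in S$ for the first time along its under-strand. (It is part of the claim that this sum does not depend on the diagram, and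 has the two stated properties.) Corollary. Let $r\ge 0$ and let $L$ be a link obtained by $r$-iterated lassoings from a link $L'$. If $\nabla(L')\neq 0$, then $\nabla(L)\neq 0$. In particular, if $L'$ is a knot, then $\nabla(L)\neq 0$. -/

import Mathlib

open Polynomial

/-- Combinatorial data of an oriented link diagram with `n` crossings.
A point of `Fin n × Bool` is a *passage*: `(c, true)` is the over-passage and `(c, false)` the
under-passage of the crossing `c`. `next x` is the passage that follows `x` along the orientation;
so `x` also stands for the edge of the diagram running from `x` to `next x`.
`positive c` tells whether the crossing `c` is positive, and `circles` is the number
of components without crossings. -/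
structure GaussDiagram where
  n : ℕ
  positive : Fin n → Bool
  next : Equiv.Perm (Fin n × Bool)
  circles : ℕ

/-- The number of cycles of a permutation, fixed points included. -/
noncomputable def numCycles {α : Type} (σ : Equiv.Perm α) : ℕ :=
  Nat.card (Quotient (Equiv.Perm.SameCycle.setoid σ))

/-- Exchange the two passages of every crossing in `S`. -/
def flipOn {n : ℕ} (S : Finset (Fin n)) : Equiv.Perm (Fin n × Bool) where
  toFun x := if x.1 ∈ S then (x.1, !x.2) else x
  invFun x := if x.1 ∈ S then (x.1, !x.2) else x
  left_inv := by
    rintro ⟨c, b⟩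
    by_cases h : c ∈ S <;> simp [h]
  right_inv := by
    rintro ⟨c, b⟩
    by_cases h : c ∈ S <;> simp [h]

namespace GaussDiagram

/-- Number of components of the link. -/
noncomputable def numComponents (D : GaussDiagram) : ℕ :=
  numCycles D.next + D.circles

/-- Half-edges: `(x, true)` is the outgoing and `(x, false)` the incoming half-edge at the
passage `x`. -/
abbrev HalfEdge (D : GaussDiagram) : Type := (Fin D.n × Bool) × Bool

/-- The involution that sends a half-edge to the other half of the same edge. -/
def otherEnd (D : GaussDiagram) : Equiv.Perm D.HalfEdge where
  toFun h := if h.2 then (D.next h.1, false) else (D.next.symm h.1, true)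
  invFun h := if h.2 then (D.next h.1, false) else (D.next.symm h.1, true)
  left_inv := by rintro ⟨x, b⟩; cases b <;> simp
  right_inv := by rintro ⟨x, b⟩; cases b <;> simp

/-- Rotation of the four half-edges at a crossing to the counterclockwise next one. At a positive
crossing the counterclockwise order is over-out, under-out, over-in, under-in; at a negative one it
is over-out, under-in, over-in, under-out. -/
def rotate (D : GaussDiagram) : Equiv.Perm D.HalfEdge where
  toFun h := ((h.1.1, !h.1.2), xor h.2 (xor h.1.2 (D.positive h.1.1)))
  invFun h := ((h.1.1, !h.1.2), xor h.2 (xor (!h.1.2) (D.positive h.1.1)))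
  left_inv := by
    rintro ⟨⟨c, s⟩, d⟩
    cases s <;> cases d <;> cases h : D.positive c <;> simp [h]
  right_inv := by
    rintro ⟨⟨c, s⟩, d⟩
    cases s <;> cases d <;> cases h : D.positive c <;> simp [h]

/-- The cycles of this permutation are the faces of the diagram. -/
def face (D : GaussDiagram) : Equiv.Perm D.HalfEdge := D.rotate * D.otherEnd

/-- The number of connected pieces of the underlying 4-valent graph. -/
noncomputable def numPieces (D : GaussDiagram) : ℕ :=
  Nat.card (MulAction.orbitRel.Quotient
    (Subgroup.closure ({D.rotate, D.otherEnd} : Set (Equiv.Perm D.HalfEdge))) D.HalfEdge)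

/-- Euler's formula `V - E + F = 2 C`: every connected piece of the 4-valent
graph is drawn on the sphere. -/
def Planar (D : GaussDiagram) : Prop :=
  D.n + numCycles D.face = 2 * D.n + 2 * D.numPieces

/-- Crossing change at `c`. -/
def switch (D : GaussDiagram) (c : Fin D.n) : GaussDiagram where
  n := D.n
  positive := Function.update D.positive c (!D.positive c)
  next := flipOn {c} * D.next * flipOn {c}
  circles := D.circles

/-- Cut the diagram at the crossings in `S` and reconnect it there according to the orientation:
whoever arrives at the passage `x` of a crossing in `S` leaves along the other passage.
The crossings in `S` are still listed, as mere marked points `(c, true)`, `(c, false)` at the places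
where the curves arrive at the former crossing; see `Deletes` for forgetting them. -/
def smooth (D : GaussDiagram) (S : Finset (Fin D.n)) : GaussDiagram where
  n := D.n
  positive := D.positive
  next := D.next * flipOn S
  circles := D.circles

/-- `E` is obtained from `D` by forgetting the crossings in `T` and the points `(c, _)` for `c ∈ T`
on the curves of `D`; the other crossings of `D` are those of `E` via `f`. Components of
`D` without other crossings become circles of `E`. -/
structure Deletes (D : GaussDiagram) (T : Finset (Fin D.n)) (E : GaussDiagram)
    (f : Fin E.n → Fin D.n) : Prop where
  injective : Function.Injective f
  range : ∀ c, c ∈ Set.range f ↔ c ∉ T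
  positive : ∀ c, D.positive (f c) = E.positive c
  next : ∀ x : Fin E.n × Bool, ∃ k : ℕ,
    (D.next ^ (k + 1)) (f x.1, x.2) = (f (E.next x).1, (E.next x).2) ∧
    ∀ j < k, ((D.next ^ (j + 1)) (f x.1, x.2)).1 ∈ T
  components : E.numComponents = D.numComponents

/-- The same diagram up to the numbering of the crossings. -/
def Iso (D E : GaussDiagram) : Prop := ∃ f, D.Deletes ∅ E f

/-- First Reidemeister move: `E` results from `D` by removing a kink. -/
def ReidemeisterOne (D E : GaussDiagram) : Prop :=
  ∃ (c : Fin D.n) (b : Bool), D.next (c, b) = (c, !b) ∧ ∃ f, D.Deletes {c} E f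

/-- Second Reidemeister move: `E` results from `D` by removing two crossings `c`, `d` of
opposite signs which are consecutive both on an over-going and on an under-going strand. -/
def ReidemeisterTwo (D E : GaussDiagram) : Prop :=
  ∃ c d : Fin D.n, c ≠ d ∧ D.positive c = !D.positive d ∧
    D.next (c, true) = (d, true) ∧
    (D.next (c, false) = (d, false) ∨ D.next (d, false) = (c, false)) ∧
    ∃ f, D.Deletes {c, d} E f

/-- The exchange of the two passages at the ends of the edge containing the half-edge `h`. -/
def swapEnds (D : GaussDiagram) (h : D.HalfEdge) : Equiv.Perm (Fin D.n × Bool) :=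
  Equiv.swap h.1 (D.otherEnd h).1

/-- Third Reidemeister move: there is a triangular face with three different corners and with
edges (containing the half-edges) `h₁`, `h₂`, `h₃` one of which is over-going at both ends and one
under-going at both ends; the two passages on each edge are put in the opposite order. -/
def ReidemeisterThree (D E : GaussDiagram) : Prop :=
  ∃ h₁ h₂ h₃ : D.HalfEdge,
    D.face h₁ = h₂ ∧ D.face h₂ = h₃ ∧ D.face h₃ = h₁ ∧
    h₁.1.1 ≠ h₂.1.1 ∧ h₂.1.1 ≠ h₃.1.1 ∧ h₃.1.1 ≠ h₁.1.1 ∧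
    (∃ h ∈ ({h₁, h₂, h₃} : Set D.HalfEdge), h.1.2 = true ∧ (D.otherEnd h).1.2 = true) ∧
    (∃ h ∈ ({h₁, h₂, h₃} : Set D.HalfEdge), h.1.2 = false ∧ (D.otherEnd h).1.2 = false) ∧
    E = { n := D.n
          positive := D.positive
          next := (D.swapEnds h₁ * D.swapEnds h₂ * D.swapEnds h₃) * D.next *
            (D.swapEnds h₁ * D.swapEnds h₂ * D.swapEnds h₃)⁻¹
          circles := D.circles }

/-- `E` is obtained from `D` by lassoing at the crossing `p`: the crossing `p` is changed, and a
loop is added which runs once around `p` in a small circle and so that the diagram is alternating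
there. Let `a` be the strand that is over at `p` in `D`, hence under at `p` in `E`, and `b` the
other strand. The loop crosses `a` at `ai` before `p` and at `ao` after `p`, going under `a`, and it
crosses `b` at `bi` before `p` and at `bo` after `p`, going over `b`. The loop may have either
orientation (`ccw` says whether it runs counterclockwise around `p`). -/
def IsLassoAt (D : GaussDiagram) (p : Fin D.n) (E : GaussDiagram) : Prop :=
  ∃ (f : Fin D.n → Fin E.n) (ai ao bi bo : Fin E.n) (ccw : Bool),
    [ai, ao, bi, bo].Nodup ∧
    -- without the four new crossings, one sees the changed diagram and a free loop
    E.Deletes {ai, ao, bi, bo} { D.switch p with circles := D.circles + 1 } f ∧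
    -- the strand `a`
    E.next (ai, true) = (f p, false) ∧ E.next (f p, false) = (ao, true) ∧
    -- the strand `b`
    E.next (bi, false) = (f p, true) ∧ E.next (f p, true) = (bo, false) ∧
    -- the loop
    (if ccw = E.positive (f p) then
      E.next (bo, true) = (ao, false) ∧ E.next (ao, false) = (bi, true) ∧
      E.next (bi, true) = (ai, false) ∧ E.next (ai, false) = (bo, true)
    else
      E.next (bo, true) = (ai, false) ∧ E.next (ai, false) = (bi, true) ∧
      E.next (bi, true) = (ao, false) ∧ E.next (ao, false) = (bo, true)) ∧
    -- the signs of the new crossings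
    E.positive ao = ccw ∧ E.positive bi = ccw ∧ E.positive ai = !ccw ∧ E.positive bo = !ccw

/-- Sign of a crossing. -/
def sign (D : GaussDiagram) (c : Fin D.n) : ℤ := if D.positive c then 1 else -1

/-- Starting on the edge that leads to the over-passage of crossing number `0` and walking along the
diagram smoothed at `S`, one meets every crossing of `S` and arrives there for
the first time on the strand that was its under-strand. -/
def Ascending (D : GaussDiagram) (S : Finset (Fin D.n)) : Prop :=
  ∀ c ∈ S, ∃ k : ℕ,
    ((D.smooth S).next ^ k) (⟨0, Fin.pos c⟩, true) = (c, false) ∧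
    ∀ j < k, ((D.smooth S).next ^ j) (⟨0, Fin.pos c⟩, true) ≠ (c, true)

open Classical in
/-- The Conway polynomial, as the state sum to which the skein relation leads when one
walks along the diagram from a base point and makes it descending: the sum of
`∏_{c ∈ S} sign c * z ^ |S|` over the sets `S` of crossings such that the diagram smoothed at `S`
has one component and `S` is ascending. -/
noncomputable def conway (D : GaussDiagram) : ℤ[X] :=
  ∑ S : Finset (Fin D.n),
    if (D.smooth S).numComponents = 1 ∧ D.Ascending S then
      C (∏ c ∈ S, D.sign c) * X ^ S.card
    else 0

end GaussDiagram

/-- An oriented link diagram on the sphere. (The mutual position of the connected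
pieces of the diagram and of its circles, which does not affect the link, is not recorded.) -/
structure LinkDiagram extends GaussDiagram where
  planar : toGaussDiagram.Planar

/-- Two diagrams that agree or differ by one Reidemeister move. -/
def LinkDiagram.Move (D E : LinkDiagram) : Prop :=
  D.Iso E.toGaussDiagram ∨ D.ReidemeisterOne E.toGaussDiagram ∨
    D.ReidemeisterTwo E.toGaussDiagram ∨ D.ReidemeisterThree E.toGaussDiagram

/-- Equivalence of oriented link diagrams: the equivalence relation generated by the Reidemeister
moves. -/
def LinkDiagram.equivalence : Setoid LinkDiagram := Relation.EqvGen.setoid LinkDiagram.Move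

/-- Oriented links in the 3-sphere up to isotopy. -/
def OrientedLink : Type := Quotient LinkDiagram.equivalence

/-- The oriented link represented by a diagram. -/
def LinkDiagram.link (D : LinkDiagram) : OrientedLink := Quotient.mk LinkDiagram.equivalence D

namespace OrientedLink

/-- A knot is a link with one component. -/
def IsKnot (K : OrientedLink) : Prop := ∃ D : LinkDiagram, D.link = K ∧ D.numComponents = 1

/-- `L` is obtained from `K` by a lassoing at some crossing of some diagram of `K`. -/
def IsLassoing (K L : OrientedLink) : Prop :=
  ∃ (D E : LinkDiagram) (p : Fin D.n), D.link = K ∧ E.link = L ∧ D.IsLassoAt p E.toGaussDiagram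

/-- `L` is obtained from `K` by `r`-iterated lassoings. -/
def IsIteratedLassoing : ℕ → OrientedLink → OrientedLink → Prop
  | 0, K, L => K = L
  | r + 1, K, L => ∃ M : OrientedLink, IsIteratedLassoing r K M ∧ M.IsLassoing L

/-- The defining properties of the Conway polynomial of oriented links: it is `1` on the trivial
knot, and `∇(L₊) - ∇(L₋) = z ∇(L₀)` for a skein triple. -/
structure IsConwayPolynomial (nabla : OrientedLink → ℤ[X]) : Prop where
  unknot : ∀ D : LinkDiagram, D.n = 0 → D.circles = 1 → nabla D.link = 1
  skein : ∀ (Dpos Dneg Dzero : LinkDiagram) (c : Fin Dpos.n), Dpos.positive c = true →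
    Dneg.toGaussDiagram = Dpos.switch c →
    (∃ f, (Dpos.smooth {c}).Deletes {c} Dzero.toGaussDiagram f) →
    nabla Dpos.link - nabla Dneg.link = X * nabla Dzero.link

/-- The Conway polynomial of an oriented link, computed from a diagram. -/
noncomputable def conway (L : OrientedLink) : ℤ[X] := (Quotient.out L).toGaussDiagram.conway

end OrientedLink

/-!
# Lassoing keeps the Conway polynomial nonzero

Everything rests on a state sum `stateSum` with two parameters more than in the definition of
`GaussDiagram.conway`: a base point, and a set of *live* crossings, the other ones being mere pairs
of marked points. For every base point, and without any planarity, it satisfies the skein relation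
(`stateSum_skein`), and it can be expanded by walking along the diagram: a crossing that follows the
base point along its over-strand may be dropped (`stateSum_over`), one that follows along its
under-strand gives a branching (`stateSum_under`), and the base point may pass marked points
(`stateSum_next`). Marked points may be forgotten, renamed and slid over other points
(`stateSum_transport`, `stateSum_slide`).

Planarity is needed for one thing only: that the state sum does not depend on the base point
(`GaussDiagram.stateSum_base`). The proof compares it with the determinant `walkDet` of a random
walk along the diagram, in which the walker may turn, with a weight depending on a parameter `s`,
where he arrives along the over-strand; the walk ends at the base point. The determinant satisfies
the same skein relation with `z = s - s⁻¹` (`walkDet_skein`), and it is easy to compute for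
descending diagrams of knots (triangular matrix) and for split ones (singular matrix). By skein
induction it equals the state sum times a power of `s` (`walkDet_eq_stateSum`). That the exponent is
the same for all descending diagrams in the induction means that all smoothings that are a single
curve have the same rotation number, which is expressed by Whitney's formula: two such smoothings
are connected by surgeries at pairs of interlaced crossings, and these do not change the number because
two closed curves on the sphere have intersection number zero (`rotation_eq`,
`sum_intersection_eq_zero`). On the other hand, the base point selects a diagonal minor of one and
the same matrix. Its rows have the sum zero, and a stationary measure of the walk is known: the
powers of `s⁻²` whose exponents are given by an Alexander numbering (`vecMul_walkMatrix`). So the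
minors are known up to a common factor (`mul_det_updateCol_single`), and the dependence on the base
point cancels against that of the power of `s`. Both the vanishing of intersection numbers and the
Alexander numbering come from Euler's formula, which says that every cycle on the diagram bounds
(`exists_faceBoundary_eq`).

With the base point at one's disposal, invariance under the Reidemeister moves is easy: with the
base point before the over-passages of a strand that is moved, the crossings on this strand can be
dropped. The skein relation of the invariant is that of the state sum
(`conway_isConwayPolynomial`).

For a diagram `E` that results from `D` by lassoing at `p`, the base point is put on the loop. The
expansion of the state sum of `E` on the crossings of the loop and `p` leads to the state sums of
`D` and of its smoothing at `p`, with coefficients in which all cancels but one term: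
`∇(E) = ± z ^ 3 ∇(D)` (`IsLasso.liveSum_eq`). So lassoing does not make the polynomial vanish. For a
knot it does not vanish because its constant term is one (`conway_ne_zero_of_knot`).
-/

/-! ### Walks of a permutation -/

/-- Starting at `b` and iterating `τ`, one meets `x`, and not `y` any earlier. -/
def ReachesBefore {α : Type*} (τ : α → α) (b x y : α) : Prop :=
  ∃ k, τ^[k] b = x ∧ ∀ j < k, τ^[j] b ≠ y

namespace ReachesBefore

variable {α : Type*} {τ : α → α} {b x y : α}

lemma refl (τ : α → α) (b y : α) : ReachesBefore τ b b y := ⟨0, rfl, by simp⟩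

lemma asymm (h : ReachesBefore τ b x y) (hxy : x ≠ y) : ¬ ReachesBefore τ b y x := by
  rintro ⟨l, hl, hl'⟩
  obtain ⟨k, hk, hk'⟩ := h
  rcases lt_trichotomy k l with h | h | h
  · exact hl' k h hk
  · subst h; exact hxy (hk.symm.trans hl)
  · exact hk' l h hl

lemma not_start (hxb : x ≠ b) : ¬ ReachesBefore τ b x b := by
  rintro ⟨k, hk, hk'⟩
  rcases Nat.eq_zero_or_pos k with h | h
  · subst h; exact hxb hk.symm
  · exact hk' 0 h rfl

lemma iff_next (hx : x ≠ b) (hy : y ≠ b) :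
    ReachesBefore τ b x y ↔ ReachesBefore τ (τ b) x y := by
  constructor
  · rintro ⟨k, hk, hk'⟩
    obtain _ | k := k
    · exact absurd hk.symm hx
    · exact ⟨k, hk, fun j hj => hk' (j + 1) (by omega)⟩
  · rintro ⟨k, hk, hk'⟩
    refine ⟨k + 1, hk, fun j hj => ?_⟩
    obtain _ | j := j
    · exact fun h => hy h.symm
    · exact hk' j (by omega)

lemma of_next (hy : y ≠ b) (h : ReachesBefore τ (τ b) x y) : ReachesBefore τ b x y := by
  obtain ⟨k, hk, hk'⟩ := h
  refine ⟨k + 1, hk, fun j hj => ?_⟩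
  obtain _ | j := j
  · exact fun h => hy h.symm
  · exact hk' j (by omega)

lemma total (h : ∃ k, τ^[k] b = x) : ReachesBefore τ b x y ∨ ReachesBefore τ b y x := by
  classical
  have hex : ∃ k, τ^[k] b = x ∨ τ^[k] b = y := by
    obtain ⟨k, hk⟩ := h; exact ⟨k, Or.inl hk⟩
  have hmin : ∀ j < Nat.find hex, τ^[j] b ≠ x ∧ τ^[j] b ≠ y := fun j hj => by
    have := Nat.find_min hex hj; tauto
  rcases Nat.find_spec hex with h | h
  · exact Or.inl ⟨_, h, fun j hj => (hmin j hj).2⟩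
  · exact Or.inr ⟨_, h, fun j hj => (hmin j hj).1⟩

end ReachesBefore

lemma sameCycle_iff_exists_iterate {α : Type*} [Finite α] {τ : Equiv.Perm α} {x y : α} :
    τ.SameCycle x y ↔ ∃ k : ℕ, (⇑τ)^[k] x = y := by
  constructor
  · intro h
    obtain ⟨k, -, hk⟩ := h.exists_pow_eq'
    exact ⟨k, by rw [Equiv.Perm.iterate_eq_pow]; exact hk⟩
  · rintro ⟨k, hk⟩
    exact ⟨k, by rw [Equiv.Perm.iterate_eq_pow] at hk; simpa using hk⟩

lemma sameCycle_iff_reachesBefore {α : Type*} [Finite α] {τ : Equiv.Perm α} {x y : α} :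
    τ.SameCycle x y ↔ ReachesBefore τ x y y := by
  rw [sameCycle_iff_exists_iterate]
  constructor
  · intro h
    have := ReachesBefore.total (y := y) h
    tauto
  · rintro ⟨k, hk, -⟩; exact ⟨k, hk⟩

/-- A set that a permutation of a finite type maps into itself is a union of cycles. -/
lemma sameCycle_mem_of_mapsTo {α : Type*} [Finite α] {τ : Equiv.Perm α} {A : Set α}
    (hA : ∀ x ∈ A, τ x ∈ A) {x y : α} (h : τ.SameCycle x y) (hx : x ∈ A) : y ∈ A := by
  obtain ⟨k, rfl⟩ := sameCycle_iff_exists_iterate.1 h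
  clear h
  induction k generalizing x with
  | zero => exact hx
  | succ k ih => exact ih (hA x hx)

lemma reachesBefore_conj {α : Type*} (τ π : Equiv.Perm α) (b x y : α) :
    ReachesBefore (π * τ * π⁻¹ : Equiv.Perm α) (π b) (π x) (π y) ↔ ReachesBefore τ b x y := by
  have h : ∀ k, (⇑(π * τ * π⁻¹ : Equiv.Perm α))^[k] (π b) = π ((⇑τ)^[k] b) := by
    intro k
    induction k with
    | zero => rfl
    | succ k ih => rw [Function.iterate_succ_apply', ih, Function.iterate_succ_apply']; simp
  unfold ReachesBefore
  simp only [h, ne_eq, EmbeddingLike.apply_eq_iff_eq]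

/-! ### Flips -/

section flip
variable {n : ℕ}

lemma flipOn_apply (S : Finset (Fin n)) (x : Fin n × Bool) :
    flipOn S x = if x.1 ∈ S then (x.1, !x.2) else x := rfl

lemma flipOn_of_notMem {S : Finset (Fin n)} {x : Fin n × Bool} (h : x.1 ∉ S) :
    flipOn S x = x := by simp [flipOn_apply, h]

lemma flipOn_of_mem {S : Finset (Fin n)} {x : Fin n × Bool} (h : x.1 ∈ S) :
    flipOn S x = (x.1, !x.2) := by simp [flipOn_apply, h]

@[simp] lemma flipOn_fst (S : Finset (Fin n)) (x : Fin n × Bool) : (flipOn S x).1 = x.1 := by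
  rw [flipOn_apply]; split_ifs <;> rfl

@[simp] lemma flipOn_empty : flipOn (∅ : Finset (Fin n)) = 1 := by ext x <;> simp [flipOn_apply]

lemma flipOn_mul (S S' : Finset (Fin n)) : flipOn S * flipOn S' = flipOn (symmDiff S S') := by
  ext x : 1
  rw [Equiv.Perm.mul_apply]
  by_cases h : x.1 ∈ S <;> by_cases h' : x.1 ∈ S' <;>
    simp [flipOn_apply, h, h', Finset.mem_symmDiff]

lemma flipOn_comm (S S' : Finset (Fin n)) : flipOn S * flipOn S' = flipOn S' * flipOn S := by
  rw [flipOn_mul, flipOn_mul, symmDiff_comm]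

@[simp] lemma flipOn_inv (S : Finset (Fin n)) : (flipOn S)⁻¹ = flipOn S := by
  rw [inv_eq_iff_mul_eq_one, flipOn_mul]; simp

lemma flipOn_insert {c : Fin n} {S : Finset (Fin n)} (hc : c ∉ S) :
    flipOn (insert c S) = flipOn {c} * flipOn S := by
  rw [flipOn_mul]; congr 1; ext d
  simp only [Finset.mem_insert, Finset.mem_symmDiff, Finset.mem_singleton]
  constructor
  · rintro (rfl | h)
    · exact Or.inl ⟨rfl, hc⟩
    · exact Or.inr ⟨h, fun h' => hc (h' ▸ h)⟩
  · tauto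

end flip

/-! ### The state sum with live crossings and a base point -/

section stateSum
variable {n : ℕ} {R : Type*} [CommRing R]

/-- The weight of a smoothed crossing: `η c`, the sign with which the passage `(c, true)` crosses
`(c, false)`, corrected by which of the two is over. -/
def crossingWeight (η : Fin n → R) (o : Fin n → Bool) (c : Fin n) : R :=
  if o c then η c else -η c

/-- The smoothing at `S` is a single closed curve on which, starting with the arrival at `b`, one
reaches each crossing of `S` first along its under-strand; `(c, o c)` is the over-passage at `c`. -/
def IsState (σ : Equiv.Perm (Fin n × Bool)) (o : Fin n → Bool) (b : Fin n × Bool)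
    (S : Finset (Fin n)) : Prop :=
  (∀ y, (σ * flipOn S).SameCycle b y) ∧
    ∀ c ∈ S, ReachesBefore ⇑(σ * flipOn S) b (c, !o c) (c, o c)

open Classical in
/-- The state sum over the sets of *live* crossings (those in `T`), with base point just before the
passage `b`. The crossings outside `T` are mere pairs of marked points. -/
noncomputable def stateSum (σ : Equiv.Perm (Fin n × Bool)) (η : Fin n → R) (o : Fin n → Bool)
    (T : Finset (Fin n)) (b : Fin n × Bool) : R :=
  ∑ S ∈ T.powerset, if IsState σ o b S then ∏ c ∈ S, crossingWeight η o c else 0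

variable {σ : Equiv.Perm (Fin n × Bool)} {η : Fin n → R} {o o' : Fin n → Bool}
  {T : Finset (Fin n)} {b : Fin n × Bool} {c : Fin n}

lemma isState_congr {S : Finset (Fin n)} (h : ∀ c ∈ S, o c = o' c) :
    IsState σ o b S ↔ IsState σ o' b S := by
  unfold IsState
  refine and_congr_right fun _ => forall₂_congr fun c hc => by rw [h c hc]

lemma stateSum_congr (h : ∀ c ∈ T, o c = o' c) :
    stateSum σ η o T b = stateSum σ η o' T b := by
  classical
  refine Finset.sum_congr rfl fun S hS => ?_
  rw [Finset.mem_powerset] at hS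
  have hp : ∏ c ∈ S, crossingWeight η o c = ∏ c ∈ S, crossingWeight η o' c :=
    Finset.prod_congr rfl fun c hc => by simp [crossingWeight, h c (hS hc)]
  rw [hp, if_congr (isState_congr fun c hc => h c (hS hc)) rfl rfl]

lemma map_stateSum {R' : Type*} [CommRing R'] (φ : R →+* R') :
    φ (stateSum σ η o T b) = stateSum σ (fun c => φ (η c)) o T b := by
  classical
  simp only [stateSum, map_sum]
  refine Finset.sum_congr rfl fun S _ => ?_
  split_ifs
  · rw [map_prod]
    refine Finset.prod_congr rfl fun c _ => ?_
    simp only [crossingWeight]; split_ifs <;> simp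
  · simp

lemma isState_insert {S : Finset (Fin n)} (hc : c ∉ S) :
    IsState σ o b (insert c S) ↔ IsState (σ * flipOn {c}) o b S ∧
      ReachesBefore ⇑(σ * flipOn {c} * flipOn S) b (c, !o c) (c, o c) := by
  unfold IsState
  rw [flipOn_insert hc, ← mul_assoc]
  simp only [Finset.mem_insert, forall_eq_or_imp]
  tauto

open Classical in
lemma stateSum_eq_add (hc : c ∈ T) :
    stateSum σ η o T b = stateSum σ η o (T.erase c) b +
      crossingWeight η o c * ∑ S ∈ (T.erase c).powerset,
        if IsState (σ * flipOn {c}) o b S ∧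
          ReachesBefore ⇑(σ * flipOn {c} * flipOn S) b (c, !o c) (c, o c)
        then ∏ d ∈ S, crossingWeight η o d else 0 := by
  conv_lhs => rw [stateSum, ← Finset.insert_erase hc]
  rw [Finset.sum_powerset_insert (Finset.notMem_erase c T), ← stateSum, Finset.mul_sum]
  congr 1
  refine Finset.sum_congr rfl fun S hS => ?_
  have hcS : c ∉ S := fun h => Finset.notMem_erase c T (Finset.mem_powerset.1 hS h)
  rw [if_congr (isState_insert hcS) rfl rfl, Finset.prod_insert hcS]
  split_ifs <;> simp

/-- If no state contains `c`, the crossing `c` may be treated as a pair of marked points. -/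
lemma stateSum_eq_erase (h : ∀ S, c ∉ S → S ⊆ T → IsState (σ * flipOn {c}) o b S →
    ¬ ReachesBefore ⇑(σ * flipOn {c} * flipOn S) b (c, !o c) (c, o c)) :
    stateSum σ η o T b = stateSum σ η o (T.erase c) b := by
  classical
  by_cases hc : c ∈ T
  · rw [stateSum_eq_add hc, Finset.sum_eq_zero, mul_zero, add_zero]
    intro S hS
    rw [Finset.mem_powerset, Finset.subset_erase] at hS
    exact if_neg fun h' => h S hS.2 hS.1 h'.1 h'.2
  · rw [Finset.erase_eq_of_notMem hc]

/-- A crossing whose over-passage follows the base point belongs to no state. -/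
lemma stateSum_over (h : b = (c, o c)) :
    stateSum σ η o T b = stateSum σ η o (T.erase c) b := by
  refine stateSum_eq_erase fun S _ _ _ h' => ?_
  rw [h] at h'
  exact ReachesBefore.not_start (by simp) h'

/-- The state sum branches at a live crossing whose under-passage follows the base point. -/
lemma stateSum_under (hc : c ∈ T) (h : b = (c, !o c)) :
    stateSum σ η o T b = stateSum σ η o (T.erase c) b +
      crossingWeight η o c * stateSum (σ * flipOn {c}) η o (T.erase c) b := by
  classical
  rw [stateSum_eq_add hc]
  congr 2
  refine Finset.sum_congr rfl fun S _ => if_congr ?_ rfl rfl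
  rw [and_iff_left]
  rw [h]; exact ReachesBefore.refl _ _ _

/-- The base point may pass a marked point that is not live. -/
lemma stateSum_next (h : b.1 ∉ T) : stateSum σ η o T b = stateSum σ η o T (σ b) := by
  classical
  refine Finset.sum_congr rfl fun S hS => if_congr ?_ rfl rfl
  rw [Finset.mem_powerset] at hS
  have hbS : b.1 ∉ S := fun h' => h (hS h')
  have hτ : (σ * flipOn S) b = σ b := by rw [Equiv.Perm.mul_apply, flipOn_of_notMem hbS]
  unfold IsState
  refine and_congr (forall_congr' fun y => ?_) (forall₂_congr fun c hc => ?_)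
  · rw [← hτ, Equiv.Perm.sameCycle_apply_left]
  · have hcb : ∀ x, (c, x) ≠ b := fun x hx => hbS (by rw [← hx]; exact hc)
    rw [← hτ, ReachesBefore.iff_next (hcb _) (hcb _)]

/-- A closed curve through dead marked points only splits off. -/
lemma not_forall_sameCycle_of_dead {S T : Finset (Fin n)} (hS : S ⊆ T) {Z : Set (Fin n × Bool)}
    (hZ : ∀ x ∈ Z, x.1 ∉ T ∧ σ x ∈ Z) (hne : Z.Nonempty) (hne' : Zᶜ.Nonempty)
    (h : ∀ y, (σ * flipOn S).SameCycle b y) : False := by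
  have hZ' : ∀ x ∈ Z, (σ * flipOn S) x ∈ Z := fun x hx => by
    rw [Equiv.Perm.mul_apply, flipOn_of_notMem fun h' => (hZ x hx).1 (hS h')]
    exact (hZ x hx).2
  obtain ⟨x, hx⟩ := hne
  obtain ⟨y, hy⟩ := hne'
  exact hy (sameCycle_mem_of_mapsTo hZ' ((h x).symm.trans (h y)) hx)

lemma stateSum_eq_zero_of_dead {Z : Set (Fin n × Bool)}
    (hZ : ∀ x ∈ Z, x.1 ∉ T ∧ σ x ∈ Z) (hne : Z.Nonempty) (hne' : Zᶜ.Nonempty) :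
    stateSum σ η o T b = 0 := by
  classical
  refine Finset.sum_eq_zero fun S hS => if_neg fun h => ?_
  exact not_forall_sameCycle_of_dead (Finset.mem_powerset.1 hS) hZ hne hne' h.1

/-- A crossing at which the smoothing splits off a curve through dead marked points belongs to no
state. -/
lemma stateSum_kink {Z : Set (Fin n × Bool)}
    (hZ : ∀ x ∈ Z, x.1 ∉ T.erase c ∧ (σ * flipOn {c}) x ∈ Z) (hne : Z.Nonempty)
    (hne' : Zᶜ.Nonempty) :
    stateSum σ η o T b = stateSum σ η o (T.erase c) b := by
  refine stateSum_eq_erase fun S hcS hS h => ?_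
  exact (not_forall_sameCycle_of_dead (Finset.subset_erase.2 ⟨hS, hcS⟩) hZ hne hne' h.1).elim

/-- The skein relation; it holds for every base point. -/
lemma stateSum_skein (hc : c ∈ T) (ho : o c = true) :
    stateSum σ η o T b = stateSum σ η (Function.update o c false) T b +
      η c * stateSum (σ * flipOn {c}) η o (T.erase c) b := by
  classical
  have hne : ∀ d ∈ T.erase c, o d = Function.update o c false d := fun d hd => by
    rw [Function.update_of_ne (Finset.ne_of_mem_erase hd)]
  rw [stateSum_eq_add hc, stateSum_eq_add hc, stateSum_congr hne, add_assoc]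
  congr 1
  simp only [crossingWeight, ho, Function.update_self, if_true, Bool.false_eq_true, if_false,
    Bool.not_true, Bool.not_false]
  rw [← sub_eq_iff_eq_add', neg_mul, sub_neg_eq_add, ← mul_add, ← Finset.sum_add_distrib]
  congr 1
  refine Finset.sum_congr rfl fun S hS => ?_
  have hS' := Finset.mem_powerset.1 hS
  have hst : IsState (σ * flipOn {c}) (Function.update o c false) b S ↔
      IsState (σ * flipOn {c}) o b S := (isState_congr fun d hd => hne d (hS' hd)).symm
  have hprod : ∏ d ∈ S, (if Function.update o c false d then η d else -η d) =
      ∏ d ∈ S, (if o d then η d else -η d) :=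
    Finset.prod_congr rfl fun d hd => by rw [← hne d (hS' hd)]
  simp only [hst, hprod]
  by_cases h : IsState (σ * flipOn {c}) o b S
  · have h1 := h.1 (c, false)
    rw [sameCycle_iff_exists_iterate] at h1
    rcases ReachesBefore.total (y := (c, true)) h1 with h2 | h2
    · have h3 := h2.asymm (by simp)
      simp only [h, h2, h3, and_false, true_and, if_true, if_false, add_zero]
      rfl
    · have h3 := h2.asymm (by simp)
      simp only [h, h2, h3, and_false, true_and, if_true, if_false, zero_add]
      rfl
  · simp [h]

/-- On the way from `b` to the first passage of a crossing of `S`, smoothing at `S` makes no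
difference. -/
lemma exists_first_mem_iterate (S : Finset (Fin n)) {c : Fin n} (hc : c ∈ S)
    (h : ∀ y, (σ * flipOn S).SameCycle b y) :
    ∃ k, (σ^[k] b).1 ∈ S ∧ (∀ j < k, (σ^[j] b).1 ∉ S) ∧
      ∀ j ≤ k, (⇑(σ * flipOn S))^[j] b = σ^[j] b := by
  classical
  obtain ⟨m, hm⟩ := sameCycle_iff_exists_iterate.1 (h (c, true))
  have hex : ∃ k, ((⇑(σ * flipOn S))^[k] b).1 ∈ S := ⟨m, by rw [hm]; exact hc⟩
  have hagree : ∀ j ≤ Nat.find hex, (⇑(σ * flipOn S))^[j] b = σ^[j] b := by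
    intro j
    induction j with
    | zero => intro _; rfl
    | succ j ih =>
      intro hj
      have h1 := Nat.find_min hex (m := j) (by omega)
      rw [Function.iterate_succ_apply', Function.iterate_succ_apply', ← ih (by omega),
        Equiv.Perm.mul_apply, flipOn_of_notMem h1]
  refine ⟨Nat.find hex, ?_, fun j hj => ?_, hagree⟩
  · rw [← hagree _ le_rfl]; exact Nat.find_spec hex
  · rw [← hagree j hj.le]; exact Nat.find_min hex hj

/-- Starting at `b`, the first passage of a crossing of a nonempty state `S` is an
under-passage. -/
lemma IsState.exists_first_under {S : Finset (Fin n)} (hS : IsState σ o b S)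
    (hne : S.Nonempty) :
    ∃ k, ∃ c ∈ S, σ^[k] b = (c, !o c) ∧ ∀ j < k, (σ^[j] b).1 ∉ S := by
  obtain ⟨c, hc⟩ := hne
  obtain ⟨k, h1, h2, h3⟩ := exists_first_mem_iterate S hc hS.1
  refine ⟨k, _, h1, ?_, h2⟩
  by_contra hcon
  have heq : σ^[k] b = ((σ^[k] b).1, o (σ^[k] b).1) := by
    ext
    · rfl
    · simp only
      by_contra h4
      apply hcon
      ext
      · rfl
      · simp only
        cases h5 : (σ^[k] b).2 <;> cases h6 : o (σ^[k] b).1 <;> simp_all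
  obtain ⟨m, hm, hm'⟩ := hS.2 _ h1
  rcases lt_trichotomy m k with h | h | h
  · refine h2 m h ?_
    rw [← h3 m h.le, hm]; exact h1
  · subst h
    exact hcon ((h3 m le_rfl).symm.trans hm)
  · exact hm' k h ((h3 k le_rfl).trans heq)

/-- The state sum of a descending diagram of a knot is one. -/
lemma stateSum_descending (hσ : ∀ y, σ.SameCycle b y)
    (h : ∀ c ∈ T, ReachesBefore σ b (c, o c) (c, !o c)) : stateSum σ η o T b = 1 := by
  classical
  rw [stateSum, Finset.sum_eq_single ∅]
  · rw [if_pos, Finset.prod_empty]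
    exact ⟨by simpa using hσ, by simp⟩
  · intro S hS hne
    refine if_neg fun hst => ?_
    obtain ⟨k, c, hc, h1, h2⟩ := hst.exists_first_under (Finset.nonempty_of_ne_empty hne)
    refine (h c (Finset.mem_powerset.1 hS hc)).asymm (by simp) ⟨k, h1, fun j hj h3 => ?_⟩
    exact h2 j hj (by rw [h3]; exact hc)
  · simp

/-- The state sum vanishes if the components through `A`, one of which carries the base point, lie
above the other ones. -/
lemma stateSum_split {A : Set (Fin n × Bool)} (hA : ∀ x, x ∈ A → σ x ∈ A) (hb : b ∈ A)
    (hne : Aᶜ.Nonempty) (h : ∀ c ∈ T, ∀ x, (c, x) ∈ A → (c, !x) ∉ A → o c = x) :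
    stateSum σ η o T b = 0 := by
  classical
  refine Finset.sum_eq_zero fun S hS => if_neg fun hst => ?_
  rw [Finset.mem_powerset] at hS
  -- the smoothing at the crossings of `A` with itself and of `Aᶜ` with itself preserves `A`
  set S₀ : Finset (Fin n) := S.filter fun c => ((c, true) ∈ A ↔ (c, false) ∈ A)
  set M : Finset (Fin n) := S.filter fun c => ¬ ((c, true) ∈ A ↔ (c, false) ∈ A)
  have hdec : flipOn S = flipOn S₀ * flipOn M := by
    rw [flipOn_mul]; congr 1; ext c
    simp only [S₀, M, Finset.mem_symmDiff, Finset.mem_filter]; tauto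
  have hS₀ : ∀ x ∈ A, (σ * flipOn S₀) x ∈ A := by
    rintro ⟨c, x⟩ hx
    rw [Equiv.Perm.mul_apply]
    apply hA
    by_cases hc : c ∈ S₀
    · rw [flipOn_of_mem hc]
      have := (Finset.mem_filter.1 hc).2
      cases x <;> simp_all
    · rwa [flipOn_of_notMem hc]
  obtain ⟨y, hy⟩ := hne
  have hmul : σ * flipOn S = σ * flipOn S₀ * flipOn M := by rw [hdec, mul_assoc]
  have hMne : M.Nonempty := by
    rw [Finset.nonempty_iff_ne_empty]
    intro hM
    have h1 := hst.1 y
    rw [hmul, hM, flipOn_empty, mul_one] at h1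
    exact hy (sameCycle_mem_of_mapsTo hS₀ h1 hb)
  have hst' : IsState (σ * flipOn S₀) o b M := by
    refine ⟨by rw [← hmul]; exact hst.1, fun c hc => ?_⟩
    rw [← hmul]
    exact hst.2 c (Finset.filter_subset _ _ hc)
  obtain ⟨k, c, hc, h1, -⟩ := hst'.exists_first_under hMne
  have h2 : (⇑(σ * flipOn S₀))^[k] b ∈ A :=
    sameCycle_mem_of_mapsTo hS₀ (sameCycle_iff_exists_iterate.2 ⟨k, rfl⟩) hb
  rw [h1] at h2
  have h3 := Finset.mem_filter.1 hc
  have h4 : (c, !!o c) ∉ A := by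
    intro h5
    apply h3.2
    cases h6 : o c <;> simp_all
  have := h c (hS h3.1) _ h2 h4
  simp at this

end stateSum

/-! ### Homology of planar diagrams -/

namespace GaussDiagram

/-- A 1-chain `u` on the edges of `D` is a cycle. The edge that arrives at the passage `x` has the
coefficient `u x`. -/
def IsCycle (D : GaussDiagram) (u : Fin D.n × Bool → ℝ) : Prop :=
  ∀ c, u (c, true) + u (c, false) = u (D.next (c, true)) + u (D.next (c, false))

/-- The incidence matrix of edges and crossings. The row of `x` belongs to the edge that leaves `x`,
so that the kernel of the transposed matrix consists of the cycles. -/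
def incidence (D : GaussDiagram) : Matrix (Fin D.n × Bool) (Fin D.n) ℝ :=
  Matrix.of fun x c => (if x.1 = c then 1 else 0) - (if (D.next x).1 = c then 1 else 0)

lemma incidence_mulVec (D : GaussDiagram) (u : Fin D.n → ℝ) (x : Fin D.n × Bool) :
    D.incidence.mulVec u x = u x.1 - u (D.next x).1 := by
  simp [incidence, Matrix.mulVec, dotProduct, sub_mul, Finset.sum_sub_distrib]

lemma incidence_transpose_mulVec (D : GaussDiagram) (z : Fin D.n × Bool → ℝ) (c : Fin D.n) :
    D.incidence.transpose.mulVec z c =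
      (z (c, true) + z (c, false)) -
        (z (D.next.symm (c, true)) + z (D.next.symm (c, false))) := by
  have h1 : ∀ w : Fin D.n × Bool → ℝ,
      ∑ x : Fin D.n × Bool, (if x.1 = c then w x else 0) = w (c, true) + w (c, false) := by
    intro w
    rw [Fintype.sum_prod_type]
    simp only [Fintype.sum_bool]
    rw [Finset.sum_eq_single c]
    · simp
    · intro d _ hd; simp [hd]
    · simp
  have h2 : ∑ x : Fin D.n × Bool, (if (D.next x).1 = c then z x else 0) =
      z (D.next.symm (c, true)) + z (D.next.symm (c, false)) := by
    rw [← h1 fun y => z (D.next.symm y),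
      ← Equiv.sum_comp D.next fun y => if y.1 = c then z (D.next.symm y) else 0]
    simp
  rw [← h1 z, ← h2]
  simp [incidence, Matrix.mulVec, dotProduct, sub_mul, Finset.sum_sub_distrib]

/-- A function on half-edges that is invariant under the two generators is constant on the connected
pieces of the diagram. -/
lemma eq_of_orbitRel (D : GaussDiagram) {X : Type*} (φ : D.HalfEdge → X)
    (h1 : ∀ h, φ (D.rotate h) = φ h) (h2 : ∀ h, φ (D.otherEnd h) = φ h) {h h' : D.HalfEdge}
    (hh : (MulAction.orbitRel (Subgroup.closure ({D.rotate, D.otherEnd} :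
      Set (Equiv.Perm D.HalfEdge))) D.HalfEdge) h h') : φ h = φ h' := by
  obtain ⟨⟨g, hg⟩, rfl⟩ := MulAction.orbitRel_apply.1 hh
  change φ (g h') = φ h'
  induction hg using Subgroup.closure_induction generalizing h' with
  | mem g hg =>
    rcases hg with rfl | hg
    · exact h1 _
    · rw [Set.mem_singleton_iff.1 hg]; exact h2 _
  | one => rfl
  | mul a b _ _ iha ihb =>
    rw [Equiv.Perm.mul_apply, iha (MulAction.orbitRel_apply.2 ⟨⟨a, ‹_›⟩, rfl⟩),
      ihb (MulAction.orbitRel_apply.2 ⟨⟨b, ‹_›⟩, rfl⟩)]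
  | inv a _ iha =>
    have := iha (h' := a⁻¹ h') (MulAction.orbitRel_apply.2 ⟨⟨a, ‹_›⟩, rfl⟩)
    simpa using this.symm

/-- The map from functions on faces to 1-chains: the coefficient of an edge is the difference of the
values on its right and on its left. -/
noncomputable def faceBoundary (D : GaussDiagram) :
    (Quotient (Equiv.Perm.SameCycle.setoid D.face) → ℝ) →ₗ[ℝ] (Fin D.n × Bool → ℝ) :=
  LinearMap.funLeft ℝ ℝ (fun x => Quotient.mk _ (x, true)) -
    LinearMap.funLeft ℝ ℝ (fun x => Quotient.mk _ (D.otherEnd (x, true)))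

lemma mk_rotate (D : GaussDiagram) (h : D.HalfEdge) :
    Quotient.mk (Equiv.Perm.SameCycle.setoid D.face) (D.rotate h) =
      Quotient.mk (Equiv.Perm.SameCycle.setoid D.face) (D.otherEnd h) := by
  have h1 : D.rotate h = D.face (D.otherEnd h) := by
    rcases h with ⟨x, b⟩
    cases b <;> simp [face, otherEnd]
  rw [h1]
  exact Quotient.sound ((Equiv.Perm.sameCycle_apply_left (f := D.face)).2
    (Equiv.Perm.SameCycle.refl _ _))

lemma faceBoundary_apply (D : GaussDiagram)
    (ψ : Quotient (Equiv.Perm.SameCycle.setoid D.face) → ℝ) (x : Fin D.n × Bool) :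
    D.faceBoundary ψ x = ψ (Quotient.mk _ (x, true)) - ψ (Quotient.mk _ (D.rotate (x, true))) := by
  rw [mk_rotate]; rfl

lemma otherEnd_in (D : GaussDiagram) (x : Fin D.n × Bool) :
    D.otherEnd (x, false) = (D.next.symm x, true) := by simp [otherEnd]

lemma otherEnd_out (D : GaussDiagram) (x : Fin D.n × Bool) :
    D.otherEnd (x, true) = (D.next x, false) := by simp [otherEnd]

lemma faceBoundary_mem_ker (D : GaussDiagram)
    (ψ : Quotient (Equiv.Perm.SameCycle.setoid D.face) → ℝ) :
    D.incidence.transpose.mulVec (D.faceBoundary ψ) = 0 := by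
  funext c
  have h1 : ∀ s, ψ (Quotient.mk _ (D.next.symm (c, s), true)) =
      ψ (Quotient.mk _ (D.rotate ((c, s), false))) := fun s => by
    rw [mk_rotate, otherEnd_in]
  have h2 : ∀ s, ψ (Quotient.mk _ (D.rotate (D.next.symm (c, s), true))) =
      ψ (Quotient.mk _ ((c, s), false)) := fun s => by
    rw [mk_rotate, otherEnd_out, Equiv.apply_symm_apply]
  rw [incidence_transpose_mulVec]
  simp only [faceBoundary_apply, h1, h2]
  cases h : D.positive c <;> simp [rotate, h]

/-- On a planar diagram every cycle is the boundary of a function on the faces. This is where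
Euler's formula enters: it makes the dimensions fit. -/
theorem exists_faceBoundary_eq (D : GaussDiagram) (hD : D.Planar) (z : Fin D.n × Bool → ℝ)
    (hz : D.incidence.transpose.mulVec z = 0) : ∃ ψ, D.faceBoundary ψ = z := by
  classical
  let Ω := MulAction.orbitRel.Quotient
    (Subgroup.closure ({D.rotate, D.otherEnd} : Set (Equiv.Perm D.HalfEdge))) D.HalfEdge
  let Q := Quotient (Equiv.Perm.SameCycle.setoid D.face)
  let _ : Fintype Ω := Fintype.ofFinite Ω
  let _ : Fintype Q := Fintype.ofFinite Q
  have hΩ : Module.finrank ℝ (Ω → ℝ) = D.numPieces := by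
    rw [Module.finrank_fintype_fun_eq_card, ← Nat.card_eq_fintype_card]; rfl
  have hQ : Module.finrank ℝ (Q → ℝ) = numCycles D.face := by
    rw [Module.finrank_fintype_fun_eq_card, ← Nat.card_eq_fintype_card]; rfl
  have hout : ∀ h : D.HalfEdge, MulAction.orbitRel (Subgroup.closure ({D.rotate, D.otherEnd} :
      Set (Equiv.Perm D.HalfEdge))) D.HalfEdge (Quotient.out (Quotient.mk _ h : Ω)) h :=
    fun h => Quotient.exact (Quotient.out_eq (Quotient.mk _ h : Ω))
  -- functions on faces without boundary are constant on the pieces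
  have hker1 : Module.finrank ℝ (LinearMap.ker D.faceBoundary) ≤ D.numPieces := by
    rw [← hΩ]
    let e : (Q → ℝ) →ₗ[ℝ] (Ω → ℝ) := LinearMap.funLeft ℝ ℝ fun ω => Quotient.mk _ (Quotient.out ω)
    refine LinearMap.finrank_le_finrank_of_injective
      (f := e.comp (LinearMap.ker D.faceBoundary).subtype) ?_
    rw [← LinearMap.ker_eq_bot, LinearMap.ker_eq_bot']
    rintro ⟨ψ, hψ⟩ h0
    rw [LinearMap.mem_ker] at hψ
    have ho : ∀ h, ψ (Quotient.mk _ (D.otherEnd h)) = ψ (Quotient.mk _ h) := by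
      rintro ⟨x, s⟩
      cases s
      · have := congrFun hψ (D.next.symm x)
        rw [faceBoundary_apply, mk_rotate, otherEnd_out, Equiv.apply_symm_apply] at this
        rw [otherEnd_in]
        exact sub_eq_zero.1 this
      · have := congrFun hψ x
        rw [faceBoundary_apply, mk_rotate] at this
        exact (sub_eq_zero.1 this).symm
    have hr : ∀ h, ψ (Quotient.mk _ (D.rotate h)) = ψ (Quotient.mk _ h) := fun h => by
      rw [mk_rotate, ho]
    ext q
    induction q using Quotient.inductionOn with
    | h h =>
      have h1 := D.eq_of_orbitRel (fun h => ψ (Quotient.mk _ h)) hr ho (hout h)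
      have h2 := congrFun h0 (Quotient.mk _ h)
      exact h1.symm.trans h2
  -- functions on crossings that are constant along the edges are constant on the pieces
  have hker2 : Module.finrank ℝ (LinearMap.ker D.incidence.mulVecLin) ≤ D.numPieces := by
    rw [← hΩ]
    let e : (Fin D.n → ℝ) →ₗ[ℝ] (Ω → ℝ) := LinearMap.funLeft ℝ ℝ fun ω => (Quotient.out ω).1.1
    refine LinearMap.finrank_le_finrank_of_injective
      (f := e.comp (LinearMap.ker D.incidence.mulVecLin).subtype) ?_
    rw [← LinearMap.ker_eq_bot, LinearMap.ker_eq_bot']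
    rintro ⟨u, hu⟩ h0
    rw [LinearMap.mem_ker, Matrix.mulVecLin_apply] at hu
    have hn : ∀ x, u (D.next x).1 = u x.1 := fun x => by
      have := congrFun hu x
      rw [incidence_mulVec] at this
      exact (sub_eq_zero.1 this).symm
    ext c
    have h1 := D.eq_of_orbitRel (fun h => u h.1.1) (fun h => rfl) (by
      rintro ⟨x, s⟩
      cases s
      · rw [otherEnd_in]
        have := hn (D.next.symm x)
        rw [Equiv.apply_symm_apply] at this
        exact this.symm
      · rw [otherEnd_out]; exact hn x) (hout ((c, true), true))
    exact h1.symm.trans (congrFun h0 (Quotient.mk _ ((c, true), true)))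
  have hr1 := D.faceBoundary.finrank_range_add_finrank_ker
  have hr2 := D.incidence.mulVecLin.finrank_range_add_finrank_ker
  have hr3 := D.incidence.transpose.mulVecLin.finrank_range_add_finrank_ker
  have hr4 : Module.finrank ℝ (LinearMap.range D.incidence.transpose.mulVecLin) =
      Module.finrank ℝ (LinearMap.range D.incidence.mulVecLin) := Matrix.rank_transpose _
  rw [Module.finrank_fintype_fun_eq_card, Fintype.card_fin] at hr2
  rw [Module.finrank_fintype_fun_eq_card, Fintype.card_prod, Fintype.card_fin,
    Fintype.card_bool] at hr3
  change _ = Module.finrank ℝ (Q → ℝ) at hr1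
  rw [hQ] at hr1
  unfold Planar at hD
  have hle : LinearMap.range D.faceBoundary ≤ LinearMap.ker D.incidence.transpose.mulVecLin := by
    rintro _ ⟨ψ, rfl⟩
    rw [LinearMap.mem_ker, Matrix.mulVecLin_apply, faceBoundary_mem_ker]
  have heq := Submodule.eq_of_le_of_finrank_le hle (by omega)
  have : z ∈ LinearMap.range D.faceBoundary := by
    rw [heq, LinearMap.mem_ker, Matrix.mulVecLin_apply, hz]
  exact this

/-- The values of a function on the faces with boundary `u` on the right (`r`) and on the left (`l`)
of the edges, and their agreement at the four corners of each crossing. -/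
theorem IsCycle.exists_right_left {D : GaussDiagram} (hD : D.Planar) {u : Fin D.n × Bool → ℝ}
    (hu : D.IsCycle u) : ∃ r l : Fin D.n × Bool → ℝ, (∀ x, r x - l x = u x) ∧ ∀ c,
      (D.positive c = true → r (D.next (c, true)) = r (c, false) ∧
        l (D.next (c, true)) = r (D.next (c, false)) ∧ l (D.next (c, false)) = l (c, true) ∧
        r (c, true) = l (c, false)) ∧
      (D.positive c = false → r (D.next (c, true)) = l (D.next (c, false)) ∧
        l (D.next (c, true)) = l (c, false) ∧ r (c, false) = l (c, true) ∧
        r (c, true) = r (D.next (c, false))) := by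
  obtain ⟨ψ, hψ⟩ := D.exists_faceBoundary_eq hD (fun x => u (D.next x)) (by
    funext c
    rw [incidence_transpose_mulVec, Equiv.apply_symm_apply, Equiv.apply_symm_apply, hu c, sub_self]
    rfl)
  refine ⟨fun x => ψ (Quotient.mk _ (D.rotate (x, false))), fun x => ψ (Quotient.mk _ (x, false)),
    fun x => ?_, fun c => ?_⟩
  · have := congrFun hψ (D.next.symm x)
    rw [faceBoundary_apply, mk_rotate, otherEnd_out, Equiv.apply_symm_apply] at this
    simp only []
    rw [mk_rotate, otherEnd_in, this]
  · have h1 : ∀ x, (Quotient.mk (Equiv.Perm.SameCycle.setoid D.face)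
        (D.rotate (D.next x, false))) = Quotient.mk _ (x, true) := fun x => by
      rw [mk_rotate, otherEnd_in, Equiv.symm_apply_apply]
    have h2 : ∀ x, (Quotient.mk (Equiv.Perm.SameCycle.setoid D.face) (D.next x, false)) =
        Quotient.mk _ (D.rotate (x, true)) := fun x => by rw [mk_rotate, otherEnd_out]
    simp only [h1]
    simp only [h2]
    constructor <;> intro h <;> simp [rotate, h]

/-- Two closed curves on the sphere have intersection number zero. The two summands count the
crossings of the two curves when these are pushed apart on the incoming and on the outgoing side. -/
theorem sum_intersection_eq_zero {D : GaussDiagram} (hD : D.Planar) {u v : Fin D.n × Bool → ℝ}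
    (hu : D.IsCycle u) (hv : D.IsCycle v) :
    ∑ c, (D.sign c : ℝ) * ((u (c, true) * v (c, false) - u (c, false) * v (c, true)) +
      (u (D.next (c, true)) * v (D.next (c, false)) -
        u (D.next (c, false)) * v (D.next (c, true)))) = 0 := by
  obtain ⟨r, l, hrl, hc⟩ := hu.exists_right_left hD
  have h1 : ∑ x, v x * (r x + l x) - ∑ x, v (D.next x) * (r (D.next x) + l (D.next x)) = 0 := by
    rw [Equiv.sum_comp D.next fun x => v x * (r x + l x), sub_self]
  rw [Fintype.sum_prod_type, Fintype.sum_prod_type, ← Finset.sum_sub_distrib] at h1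
  rw [← h1]
  refine Finset.sum_congr rfl fun c _ => ?_
  simp only [Fintype.sum_bool, ← hrl]
  have hv' := hv c
  obtain ⟨hp, hn⟩ := hc c
  cases h : D.positive c
  · obtain ⟨e1, e2, e3, e4⟩ := hn h
    simp only [sign, h, Bool.false_eq_true, if_false]
    push_cast
    rw [e1, e2, e3, e4]
    linear_combination -(l (c, false) + r (D.next (c, false))) * hv'
  · obtain ⟨e1, e2, e3, e4⟩ := hp h
    simp only [sign, h, if_true]
    push_cast
    rw [e1, e2, e3, e4]
    linear_combination -(r (c, false) + l (c, true)) * hv'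

/-- An Alexander numbering of the faces: the numbers drop by one when an edge is crossed from right
to left. Here `idx x` is the number of the face to the right of the edge that arrives at `x`. -/
theorem Planar.exists_index {D : GaussDiagram} (hD : D.Planar) :
    ∃ idx : Fin D.n × Bool → ℝ, ∀ c, idx (D.next (c, true)) = idx (c, true) + D.sign c ∧
      idx (c, false) = idx (c, true) + D.sign c ∧ idx (D.next (c, false)) = idx (c, true) := by
  obtain ⟨r, l, hrl, hc⟩ := IsCycle.exists_right_left hD (u := fun _ => 1) (fun c => rfl)
  refine ⟨r, fun c => ?_⟩
  obtain ⟨hp, hn⟩ := hc c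
  have h1 := hrl (c, true)
  have h2 := hrl (c, false)
  have h3 := hrl (D.next (c, true))
  have h4 := hrl (D.next (c, false))
  cases h : D.positive c
  · obtain ⟨e1, e2, e3, e4⟩ := hn h
    simp only [sign, h, Bool.false_eq_true, if_false]
    push_cast
    refine ⟨?_, ?_, ?_⟩ <;> linarith
  · obtain ⟨e1, e2, e3, e4⟩ := hp h
    simp only [sign, h, if_true]
    push_cast
    refine ⟨?_, ?_, ?_⟩ <;> linarith

end GaussDiagram

/-! ### Constancy of the rotation number -/

section enum
variable {α : Type*} [Finite α] {τ : Equiv.Perm α} {b : α}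

/-- On a single cycle, the iterates with exponents less than `N`, the length of the cycle, enumerate
the points. -/
lemma exists_enum (hτ : ∀ y, τ.SameCycle b y) : ∃ N, 0 < N ∧
    (∀ i < N, ∀ j < N, τ^[i] b = τ^[j] b → i = j) ∧ (∀ y, ∃ i < N, τ^[i] b = y) ∧
      τ^[N] b = b := by
  have hper : b ∈ Function.periodicPts τ := by
    obtain ⟨k, hk⟩ := sameCycle_iff_exists_iterate.1 ((hτ (τ b)).symm)
    exact ⟨k + 1, Nat.succ_pos k, hk⟩
  have hpos := Function.minimalPeriod_pos_of_mem_periodicPts hper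
  refine ⟨Function.minimalPeriod τ b, hpos, fun i hi j hj h => ?_, fun y => ?_, ?_⟩
  · exact Function.iterate_injOn_Iio_minimalPeriod hi hj h
  · obtain ⟨k, hk⟩ := sameCycle_iff_exists_iterate.1 (hτ y)
    exact ⟨k % Function.minimalPeriod τ b, Nat.mod_lt _ hpos, by
      rw [Function.iterate_mod_minimalPeriod_eq, hk]⟩
  · exact Function.iterate_minimalPeriod

end enum

/-- If `f` visits the points `x i` in the order `x (g 0)`, `x (g 1)`, …, and `h` is the inverse
of `g`, then `h i` is the time of the visit of `x i`. -/
lemma reachesBefore_iff_of_enum {α : Type*} {b : α} {f : α → α} {x : ℕ → α} {N : ℕ} {g h : ℕ → ℕ}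
    (hx : ∀ i < N, ∀ j < N, x i = x j → i = j) (hf : ∀ k < N, f^[k] b = x (g k))
    (hg : ∀ k < N, g k < N) (hh : ∀ i < N, h i < N) (hgh : ∀ i < N, g (h i) = i)
    (hhg : ∀ i < N, h (g i) = i) {i j : ℕ} (hi : i < N) (hj : j < N) (hij : i ≠ j) :
    ReachesBefore f b (x i) (x j) ↔ h i < h j := by
  have key : ∀ i j, i < N → j < N → h i < h j → ReachesBefore f b (x i) (x j) := by
    intro i j hi hj hlt
    refine ⟨h i, by rw [hf _ (hh i hi), hgh i hi], fun m hm he => ?_⟩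
    have hmN : m < N := hm.trans (hh i hi)
    rw [hf m hmN] at he
    have h1 := hx _ (hg m hmN) _ hj he
    have h2 := hhg m hmN
    rw [h1] at h2
    omega
  constructor
  · intro hr
    by_contra hlt
    have hne : h i ≠ h j := fun he => hij (by rw [← hgh i hi, he, hgh j hj])
    refine (key j i hj hi (by omega)).asymm (fun he => hij (hx _ hi _ hj he.symm)) hr
  · exact key i j hi hj

/-- If the positions `0`, `q` on a cyclic sequence are joined and so are `p`, `r`, then surgery at
both pairs leads to a cyclic sequence again, on which the point number `i` has this position. -/
def surgeryOrder (p q r i : ℕ) : ℕ :=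
  if i = 0 then 0 else if i ≤ p then i + (r - p) else if i ≤ q then i - p + (r - q)
    else if i ≤ r then i - q else i

namespace GaussDiagram

variable {D : GaussDiagram}

open Classical in
/-- The number of crossings outside `S`, each counted with the sign with which the first passage
crosses the second one on the walk from `b` along the smoothing at `S`. Up to a term depending on
`b`, this is Whitney's formula for the rotation number of a closed curve. -/
noncomputable def whitneySum (D : GaussDiagram) (S : Finset (Fin D.n)) (b : Fin D.n × Bool) : ℝ :=
  ∑ c, if c ∈ S then 0 else
    (D.sign c : ℝ) *
      if ReachesBefore ⇑(D.next * flipOn S) b (c, true) (c, false) then 1 else -1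

/-- Moving the base point along the curve changes the sum as it changes the Alexander numbering. So
`D.whitneySum S b + 2 * idx b` is the same for all base points; it is the rotation number. -/
lemma whitneySum_next {S : Finset (Fin D.n)} {b : Fin D.n × Bool}
    (hS : ∀ y, (D.next * flipOn S).SameCycle b y) {idx : Fin D.n × Bool → ℝ}
    (hidx : ∀ c, idx (D.next (c, true)) = idx (c, true) + D.sign c ∧
      idx (c, false) = idx (c, true) + D.sign c ∧ idx (D.next (c, false)) = idx (c, true)) :
    D.whitneySum S ((D.next * flipOn S) b) + 2 * idx ((D.next * flipOn S) b) =
      D.whitneySum S b + 2 * idx b := by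
  classical
  obtain ⟨c, s⟩ := b
  obtain ⟨N, hN, hinj, hsurj, -⟩ := exists_enum hS
  -- only the crossing at the base point changes its contribution
  have hret : ReachesBefore ⇑(D.next * flipOn S) ((D.next * flipOn S) (c, s)) (c, !s) (c, s) := by
    obtain ⟨i, hi, hi'⟩ := hsurj (c, !s)
    obtain _ | i := i
    · simp at hi'
    · refine ⟨i, hi', fun j hj h => ?_⟩
      have := hinj (j + 1) (by omega) 0 hN h
      omega
  have hret' := hret.asymm (by simp)
  have hst : ReachesBefore ⇑(D.next * flipOn S) (c, s) (c, s) (c, !s) := ReachesBefore.refl _ _ _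
  have hst' := hst.asymm (by simp)
  have hdiff : D.whitneySum S (c, s) - D.whitneySum S ((D.next * flipOn S) (c, s)) =
      if c ∈ S then 0 else (D.sign c : ℝ) * if s then 2 else -2 := by
    rw [whitneySum, whitneySum, ← Finset.sum_sub_distrib, Finset.sum_eq_single c]
    · by_cases hc : c ∈ S
      · simp [hc]
      · simp only [hc, if_false, ← mul_sub]
        congr 1
        cases s
        · simp only [Bool.not_false] at hret hret' hst hst'
          rw [if_neg hst', if_pos hret]; norm_num
        · simp only [Bool.not_true] at hret hret' hst hst'
          rw [if_pos hst, if_neg hret']; norm_num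
    · intro e _ he
      have h1 : ∀ x, (e, x) ≠ (c, s) := fun x h => he (Prod.ext_iff.1 h).1
      rw [← ReachesBefore.iff_next (h1 _) (h1 _), sub_self]
    · simp
  obtain ⟨h1, h2, h3⟩ := hidx c
  rw [Equiv.Perm.mul_apply, flipOn_apply] at *
  by_cases hc : c ∈ S
  · simp only [hc, if_true] at *
    cases s
    · simp only [Bool.not_false] at *; linarith
    · simp only [Bool.not_true] at *; linarith
  · simp only [hc, if_false] at *
    cases s
    · simp only [Bool.false_eq_true, if_false] at *; linarith
    · simp only [if_true] at *; linarith

lemma surgeryOrder_lt {p q r N i : ℕ} (hp : 0 < p) (hpq : p < q) (hqr : q < r) (hr : r < N)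
    (hi : i < N) : surgeryOrder p q r i < N := by
  unfold surgeryOrder; split_ifs <;> omega

lemma surgeryOrder_surgeryOrder {p q r : ℕ} (hp : 0 < p) (hpq : p < q) (hqr : q < r) (i : ℕ) :
    surgeryOrder p q r (surgeryOrder (r - q) (r - p) r i) = i := by
  unfold surgeryOrder; split_ifs <;> omega

lemma surgeryOrder_surgeryOrder' {p q r : ℕ} (hp : 0 < p) (hpq : p < q) (hqr : q < r) (i : ℕ) :
    surgeryOrder (r - q) (r - p) r (surgeryOrder p q r i) = i := by
  unfold surgeryOrder; split_ifs <;> omega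

/-- The points whose order changes under the surgery. The right-hand side compares the arc from `0`
to `q` with the arc from `p` to `r`. -/
lemma surgery_inversions {p q r i j : ℕ} (hp : 0 < p) (hpq : p < q) (hqr : q < r) :
    (if i < j then (1 : ℤ) else -1) -
      (if surgeryOrder p q r i < surgeryOrder p q r j then 1 else -1) =
    2 * ((if 1 ≤ i ∧ i ≤ q then 1 else 0) * (if p < j ∧ j ≤ r then 1 else 0) -
      (if 1 ≤ j ∧ j ≤ q then 1 else 0) * (if p < i ∧ i ≤ r then 1 else 0)) := by
  have key : ∀ i, (i = 0 ∨ r < i) ∧ surgeryOrder p q r i = i ∨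
      (1 ≤ i ∧ i ≤ p) ∧ surgeryOrder p q r i = i + (r - p) ∨
      (p < i ∧ i ≤ q) ∧ surgeryOrder p q r i = i - p + (r - q) ∨
      (q < i ∧ i ≤ r) ∧ surgeryOrder p q r i = i - q := by
    intro i; unfold surgeryOrder; split_ifs <;> omega
  rcases key i with ⟨h1, e1⟩ | ⟨h1, e1⟩ | ⟨h1, e1⟩ | ⟨h1, e1⟩ <;>
  rcases key j with ⟨h2, e2⟩ | ⟨h2, e2⟩ | ⟨h2, e2⟩ | ⟨h2, e2⟩ <;>
  rw [e1, e2] <;> split_ifs <;> omega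

end GaussDiagram

namespace GaussDiagram
variable {D : GaussDiagram}

/-- The successor map on the sequence after the surgery: it jumps at the four joined points. -/
lemma surgeryOrder_succ {p q r : ℕ} (hp : 0 < p) (hpq : p < q) (hqr : q < r) (k : ℕ) :
    surgeryOrder (r - q) (r - p) r (k + 1) =
      if surgeryOrder (r - q) (r - p) r k = 0 then q + 1
      else if surgeryOrder (r - q) (r - p) r k = q then 1
      else if surgeryOrder (r - q) (r - p) r k = p then r + 1
      else if surgeryOrder (r - q) (r - p) r k = r then p + 1
      else surgeryOrder (r - q) (r - p) r k + 1 := by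
  have key : k = 0 ∧ surgeryOrder (r - q) (r - p) r k = 0 ∨
      (1 ≤ k ∧ k ≤ r - q) ∧ surgeryOrder (r - q) (r - p) r k = k + q ∨
      (r - q < k ∧ k ≤ r - p) ∧ surgeryOrder (r - q) (r - p) r k = k - (r - q) + p ∨
      (r - p < k ∧ k ≤ r) ∧ surgeryOrder (r - q) (r - p) r k = k - (r - p) ∨
      r < k ∧ surgeryOrder (r - q) (r - p) r k = k := by
    unfold surgeryOrder; split_ifs <;> omega
  have key' : (k < r - q ∧ surgeryOrder (r - q) (r - p) r (k + 1) = k + 1 + q) ∨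
      ((r - q ≤ k ∧ k < r - p) ∧
        surgeryOrder (r - q) (r - p) r (k + 1) = k + 1 - (r - q) + p) ∨
      ((r - p ≤ k ∧ k < r) ∧ surgeryOrder (r - q) (r - p) r (k + 1) = k + 1 - (r - p)) ∨
      (r ≤ k ∧ surgeryOrder (r - q) (r - p) r (k + 1) = k + 1) := by
    have h : k + 1 ≠ 0 := by omega
    unfold surgeryOrder
    rw [if_neg h]
    split_ifs <;> omega
  split_ifs <;> omega

set_option maxHeartbeats 2000000 in
/-- Two crossings `c`, `d` that are passed alternately along the smoothing at `S` may be moved into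
or out of `S` together. The reason is that the closed curves running from the first to the second
passage of `c`, and likewise for `d`, have intersection number zero. -/
lemma whitneySum_surgery (hD : D.Planar) {S : Finset (Fin D.n)} {c d : Fin D.n} {e : Bool}
    {N p q r : ℕ}
    (hinj : ∀ i < N, ∀ j < N, (⇑(D.next * flipOn S))^[i] (c, true) =
      (⇑(D.next * flipOn S))^[j] (c, true) → i = j)
    (hsurj : ∀ y, ∃ i < N, (⇑(D.next * flipOn S))^[i] (c, true) = y)
    (hret : (⇑(D.next * flipOn S))^[N] (c, true) = (c, true))
    (hp : 0 < p) (hpq : p < q) (hqr : q < r) (hr : r < N)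
    (hxq : (⇑(D.next * flipOn S))^[q] (c, true) = (c, false))
    (hxp : (⇑(D.next * flipOn S))^[p] (c, true) = (d, e))
    (hxr : (⇑(D.next * flipOn S))^[r] (c, true) = (d, !e)) :
    (∀ y, (D.next * flipOn (symmDiff S {c, d})).SameCycle (c, true) y) ∧
      D.whitneySum S (c, true) = D.whitneySum (symmDiff S {c, d}) (c, true) := by
  classical
  set τ := D.next * flipOn S with hτ
  set τ' := D.next * flipOn (symmDiff S {c, d}) with hτ'
  have hτ'τ : τ' = τ * flipOn {c, d} := by rw [hτ', ← flipOn_mul, ← mul_assoc]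
  set x : ℕ → Fin D.n × Bool := fun i => (⇑τ)^[i] (c, true) with hx
  have hx0 : x 0 = (c, true) := rfl
  have hxs : ∀ i, τ (x i) = x (i + 1) := fun i => by
    simp only [hx, Function.iterate_succ_apply']
  have hcd : c ≠ d := by
    rintro rfl
    cases e
    · exact hpq.ne (hinj _ (by omega) _ (by omega) (hxp.trans hxq.symm))
    · exact hp.ne' (hinj _ (by omega) _ (by omega) hxp)
  -- the passages of `c` and `d`
  have hpos : ∀ i < N, (x i).1 = c ↔ i = 0 ∨ i = q := by
    intro i hi
    constructor
    · intro h
      rcases h2 : x i with ⟨c', s⟩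
      rw [h2] at h
      simp only at h
      subst h
      cases s
      · right; exact hinj _ hi _ (by omega) (h2.trans hxq.symm)
      · left; exact hinj _ hi _ (by omega) h2
    · rintro (rfl | rfl)
      · rfl
      · exact congrArg Prod.fst hxq
  have hposd : ∀ i < N, (x i).1 = d ↔ i = p ∨ i = r := by
    intro i hi
    constructor
    · intro h
      rcases h2 : x i with ⟨c', s⟩
      rw [h2] at h
      simp only at h
      subst h
      by_cases hs : s = e
      · subst hs; left; exact hinj _ hi _ (by omega) (h2.trans hxp.symm)
      · have hs' : s = !e := by cases s <;> cases e <;> simp_all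
        subst hs'; right; exact hinj _ hi _ (by omega) (h2.trans hxr.symm)
    · rintro (rfl | rfl)
      · exact congrArg Prod.fst hxp
      · exact congrArg Prod.fst hxr
  -- the enumeration after the surgery
  have hstep : ∀ i < N, τ' (x i) = x (if i = 0 then q + 1 else if i = q then 1 else
      if i = p then r + 1 else if i = r then p + 1 else i + 1) := by
    intro i hi
    rw [hτ'τ, Equiv.Perm.mul_apply]
    split_ifs with h1 h2 h3 h4
    · subst h1
      rw [flipOn_of_mem (by simp [hx0]), hx0, ← hxs q]
      exact congrArg τ hxq.symm
    · subst h2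
      rw [flipOn_of_mem (by simp [hx, hxq]), ← hxs 0]
      simp only [hx, hxq]; rfl
    · subst h3
      rw [flipOn_of_mem (by simp [hx, hxp]), ← hxs r]
      simp only [hx, hxp, hxr]
    · subst h4
      rw [flipOn_of_mem (by simp [hx, hxr]), ← hxs p]
      simp only [hx, hxp, hxr, Bool.not_not]
    · rw [flipOn_of_notMem, hxs]
      rw [Finset.mem_insert, Finset.mem_singleton, hpos i hi, hposd i hi]
      omega
  have henum : ∀ k < N, (⇑τ')^[k] (c, true) = x (surgeryOrder (r - q) (r - p) r k) := by
    intro k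
    induction k with
    | zero => intro _; simp [surgeryOrder, hx]
    | succ k ih =>
      intro hk
      have hlt : surgeryOrder (r - q) (r - p) r k < N :=
        surgeryOrder_lt (N := N) (by omega) (by omega) (by omega) hr (by omega)
      rw [Function.iterate_succ_apply', ih (by omega), hstep _ hlt,
        surgeryOrder_succ hp hpq hqr]
  have hlt : ∀ i < N, surgeryOrder p q r i < N := fun i hi => surgeryOrder_lt hp hpq hqr hr hi
  have hlt' : ∀ i < N, surgeryOrder (r - q) (r - p) r i < N := fun i hi =>
    surgeryOrder_lt (by omega) (by omega) (by omega) hr hi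
  refine ⟨fun y => ?_, ?_⟩
  · obtain ⟨i, hi, rfl⟩ := hsurj y
    refine sameCycle_iff_exists_iterate.2 ⟨surgeryOrder p q r i, ?_⟩
    rw [henum _ (hlt i hi), surgeryOrder_surgeryOrder' hp hpq hqr]
  choose pos hposN hxpos using hsurj
  have hxpos' : ∀ y, x (pos y) = y := hxpos
  have hposinj : ∀ y z, pos y = pos z → y = z := fun y z h => by
    rw [← hxpos' y, ← hxpos' z, h]
  have hposx : ∀ i < N, pos (x i) = i := fun i hi => hinj _ (hposN _) _ hi (hxpos _)
  have hposc : ∀ y : Fin D.n × Bool, y.1 = c ↔ pos y = 0 ∨ pos y = q := fun y => by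
    rw [← hpos _ (hposN y), hxpos']
  have hposd' : ∀ y : Fin D.n × Bool, y.1 = d ↔ pos y = p ∨ pos y = r := fun y => by
    rw [← hposd _ (hposN y), hxpos']
  have hposτ : ∀ y, pos (τ y) = if pos y + 1 = N then 0 else pos y + 1 := by
    intro y
    have h1 : τ y = x (pos y + 1) := by rw [← hxs, hxpos']
    split_ifs with h
    · have h2 : τ y = x 0 := by rw [h1, h]; exact hret
      rw [h2, hposx 0 (by omega)]
    · rw [h1, hposx]
      have := hposN y
      omega
  have hrb : ∀ y z, y ≠ z → (ReachesBefore τ (c, true) y z ↔ pos y < pos z) := by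
    intro y z hyz
    have := reachesBefore_iff_of_enum (f := τ) (b := (c, true)) (x := x) (N := N) (g := id)
      (h := id) hinj (fun k _ => rfl) (fun k hk => hk) (fun k hk => hk) (fun _ _ => rfl)
      (fun _ _ => rfl) (hposN y) (hposN z) (fun h => hyz (hposinj _ _ h))
    rwa [hxpos', hxpos'] at this
  have hrb' : ∀ y z, y ≠ z → (ReachesBefore τ' (c, true) y z ↔
      surgeryOrder p q r (pos y) < surgeryOrder p q r (pos z)) := by
    intro y z hyz
    have := reachesBefore_iff_of_enum (f := τ') (b := (c, true)) (x := x) (N := N)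
      (g := surgeryOrder (r - q) (r - p) r) (h := surgeryOrder p q r) hinj henum hlt' hlt
      (fun i _ => surgeryOrder_surgeryOrder' hp hpq hqr i)
      (fun i _ => surgeryOrder_surgeryOrder hp hpq hqr i)
      (hposN y) (hposN z) (fun h => hyz (hposinj _ _ h))
    rwa [hxpos', hxpos'] at this
  -- the two closed curves
  set u : Fin D.n × Bool → ℝ := fun y => if 1 ≤ pos y ∧ pos y ≤ q then 1 else 0 with hu
  set v : Fin D.n × Bool → ℝ := fun y => if p < pos y ∧ pos y ≤ r then 1 else 0 with hv
  have huτ : ∀ y, u (τ y) = if pos y < q then 1 else 0 := by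
    intro y
    simp only [hu, hposτ]
    have := hposN y
    refine if_congr ?_ rfl rfl
    split_ifs <;> omega
  have hvτ : ∀ y, v (τ y) = if p ≤ pos y ∧ pos y < r then 1 else 0 := by
    intro y
    simp only [hv, hposτ]
    have := hposN y
    refine if_congr ?_ rfl rfl
    split_ifs <;> omega
  have hnext : ∀ f s, D.next (f, s) = if f ∈ S then τ (f, !s) else τ (f, s) := by
    intro f s
    split_ifs with hf
    · rw [hτ, Equiv.Perm.mul_apply, flipOn_of_mem hf, Bool.not_not]
    · rw [hτ, Equiv.Perm.mul_apply, flipOn_of_notMem hf]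
  have hne : ∀ f : Fin D.n, pos (f, true) ≠ pos (f, false) := fun f h => by
    simpa using hposinj _ _ h
  have hec : pos (c, true) = 0 ∧ pos (c, false) = q := by
    refine ⟨hposx 0 (by omega), ?_⟩
    rw [← hxq]; exact hposx q (by omega)
  have hed : (pos (d, true) = p ∧ pos (d, false) = r) ∨
      (pos (d, true) = r ∧ pos (d, false) = p) := by
    have h1 : pos (d, e) = p := by rw [← hxp]; exact hposx p (by omega)
    have h2 : pos (d, !e) = r := by rw [← hxr]; exact hposx r (by omega)
    cases e
    · right; exact ⟨h2, h1⟩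
    · left; exact ⟨h1, h2⟩
  have hother : ∀ f, f ≠ c → f ≠ d → ∀ s, pos (f, s) ≠ 0 ∧ pos (f, s) ≠ q ∧ pos (f, s) ≠ p ∧
      pos (f, s) ≠ r := by
    intro f hfc hfd s
    have h1 := (hposc (f, s)).not.1 hfc
    have h2 := (hposd' (f, s)).not.1 hfd
    omega
  have huc : D.IsCycle u := by
    intro f
    have h : u (f, true) + u (f, false) = u (τ (f, true)) + u (τ (f, false)) := by
      rw [huτ, huτ]
      simp only [hu]
      by_cases hfc : f = c
      · subst hfc
        rw [hec.1, hec.2]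
        rw [if_neg (by omega), if_pos (by omega), if_pos (by omega), if_neg (by omega)]
        norm_num
      · have h0 : ∀ s, (1 ≤ pos (f, s) ∧ pos (f, s) ≤ q) ↔ pos (f, s) < q := fun s => by
          have := (hposc (f, s)).not.1 hfc
          omega
        rw [if_congr (h0 true) rfl rfl, if_congr (h0 false) rfl rfl]
    rw [h, hnext, hnext]
    split_ifs
    · rw [add_comm]; rfl
    · rfl
  have hvc : D.IsCycle v := by
    intro f
    have h : v (f, true) + v (f, false) = v (τ (f, true)) + v (τ (f, false)) := by
      rw [hvτ, hvτ]
      simp only [hv]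
      by_cases hfd : f = d
      · subst hfd
        rcases hed with ⟨h1, h2⟩ | ⟨h1, h2⟩
        · rw [h1, h2, if_neg (by omega), if_pos (by omega), if_pos (by omega), if_neg (by omega)]
          norm_num
        · rw [h1, h2, if_pos (by omega), if_neg (by omega), if_neg (by omega), if_pos (by omega)]
          norm_num
      · have h0 : ∀ s, (p < pos (f, s) ∧ pos (f, s) ≤ r) ↔
            (p ≤ pos (f, s) ∧ pos (f, s) < r) := fun s => by
          have := (hposd' (f, s)).not.1 hfd
          omega
        rw [if_congr (h0 true) rfl rfl, if_congr (h0 false) rfl rfl]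
    rw [h, hnext, hnext]
    split_ifs
    · rw [add_comm]; rfl
    · rfl
  rw [← sub_eq_zero, whitneySum, whitneySum, ← Finset.sum_sub_distrib]
  refine Eq.trans ?_ (sum_intersection_eq_zero hD huc hvc)
  refine Finset.sum_congr rfl fun f _ => ?_
  have hmem : f ∈ symmDiff S {c, d} ↔ (f ∈ S ↔ ¬ (f = c ∨ f = d)) := by
    simp only [Finset.mem_symmDiff, Finset.mem_insert, Finset.mem_singleton]; tauto
  rw [← hτ, ← hτ', if_congr (hrb _ _ (by simp)) rfl rfl, if_congr (hrb' _ _ (by simp)) rfl rfl,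
    if_congr hmem rfl rfl]
  simp only [hnext]
  by_cases hfc : f = c
  · subst hfc
    have hW : u (τ (f, true)) = 1 ∧ u (τ (f, false)) = 0 ∧ v (τ (f, true)) = 0 ∧
        v (τ (f, false)) = 1 := by
      simp only [huτ, hvτ, hec.1, hec.2]
      refine ⟨if_pos (by omega), if_neg (by omega), if_neg (by omega), if_pos (by omega)⟩
    have hV : u (f, true) = 0 ∧ v (f, true) = 0 := by
      simp only [hu, hv, hec.1]
      refine ⟨if_neg (by omega), if_neg (by omega)⟩
    have h1 : surgeryOrder p q r 0 < surgeryOrder p q r q := by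
      unfold surgeryOrder; split_ifs <;> omega
    rw [hec.1, hec.2, if_pos (show 0 < q by omega), if_pos h1]
    by_cases hf : f ∈ S <;>
      simp only [hf, true_or, not_true, if_true, if_false, iff_false,
        Bool.not_true, Bool.not_false, hW.1, hW.2.1, hW.2.2.1, hW.2.2.2, hV.1, hV.2] <;> ring
  · by_cases hfd : f = d
    · subst hfd
      have h1 : surgeryOrder p q r r < surgeryOrder p q r p := by
        unfold surgeryOrder; split_ifs <;> omega
      rcases hed with ⟨h2, h3⟩ | ⟨h2, h3⟩
      · have hW : u (τ (f, true)) = 1 ∧ u (τ (f, false)) = 0 ∧ v (τ (f, true)) = 1 ∧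
            v (τ (f, false)) = 0 := by
          simp only [huτ, hvτ, h2, h3]
          refine ⟨if_pos (by omega), if_neg (by omega), if_pos (by omega), if_neg (by omega)⟩
        have hV : u (f, true) = 1 ∧ v (f, true) = 0 ∧ u (f, false) = 0 ∧ v (f, false) = 1 := by
          simp only [hu, hv, h2, h3]
          refine ⟨if_pos (by omega), if_neg (by omega), if_neg (by omega), if_pos (by omega)⟩
        rw [h2, h3, if_pos (show p < r by omega), if_neg h1.not_gt]
        by_cases hf : f ∈ S <;>
          simp only [hf, or_true, not_true, if_true, if_false, iff_false,
            Bool.not_true, Bool.not_false, hW.1, hW.2.1, hW.2.2.1, hW.2.2.2, hV.1, hV.2.1,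
            hV.2.2.1, hV.2.2.2] <;> ring
      · have hW : u (τ (f, true)) = 0 ∧ u (τ (f, false)) = 1 ∧ v (τ (f, true)) = 0 ∧
            v (τ (f, false)) = 1 := by
          simp only [huτ, hvτ, h2, h3]
          refine ⟨if_neg (by omega), if_pos (by omega), if_neg (by omega), if_pos (by omega)⟩
        have hV : u (f, true) = 0 ∧ v (f, true) = 1 ∧ u (f, false) = 1 ∧ v (f, false) = 0 := by
          simp only [hu, hv, h2, h3]
          refine ⟨if_neg (by omega), if_pos (by omega), if_pos (by omega), if_neg (by omega)⟩
        rw [h2, h3, if_neg (show ¬ r < p by omega), if_pos h1]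
        by_cases hf : f ∈ S <;>
          simp only [hf, or_true, not_true, if_true, if_false, iff_false,
            Bool.not_true, Bool.not_false, hW.1, hW.2.1, hW.2.2.1, hW.2.2.2, hV.1, hV.2.1,
            hV.2.2.1, hV.2.2.2] <;> ring
    · have h0 := hother f hfc hfd
      have hu' : ∀ s, u (τ (f, s)) = u (f, s) := fun s => by
        rw [huτ]; simp only [hu]; have := h0 s
        exact if_congr (by omega) rfl rfl
      have hv' : ∀ s, v (τ (f, s)) = v (f, s) := fun s => by
        rw [hvτ]; simp only [hv]; have := h0 s
        exact if_congr (by omega) rfl rfl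
      have hinv := surgery_inversions (i := pos (f, true)) (j := pos (f, false)) hp hpq hqr
      have hinv' : (if pos (f, true) < pos (f, false) then (1 : ℝ) else -1) -
          (if surgeryOrder p q r (pos (f, true)) < surgeryOrder p q r (pos (f, false)) then 1
            else -1) = 2 * (u (f, true) * v (f, false) - u (f, false) * v (f, true)) := by
        simp only [hu, hv]
        exact_mod_cast hinv
      by_cases hf : f ∈ S
      · simp only [hf, hfc, hfd, or_self, not_false_iff, if_true, hu', hv', Bool.not_true,
          Bool.not_false]
        ring
      · simp only [hf, hfc, hfd, or_self, not_false_iff, iff_true, if_false, hu', hv']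
        linear_combination (D.sign f : ℝ) * hinv'

set_option maxHeartbeats 1000000 in
/-- The rotation number of the curves obtained by smoothing a planar diagram does not depend on the
choice of the smoothing, as long as this is a single curve. -/
theorem rotation_eq (hD : D.Planar) {idx : Fin D.n × Bool → ℝ}
    (hidx : ∀ c, idx (D.next (c, true)) = idx (c, true) + D.sign c ∧
      idx (c, false) = idx (c, true) + D.sign c ∧ idx (D.next (c, false)) = idx (c, true))
    {S S' : Finset (Fin D.n)} {b b' : Fin D.n × Bool}
    (hS : ∀ y, (D.next * flipOn S).SameCycle b y)
    (hS' : ∀ y, (D.next * flipOn S').SameCycle b' y) :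
    D.whitneySum S b + 2 * idx b = D.whitneySum S' b' + 2 * idx b' := by
  classical
  have move : ∀ (S : Finset (Fin D.n)) (b y : Fin D.n × Bool),
      (∀ y, (D.next * flipOn S).SameCycle b y) →
      D.whitneySum S y + 2 * idx y = D.whitneySum S b + 2 * idx b := by
    intro S b y h
    obtain ⟨k, rfl⟩ := sameCycle_iff_exists_iterate.1 (h y)
    induction k with
    | zero => rfl
    | succ k ih =>
      rw [Function.iterate_succ_apply', whitneySum_next _ hidx, ih]
      exact fun z => (sameCycle_iff_exists_iterate.2 ⟨k, rfl⟩).symm.trans (h z)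
  induction hm : (symmDiff S S').card using Nat.strong_induction_on generalizing S b with
  | _ m ih =>
    rcases (symmDiff S S').eq_empty_or_nonempty with h0 | ⟨c, hc⟩
    · have : S = S' := symmDiff_eq_bot.1 h0
      subst this
      exact (move S b b' hS).symm
    -- another crossing of the symmetric difference is passed alternately with `c`; otherwise the
    -- points between the two passages of `c` are closed under the walk along the smoothing at `S'`
    have hSc : ∀ y, (D.next * flipOn S).SameCycle (c, true) y :=
      fun y => (hS _).symm.trans (hS y)
    rw [← move S b (c, true) hS]
    obtain ⟨N, hN, hinj, hsurj, hret⟩ := exists_enum hSc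
    set τ := D.next * flipOn S with hτ
    have hτ' : D.next * flipOn S' = τ * flipOn (symmDiff S S') := by
      rw [hτ, mul_assoc, flipOn_mul, symmDiff_symmDiff_cancel_left]
    obtain ⟨q, hqN, hq⟩ := hsurj (c, false)
    have hq0 : 0 < q := Nat.pos_of_ne_zero fun h => by subst h; simp at hq
    have hex : ∃ d ∈ symmDiff S S', d ≠ c ∧ ∃ e p r, 0 < p ∧ p < q ∧ q < r ∧ r < N ∧
        (⇑τ)^[p] (c, true) = (d, e) ∧ (⇑τ)^[r] (c, true) = (d, !e) := by
      by_contra hcon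
      push Not at hcon
      let A : Set (Fin D.n × Bool) := {y | ∃ i, 0 < i ∧ i ≤ q ∧ (⇑τ)^[i] (c, true) = y}
      have hA : ∀ y ∈ A, (D.next * flipOn S') y ∈ A := by
        rintro y ⟨i, hi, hiq, rfl⟩
        rw [hτ', Equiv.Perm.mul_apply]
        rcases hiq.lt_or_eq with hiq | rfl
        · rcases hy : (⇑τ)^[i] (c, true) with ⟨d, e⟩
          by_cases hd : d ∈ symmDiff S S'
          · rw [flipOn_of_mem hd]
            have hdc : d ≠ c := by
              rintro rfl
              cases e
              · exact hiq.ne (hinj _ (by omega) _ hqN (hy.trans hq.symm))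
              · exact hi.ne' (hinj _ (by omega) _ hN hy)
            obtain ⟨j, hj, hj'⟩ := hsurj (d, !e)
            have h1 := hcon d hd hdc e i j hi hiq
            have hj0 : j ≠ 0 := by
              rintro rfl
              exact hdc (Prod.ext_iff.1 hj').1.symm
            have hjq : j ≠ q := by
              rintro rfl
              exact hdc (Prod.ext_iff.1 (hq.symm.trans hj')).1.symm
            by_cases hjq' : q < j
            · exact absurd hj' (h1 hjq' hj hy)
            · exact ⟨j + 1, by omega, by omega, by rw [Function.iterate_succ_apply', hj']⟩
          · rw [flipOn_of_notMem hd, ← hy, ← Function.iterate_succ_apply' (⇑τ)]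
            exact ⟨i + 1, by omega, by omega, rfl⟩
        · rw [hq, flipOn_of_mem hc]
          exact ⟨1, by omega, by omega, rfl⟩
      have h1 : (c, true) ∈ A := sameCycle_mem_of_mapsTo hA
        ((hS' ((⇑τ)^[q] (c, true))).symm.trans (hS' (c, true))) ⟨q, hq0, le_rfl, rfl⟩
      obtain ⟨i, hi, hiq, hi'⟩ := h1
      exact hi.ne' (hinj _ (by omega) _ hN hi')
    obtain ⟨d, hd, hdc, e, p, r, hp, hpq, hqr, hr, hxp, hxr⟩ := hex
    obtain ⟨hsingle, hW⟩ := whitneySum_surgery hD hinj hsurj hret hp hpq hqr hr hq hxp hxr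
    rw [hW]
    refine ih _ ?_ hsingle rfl
    rw [← hm]
    apply Finset.card_lt_card
    have hcd : ∀ f, f ∈ symmDiff (symmDiff S {c, d}) S' ↔
        f ∈ symmDiff S S' ∧ f ≠ c ∧ f ≠ d := by
      intro f
      rw [Finset.mem_symmDiff] at hc hd
      simp only [Finset.mem_symmDiff, Finset.mem_insert, Finset.mem_singleton]
      by_cases h1 : f = c
      · subst h1; simp only [true_or, ne_eq, not_true]; tauto
      · by_cases h2 : f = d
        · subst h2; simp only [or_true, ne_eq, not_true]; tauto
        · simp only [h1, h2, ne_eq, or_self]; tauto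
    refine ⟨fun f hf => ((hcd f).1 hf).1, fun hsub => ?_⟩
    exact ((hcd c).1 (hsub hc)).2.1 rfl

end GaussDiagram

/-! ### Cofactors and the skein relation of determinants -/

section det
variable {m : Type*} [Fintype m] [DecidableEq m]

/-- If the combination of the rows of a matrix with the coefficients `w` is zero, then its cofactors
in any fixed column are proportional to `w`. -/
lemma mul_det_updateRow {N : Matrix m m ℝ} {w : m → ℝ} (hw : Matrix.vecMul w N = 0) (i j : m)
    (u : m → ℝ) : w j * (N.updateRow i u).det = w i * (N.updateRow j u).det := by
  rcases eq_or_ne i j with rfl | hij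
  · rfl
  have h1 := Matrix.det_updateRow_sum (N.updateRow i u) j (Function.update w i 0)
  rw [Function.update_of_ne hij.symm] at h1
  have h2 : ∑ k, Function.update w i 0 k • (N.updateRow i u) k = (-w i) • N i := by
    have h3 : ∑ k, w k • N k = 0 := by rw [← hw, Matrix.vecMul_eq_sum]
    rw [← Finset.add_sum_erase _ _ (Finset.mem_univ i)] at h3 ⊢
    rw [Function.update_self, zero_smul, zero_add, neg_smul, eq_neg_iff_add_eq_zero, add_comm,
      ← h3]
    congr 1
    refine Finset.sum_congr rfl fun k hk => ?_
    rw [Function.update_of_ne (Finset.ne_of_mem_erase hk),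
      Matrix.updateRow_ne (Finset.ne_of_mem_erase hk)]
  rw [h2, Matrix.det_updateRow_smul] at h1
  have h4 : (N.updateRow i u).updateRow j (N i) =
      (N.updateRow j u).submatrix (Equiv.swap i j) id := by
    ext k l
    rw [Matrix.submatrix_apply, Matrix.updateRow_apply, Matrix.updateRow_apply,
      Matrix.updateRow_apply, id]
    by_cases hkj : k = j
    · subst hkj; simp [hij]
    · by_cases hki : k = i
      · subst hki; simp [hkj]
      · simp [Equiv.swap_apply_of_ne_of_ne hki hkj, hki, hkj]
  rw [h4, Matrix.det_permute, Equiv.Perm.sign_swap hij, smul_eq_mul] at h1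
  rw [← h1]
  simp

/-- The analogue for columns. -/
lemma mul_det_updateCol {N : Matrix m m ℝ} {v : m → ℝ} (hv : N.mulVec v = 0) (i j : m)
    (u : m → ℝ) : v j * (N.updateCol i u).det = v i * (N.updateCol j u).det := by
  have := mul_det_updateRow (N := N.transpose) (w := v) (by rwa [Matrix.vecMul_transpose]) i j u
  rwa [Matrix.updateRow_transpose, Matrix.det_transpose, Matrix.updateRow_transpose,
    Matrix.det_transpose] at this

/-- If the rows of a matrix have the sum zero and the combination of its rows with the coefficients
`w` is zero, then its diagonal minors are proportional to `w`. -/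
lemma mul_det_updateCol_single {N : Matrix m m ℝ} {w : m → ℝ} (hv : N.mulVec 1 = 0)
    (hw : Matrix.vecMul w N = 0) (i j : m) :
    w j * (N.updateCol i (Pi.single i 1)).det = w i * (N.updateCol j (Pi.single j 1)).det := by
  have h : ∀ k l, (N.updateCol k (Pi.single l 1)).det = (N.updateRow l (Pi.single k 1)).det := by
    intro k l
    rw [← Matrix.adjugate_apply, Matrix.adjugate_def, Matrix.of_apply,
      Matrix.cramer_transpose_apply, ← Matrix.cramer_apply]
    have := congrFun (congrFun (Matrix.adjugate_transpose N) l) k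
    rw [Matrix.transpose_apply, Matrix.adjugate_apply, Matrix.adjugate_apply,
      Matrix.updateRow_transpose, Matrix.det_transpose] at this
    rw [Matrix.cramer_apply, ← this]
  have h1 := mul_det_updateCol hv i j (Pi.single i 1)
  simp only [Pi.one_apply, one_mul] at h1
  rw [h1, h j i, mul_det_updateRow hw i j, h j j]

/-- The relation between `2 × 2` blocks behind the skein relation: the three transition matrices of
the two rows belong to a positive crossing, a negative crossing and a smoothing. -/
lemma det_skein (M : Matrix m m ℝ) {i j : m} (hij : i ≠ j) (e₁ e₂ f₁ f₂ : m → ℝ) {t : ℝ}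
    (ht : t ≠ 0) :
    t * ((M.updateRow i (e₁ - (t ^ 2)⁻¹ • f₁ - (1 - (t ^ 2)⁻¹) • f₂)).updateRow j
        (e₂ - f₂)).det -
      t⁻¹ * ((M.updateRow i (e₁ - f₁)).updateRow j (e₂ - t ^ 2 • f₂ - (1 - t ^ 2) • f₁)).det =
    (t - t⁻¹) * ((M.updateRow i (e₁ - f₂)).updateRow j (e₂ - f₁)).det := by
  set B : (m → ℝ) → (m → ℝ) → ℝ := fun u v => ((M.updateRow i u).updateRow j v).det with hB
  have swap : ∀ u v, B u v = ((M.updateRow j v).updateRow i u).det := fun u v => by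
    rw [hB]; simp only; rw [Matrix.updateRow_comm _ hij]
  have addr : ∀ u v w, B u (v + w) = B u v + B u w := fun u v w => Matrix.det_updateRow_add _ _ _ _
  have smulr : ∀ u v (a : ℝ), B u (a • v) = a * B u v :=
    fun u v a => Matrix.det_updateRow_smul _ _ _ _
  have addl : ∀ u v w, B (u + v) w = B u w + B v w := fun u v w => by
    rw [swap, swap, swap]; exact Matrix.det_updateRow_add _ _ _ _
  have smull : ∀ u v (a : ℝ), B (a • u) v = a * B u v := fun u v a => by
    rw [swap, swap]; exact Matrix.det_updateRow_smul _ _ _ _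
  have subr : ∀ u v w, B u (v - w) = B u v - B u w := fun u v w => by
    rw [sub_eq_add_neg, addr, ← neg_one_smul ℝ w, smulr]; ring
  have subl : ∀ u v w, B (u - v) w = B u w - B v w := fun u v w => by
    rw [sub_eq_add_neg, addl, ← neg_one_smul ℝ v, smull]; ring
  have alt : ∀ u, B u u = 0 := fun u => Matrix.det_zero_of_row_eq hij (by
    rw [Matrix.updateRow_ne hij, Matrix.updateRow_self, Matrix.updateRow_self])
  have anti : B f₂ f₁ = -B f₁ f₂ := by
    have := alt (f₁ + f₂)
    rw [addr, addl, addl, alt, alt] at this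
    linarith
  change t * B _ _ - t⁻¹ * B _ _ = (t - t⁻¹) * B _ _
  simp only [subr, subl, smulr, smull, alt, anti]
  field_simp
  ring

end det

/-! ### The determinant of the random walk along a diagram -/

namespace GaussDiagram

variable (D : GaussDiagram)

/-- The sign of a crossing if `(c, o c)` is its over-passage. -/
def signWith (o : Fin D.n → Bool) (c : Fin D.n) : ℤ := if o c then D.sign c else -D.sign c

/-- A walker who arrives at the passage `x` goes straight on with this weight, and otherwise leaves
along the other passage: the walker always turns at the crossings in `S`, never turns at an
under-passage, and turns at an over-passage of sign `ε` with weight `1 - s ^ (-2 ε)`. -/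
noncomputable def straightWeight (s : ℝ) (S : Finset (Fin D.n)) (o : Fin D.n → Bool)
    (x : Fin D.n × Bool) : ℝ :=
  if x.1 ∈ S then 0 else if x.2 = o x.1 then s ^ (-2 * D.signWith o x.1) else 1

/-- Identity minus the transition matrix of the walk. -/
noncomputable def walkMatrix (s : ℝ) (S : Finset (Fin D.n)) (o : Fin D.n → Bool) :
    Matrix (Fin D.n × Bool) (Fin D.n × Bool) ℝ :=
  Matrix.of fun x => Pi.single x 1 - D.straightWeight s S o x • Pi.single (D.next x) 1 -
    (1 - D.straightWeight s S o x) • Pi.single (D.next (x.1, !x.2)) 1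

/-- The point mass at `y`, or zero if `y` is the place `b` where the walk stops. -/
def exitVec {n : ℕ} (b y : Fin n × Bool) : Fin n × Bool → ℝ := if y = b then 0 else Pi.single y 1

/-- The matrix `walkMatrix` for the walk that stops when it arrives at `b`. -/
noncomputable def cutMatrix (s : ℝ) (S : Finset (Fin D.n)) (o : Fin D.n → Bool)
    (b : Fin D.n × Bool) : Matrix (Fin D.n × Bool) (Fin D.n × Bool) ℝ :=
  Matrix.of fun x => Pi.single x 1 - D.straightWeight s S o x • exitVec b (D.next x) -
    (1 - D.straightWeight s S o x) • exitVec b (D.next (x.1, !x.2))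

/-- The determinant of the walk along the smoothing at `S` that stops at `b`, normalized so that the
skein relation holds. -/
noncomputable def walkDet (s : ℝ) (S : Finset (Fin D.n)) (o : Fin D.n → Bool)
    (b : Fin D.n × Bool) : ℝ :=
  (∏ c ∈ Sᶜ, s ^ D.signWith o c) * (D.cutMatrix s S o b).det

variable {D} {s : ℝ} {S : Finset (Fin D.n)} {o o' : Fin D.n → Bool} {b : Fin D.n × Bool}

lemma cutMatrix_row (x : Fin D.n × Bool) : D.cutMatrix s S o b x =
    Pi.single x 1 - D.straightWeight s S o x • exitVec b (D.next x) -
      (1 - D.straightWeight s S o x) • exitVec b (D.next (x.1, !x.2)) := rfl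

/-- The base point `b` only affects the column of `b`, so that the determinant of the matrix is a
diagonal minor of `walkMatrix`, which does not depend on `b`. -/
lemma cutMatrix_eq_updateCol :
    D.cutMatrix s S o b = (D.walkMatrix s S o).updateCol b (Pi.single b 1) := by
  have h : ∀ y z, exitVec b y z = if z = b then 0 else (Pi.single y 1 : Fin D.n × Bool → ℝ) z := by
    intro y z
    rw [exitVec]
    split_ifs with h1 h2 h2
    · rfl
    · subst h1; rw [Pi.single_eq_of_ne h2]; rfl
    · subst h2; rw [Pi.single_eq_of_ne (Ne.symm h1)]
    · rfl
  ext x z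
  rw [Matrix.updateCol_apply, cutMatrix, walkMatrix, Matrix.of_apply, Matrix.of_apply]
  simp only [Pi.sub_apply, Pi.smul_apply, h, smul_eq_mul]
  by_cases hz : z = b
  · subst hz; simp [Pi.single_apply, eq_comm]
  · simp [hz]

lemma signWith_congr {c : Fin D.n} (h : o c = o' c) : D.signWith o c = D.signWith o' c := by
  simp [signWith, h]

lemma straightWeight_congr {x : Fin D.n × Bool} (h : x.1 ∉ S → o x.1 = o' x.1) :
    D.straightWeight s S o x = D.straightWeight s S o' x := by
  unfold straightWeight
  by_cases hx : x.1 ∈ S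
  · simp [hx]
  · rw [h hx, signWith_congr (h hx)]

lemma walkDet_congr (h : ∀ c ∉ S, o c = o' c) : D.walkDet s S o b = D.walkDet s S o' b := by
  unfold walkDet cutMatrix
  congr 1
  · refine Finset.prod_congr rfl fun c hc => ?_
    rw [signWith_congr (h c (Finset.mem_compl.1 hc))]
  · congr 2
    funext x
    rw [straightWeight_congr fun hx => h x.1 hx]

lemma sign_eq (c : Fin D.n) : D.sign c = 1 ∨ D.sign c = -1 := by
  unfold sign; split_ifs <;> simp

/-- The skein relation for the determinant. -/
lemma walkDet_skein (hs : s ≠ 0) {c : Fin D.n} (hc : c ∉ S) (ho : o c = true) :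
    D.walkDet s S o b = D.walkDet s S (Function.update o c false) b +
      D.sign c * (s - s⁻¹) * D.walkDet s (insert c S) o b := by
  set t : ℝ := s ^ D.sign c with ht
  have ht0 : t ≠ 0 := zpow_ne_zero _ hs
  set o' := Function.update o c false with ho'
  have ho'c : o' c = false := Function.update_self _ _ _
  have ho'd : ∀ d, d ≠ c → o d = o' d := fun d hd => (Function.update_of_ne hd _ _).symm
  set P : ℝ := ∏ d ∈ (insert c S)ᶜ, s ^ D.signWith o d with hP
  have hcompl : Sᶜ = insert c (insert c S)ᶜ := by
    rw [Finset.compl_insert, Finset.insert_erase (Finset.mem_compl.2 hc)]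
  have hcn : c ∉ (insert c S)ᶜ := by simp
  have hP1 : ∏ d ∈ Sᶜ, s ^ D.signWith o d = t * P := by
    rw [hcompl, Finset.prod_insert hcn, ← hP, ht, signWith, if_pos ho]
  have hP2 : ∏ d ∈ Sᶜ, s ^ D.signWith o' d = t⁻¹ * P := by
    rw [hcompl, Finset.prod_insert hcn, signWith, ho'c, ht, ← zpow_neg]
    simp only [Bool.false_eq_true, if_false]
    congr 1
    refine Finset.prod_congr rfl fun d hd => ?_
    rw [signWith_congr (ho'd d fun h => hcn (h ▸ hd))]
  have hz : t - t⁻¹ = D.sign c * (s - s⁻¹) := by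
    rw [ht]
    rcases sign_eq c with h | h <;> rw [h] <;> simp
  -- the three matrices differ in the rows of `c` only
  set e₁ : Fin D.n × Bool → ℝ := Pi.single (c, true) 1
  set e₂ : Fin D.n × Bool → ℝ := Pi.single (c, false) 1
  set f₁ := exitVec b (D.next (c, true))
  set f₂ := exitVec b (D.next (c, false))
  have hrow : ∀ (S₁ : Finset (Fin D.n)) (o₁ : Fin D.n → Bool),
      (∀ x : Fin D.n × Bool, x.1 ≠ c → D.straightWeight s S₁ o₁ x = D.straightWeight s S o x) →
      D.cutMatrix s S₁ o₁ b = ((D.cutMatrix s S o b).updateRow (c, true)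
        (e₁ - D.straightWeight s S₁ o₁ (c, true) • f₁ -
          (1 - D.straightWeight s S₁ o₁ (c, true)) • f₂)).updateRow (c, false)
        (e₂ - D.straightWeight s S₁ o₁ (c, false) • f₂ -
          (1 - D.straightWeight s S₁ o₁ (c, false)) • f₁) := by
    intro S₁ o₁ h
    ext x z
    rw [Matrix.updateRow_apply, Matrix.updateRow_apply]
    by_cases h1 : x = (c, false)
    · rw [if_pos h1, h1]; rfl
    · by_cases h2 : x = (c, true)
      · rw [if_neg h1, if_pos h2, h2]; rfl
      · rw [if_neg h1, if_neg h2, cutMatrix_row, cutMatrix_row, h x]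
        intro hx
        obtain ⟨d, y⟩ := x
        simp only at hx
        subst hx
        cases y
        · exact h1 rfl
        · exact h2 rfl
  have h1 := hrow S o fun _ _ => rfl
  have h2 := hrow S o' fun x hx => (straightWeight_congr fun _ => ho'd _ hx).symm
  have h3 := hrow (insert c S) o fun x hx => by simp [straightWeight, hx]
  have a1 : D.straightWeight s S o (c, true) = (t ^ 2)⁻¹ := by
    simp only [straightWeight, hc, ho, if_false, if_true, signWith, ht]
    rw [neg_mul, zpow_neg, mul_comm, zpow_mul]; norm_cast
  have a2 : D.straightWeight s S o (c, false) = 1 := by simp [straightWeight, hc, ho]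
  have a3 : D.straightWeight s S o' (c, true) = 1 := by simp [straightWeight, hc, ho'c]
  have a4 : D.straightWeight s S o' (c, false) = t ^ 2 := by
    simp only [straightWeight, hc, ho'c, if_false, if_true, signWith, ht, Bool.false_eq_true]
    rw [neg_mul_neg, mul_comm, zpow_mul]; norm_cast
  have a5 : ∀ y, D.straightWeight s (insert c S) o (c, y) = 0 := by simp [straightWeight]
  rw [a1, a2, one_smul, sub_self, zero_smul, sub_zero] at h1
  rw [a3, a4, one_smul, sub_self, zero_smul, sub_zero] at h2
  rw [a5, a5, zero_smul, zero_smul, sub_zero, sub_zero, sub_zero, one_smul, one_smul] at h3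
  have key := det_skein (D.cutMatrix s S o b) (i := (c, true)) (j := (c, false)) (by simp)
    e₁ e₂ f₁ f₂ ht0
  rw [← h1, ← h2, ← h3, hz] at key
  rw [walkDet, walkDet, walkDet, hP1, hP2, ← hP]
  linear_combination P * key

/-- The matrix of a descending diagram of a knot is triangular if one orders the passages along the
walk from the base point. -/
lemma det_cutMatrix_descending (hS : ∀ y, (D.next * flipOn S).SameCycle b y)
    (h : ∀ c ∉ S, ReachesBefore ⇑(D.next * flipOn S) b (c, o c) (c, !o c)) :
    (D.cutMatrix s S o b).det = 1 := by
  classical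
  obtain ⟨N, hN, hinj, hsurj, hret⟩ := exists_enum hS
  choose pos hposN hpos using hsurj
  set τ := D.next * flipOn S with hτ
  have hposinj : Function.Injective pos := fun y z h => by rw [← hpos y, ← hpos z, h]
  have hposτ : ∀ y, τ y ≠ b → pos (τ y) = pos y + 1 := by
    intro y hy
    have h1 : (⇑τ)^[pos y + 1] b = τ y := by rw [Function.iterate_succ_apply', hpos]
    have h2 : pos y + 1 < N := by
      have := hposN y
      by_contra h3
      apply hy
      rw [← h1, show pos y + 1 = N by omega, hret]
    exact hinj _ (hposN _) _ h2 ((hpos _).trans h1.symm)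
  have hlt : ∀ c ∉ S, pos (c, o c) < pos (c, !o c) := by
    intro c hc
    by_contra hcon
    have hne : pos (c, o c) ≠ pos (c, !o c) := fun h => by simpa using hposinj h
    refine (h c hc).asymm (by simp) ⟨pos (c, !o c), hpos _, fun j hj he => ?_⟩
    have := hinj j (hj.trans (hposN _)) _ (hposN _) (he.trans (hpos _).symm)
    omega
  -- a nonzero coefficient off the diagonal belongs to a later passage
  have hexit : ∀ x y z, (pos x ≤ pos y) → pos z ≤ pos x → exitVec b (τ y) z = 0 := by
    intro x y z hxy hzx
    unfold exitVec
    split_ifs with hb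
    · rfl
    · refine Pi.single_eq_of_ne ?_ _
      rintro rfl
      have := hposτ y hb
      omega
  have hentry : ∀ x z, pos z ≤ pos x →
      D.cutMatrix s S o b x z = (Pi.single x 1 : Fin D.n × Bool → ℝ) z := by
    rintro ⟨c, y⟩ z hz
    rw [cutMatrix_row]
    simp only [Pi.sub_apply, Pi.smul_apply, smul_eq_mul]
    by_cases hc : c ∈ S
    · have h1 : D.next (c, !y) = τ (c, y) := by
        rw [hτ, Equiv.Perm.mul_apply, flipOn_of_mem hc]
      rw [h1, hexit (c, y) (c, y) z le_rfl hz]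
      simp [straightWeight, hc]
    · have h1 : ∀ y, D.next (c, y) = τ (c, y) := fun y => by
        rw [hτ, Equiv.Perm.mul_apply, flipOn_of_notMem hc]
      rw [h1, h1, hexit (c, y) (c, y) z le_rfl hz]
      by_cases hy : y = o c
      · subst hy
        rw [hexit (c, o c) (c, !o c) z (hlt c hc).le hz]
        simp
      · simp [straightWeight, hc, hy]
  have htri : (D.cutMatrix s S o b).BlockTriangular pos := by
    intro x z hz
    rw [hentry x z hz.le, Pi.single_eq_of_ne]
    rintro rfl
    exact lt_irrefl _ hz
  rw [htri.det]
  refine Finset.prod_eq_one fun a _ => ?_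
  have : (D.cutMatrix s S o b).toSquareBlock pos a = 1 := by
    ext ⟨x, hx⟩ ⟨z, hz⟩
    rw [Matrix.toSquareBlock_def, Matrix.of_apply, hentry x z (by rw [hx, hz]), Matrix.one_apply,
      Pi.single_apply]
    simp [eq_comm]
  rw [this, Matrix.det_one]

/-- If some components, one of which carries the base point, lie above the other ones, a walker on
the latter never reaches the former nor stops, so the determinant vanishes. -/
lemma det_cutMatrix_split {A : Set (Fin D.n × Bool)}
    (hA : ∀ x, (D.next * flipOn S) x ∈ A ↔ x ∈ A) (hb : b ∈ A) (hne : Aᶜ.Nonempty)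
    (h : ∀ c ∉ S, ∀ x, (c, x) ∈ A → (c, !x) ∉ A → o c = x) :
    (D.cutMatrix s S o b).det = 0 := by
  classical
  set τ := D.next * flipOn S with hτ
  have hexit : ∀ y, y ∉ A → exitVec b (τ y) = Pi.single (τ y) 1 := fun y hy => by
    rw [exitVec, if_neg]
    rintro h1
    exact hy ((hA y).1 (h1 ▸ hb))
  -- on the rows outside `A`, all the mass stays outside `A`
  have hrow : ∀ x, x ∉ A → ∃ a b' : ℝ, ∃ y z, y ∉ A ∧ z ∉ A ∧ a + b' = 1 ∧
      D.cutMatrix s S o b x = Pi.single x 1 - a • Pi.single y 1 - b' • Pi.single z 1 := by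
    rintro ⟨c, y⟩ hx
    have hτx : τ (c, y) ∉ A := fun h => hx ((hA _).1 h)
    rw [cutMatrix_row]
    by_cases hc : c ∈ S
    · have h1 : D.next (c, !y) = τ (c, y) := by
        rw [hτ, Equiv.Perm.mul_apply, flipOn_of_mem hc]
      have h2 : D.straightWeight s S o (c, y) = 0 := by simp [straightWeight, hc]
      refine ⟨0, 1, _, _, hτx, hτx, by norm_num, ?_⟩
      rw [h1, h2, hexit _ hx]; simp
    · have h1 : ∀ y, D.next (c, y) = τ (c, y) := fun y => by
        rw [hτ, Equiv.Perm.mul_apply, flipOn_of_notMem hc]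
      rw [h1, h1, hexit _ hx]
      by_cases hy : (c, !y) ∈ A
      · have h2 := h c hc (!y) hy (by rwa [Bool.not_not])
        have h3 : D.straightWeight s S o (c, y) = 1 := by
          simp only [straightWeight, hc, if_false, h2]
          cases y <;> simp
        refine ⟨1, 0, _, _, hτx, hτx, by norm_num, ?_⟩
        rw [h3]; simp
      · refine ⟨D.straightWeight s S o (c, y), _, _, _, hτx, fun h => hy ((hA _).1 h),
          add_sub_cancel _ _, ?_⟩
        rw [hexit _ hy]
  rw [Matrix.twoBlockTriangular_det _ (· ∈ A)]
  · apply mul_eq_zero_of_right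
    obtain ⟨x₀, hx₀⟩ := hne
    rw [← Matrix.exists_mulVec_eq_zero_iff]
    refine ⟨1, fun h0 => one_ne_zero (congrFun h0 ⟨x₀, hx₀⟩), ?_⟩
    funext ⟨x, hx⟩
    obtain ⟨a, b', y, z, hy, hz, hab, hr⟩ := hrow x hx
    have hsum : ∑ z : {z // z ∉ A}, D.cutMatrix s S o b x z =
        ∑ z, if z ∉ A then D.cutMatrix s S o b x z else 0 := by
      rw [← Finset.sum_filter]
      exact (Finset.sum_subtype (Finset.univ.filter (· ∉ A)) (by simp) _).symm
    simp only [Matrix.mulVec, dotProduct, Pi.one_apply, mul_one, Pi.zero_apply]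
    refine hsum.trans ?_
    rw [hr]
    have h1 : ∀ w, w ∉ A →
        ∑ v, (if v ∉ A then (Pi.single w 1 : Fin D.n × Bool → ℝ) v else 0) = 1 := by
      intro w hw
      rw [Finset.sum_eq_single w]
      · rw [if_pos hw, Pi.single_eq_same]
      · intro v _ hv; rw [Pi.single_eq_of_ne hv]; simp
      · simp
    have h2 : ∀ v, (if v ∉ A then (Pi.single x 1 - a • Pi.single y 1 - b' • Pi.single z 1 :
        Fin D.n × Bool → ℝ) v else 0) =
        (if v ∉ A then (Pi.single x 1 : Fin D.n × Bool → ℝ) v else 0) -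
        a * (if v ∉ A then (Pi.single y 1 : Fin D.n × Bool → ℝ) v else 0) -
        b' * (if v ∉ A then (Pi.single z 1 : Fin D.n × Bool → ℝ) v else 0) := by
      intro v; split_ifs <;> simp
    simp only [h2]
    rw [Finset.sum_sub_distrib, Finset.sum_sub_distrib, ← Finset.mul_sum, ← Finset.mul_sum,
      h1 x hx, h1 y hy, h1 z hz]
    linarith
  · intro x hx z hz
    obtain ⟨a, b', y, y', hy, hy', -, hr⟩ := hrow x hx
    have h1 : ∀ w, w ∉ A → (Pi.single w 1 : Fin D.n × Bool → ℝ) z = 0 := fun w hw =>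
      Pi.single_eq_of_ne (by rintro rfl; exact hw hz) _
    rw [hr]
    simp [h1 x hx, h1 y hy, h1 y' hy']

end GaussDiagram

/-! ### Independence of the base point -/

/-- A function of crossing data that does not change when an over-crossing in `T` becomes an
under-crossing is constant. -/
lemma eq_of_update_eq {n : ℕ} {β : Type*} {T : Finset (Fin n)} {H : (Fin n → Bool) → β}
    (h : ∀ c ∈ T, ∀ o, o c = true → H o = H (Function.update o c false))
    (hT : ∀ o o', (∀ c ∈ T, o c = o' c) → H o = H o') (o o' : Fin n → Bool) : H o = H o' := by
  classical
  have key : ∀ o, ∀ U : Finset (Fin n), U ⊆ T → H o = H fun c => if c ∈ U then false else o c := by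
    intro o U
    induction U using Finset.induction_on with
    | empty => intro _; simp
    | insert c U hc ih =>
      intro hU
      rw [Finset.insert_subset_iff] at hU
      rw [ih hU.2]
      have h1 : (fun d => if d ∈ insert c U then false else o d) =
          Function.update (fun d => if d ∈ U then false else o d) c false := by
        funext d
        by_cases hd : d = c
        · subst hd; simp
        · rw [Function.update_of_ne hd]; simp [hd]
      cases ho : o c
      · rw [h1, Function.update_eq_self_iff.2]
        simp [hc, ho]
      · rw [h1, ← h c hU.1 _ (by simp [hc, ho])]
  rw [key o T le_rfl, key o' T le_rfl]
  exact hT _ _ fun c hc => by simp [hc]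

namespace GaussDiagram

variable {D : GaussDiagram} {s : ℝ} {S : Finset (Fin D.n)} {o : Fin D.n → Bool}
  {b : Fin D.n × Bool}

open Classical in
/-- For a descending diagram, the normalizing factor of the determinant is given by Whitney's
formula. -/
lemma prod_signWith_eq_rpow (hs : 0 < s)
    (ho : ∀ c ∉ S, o c = true ↔ ReachesBefore ⇑(D.next * flipOn S) b (c, true) (c, false)) :
    ∏ c ∈ Sᶜ, s ^ D.signWith o c = s ^ D.whitneySum S b := by
  have h : D.whitneySum S b = ∑ c ∈ Sᶜ, ((D.signWith o c : ℤ) : ℝ) := by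
    rw [whitneySum, ← Finset.sum_subset (Finset.subset_univ Sᶜ)]
    · refine Finset.sum_congr rfl fun c hc => ?_
      rw [Finset.mem_compl] at hc
      rw [if_neg hc, signWith, if_congr (ho c hc).symm rfl rfl]
      split_ifs <;> simp
    · intro c _ hc
      rw [Finset.mem_compl, not_not] at hc
      rw [if_pos hc]
  rw [h, Real.rpow_sum_of_pos hs]
  exact Finset.prod_congr rfl fun c _ => (Real.rpow_intCast _ _).symm

/-- The determinant is, up to a power of `s`, the state sum at `z = s - s⁻¹`. Both sides satisfy the
skein relation, and they agree on descending diagrams. -/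
theorem walkDet_eq_stateSum (hs : 0 < s) (r : ℝ) (hr : ∀ S', S ⊆ S' →
      (∀ y, (D.next * flipOn S').SameCycle b y) → D.whitneySum S' b = r) (o : Fin D.n → Bool) :
    D.walkDet s S o b = s ^ r *
      stateSum (D.next * flipOn S) (fun c => (D.sign c : ℝ) * (s - s⁻¹)) o Sᶜ b := by
  classical
  induction hm : Sᶜ.card using Nat.strong_induction_on generalizing S o with
  | _ m ih =>
  set σ := D.next * flipOn S with hσ
  set η : Fin D.n → ℝ := fun c => (D.sign c : ℝ) * (s - s⁻¹) with hη
  set H : (Fin D.n → Bool) → ℝ := fun o => D.walkDet s S o b - s ^ r * stateSum σ η o Sᶜ b with hH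
  -- by induction, the difference of both sides does not depend on the crossing data
  have hconst : ∀ o o', H o = H o' := by
    refine eq_of_update_eq (T := Sᶜ) (fun c hc o ho => ?_) fun o o' h => ?_
    · have hcS := Finset.mem_compl.1 hc
      have h1 := ih (insert c S)ᶜ.card (by
        rw [Finset.compl_insert, ← hm]; exact Finset.card_erase_lt_of_mem hc)
        (S := insert c S) (fun S' hS' => hr S' ((Finset.subset_insert c S).trans hS')) o rfl
      rw [flipOn_insert hcS, flipOn_mul, symmDiff_comm, ← flipOn_mul, ← mul_assoc, ← hσ,
        Finset.compl_insert] at h1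
      simp only [hH]
      rw [walkDet_skein hs.ne' hcS ho, stateSum_skein hc ho, h1, hη]
      ring
    · simp only [hH]
      rw [stateSum_congr h, walkDet_congr fun c hc => h c (Finset.mem_compl.2 hc)]
  -- so one may choose a descending diagram
  suffices h : ∃ o, H o = 0 by
    obtain ⟨o', ho'⟩ := h
    exact sub_eq_zero.1 ((hconst o o').trans ho')
  by_cases hS : ∀ y, σ.SameCycle b y
  · set o₁ : Fin D.n → Bool := fun c => decide (ReachesBefore σ b (c, true) (c, false)) with ho₁
    have hdesc : ∀ c, ReachesBefore σ b (c, o₁ c) (c, !o₁ c) := by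
      intro c
      by_cases h : ReachesBefore σ b (c, true) (c, false)
      · simp [ho₁, h]
      · have := (ReachesBefore.total (y := (c, false))
          (sameCycle_iff_exists_iterate.1 (hS (c, true)))).resolve_left h
        simpa [ho₁, h] using this
    refine ⟨o₁, ?_⟩
    simp only [hH]
    rw [stateSum_descending hS fun c _ => hdesc c, walkDet,
      det_cutMatrix_descending hS fun c _ => hdesc c,
      prod_signWith_eq_rpow (b := b) hs fun c _ => by simp [ho₁, hσ], hr S le_rfl hS, sub_self]
  · -- the component of the base point is placed above the other ones
    set A : Set (Fin D.n × Bool) := {y | σ.SameCycle b y} with hA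
    set o₁ : Fin D.n → Bool := fun c => decide ((c, true) ∈ A) with ho₁
    have hbA : b ∈ A := Equiv.Perm.SameCycle.refl _ _
    have hσA : ∀ x, σ x ∈ A ↔ x ∈ A := fun x => Equiv.Perm.sameCycle_apply_right
    have hne : Aᶜ.Nonempty := by
      push Not at hS
      exact hS
    have hover : ∀ c x, (c, x) ∈ A → (c, !x) ∉ A → o₁ c = x := by
      intro c x h1 h2
      cases x
      · simpa [ho₁] using h2
      · simpa [ho₁] using h1
    refine ⟨o₁, ?_⟩
    simp only [hH]
    rw [stateSum_split (fun x hx => (hσA x).2 hx) hbA hne fun c _ => hover c, walkDet,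
      det_cutMatrix_split hσA hbA hne fun c _ => hover c]
    simp

/-- The rows of the matrix of the walk have the sum zero. -/
lemma walkMatrix_mulVec_one : (D.walkMatrix s S o).mulVec 1 = 0 := by
  funext x
  simp only [Matrix.mulVec, dotProduct, Pi.one_apply, mul_one, Pi.zero_apply, walkMatrix,
    Matrix.of_apply, Pi.sub_apply, Pi.smul_apply, Finset.sum_sub_distrib, smul_eq_mul,
    Finset.sum_pi_single', Finset.mem_univ, if_true]
  simp [Pi.single_apply]

/-- The powers of `s ^ (-2)` with the Alexander numbering of the edges as exponent are a stationary
measure of the walk. -/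
lemma vecMul_walkMatrix (hs : 0 < s) {idx : Fin D.n × Bool → ℝ}
    (hidx : ∀ c, idx (D.next (c, true)) = idx (c, true) + D.sign c ∧
      idx (c, false) = idx (c, true) + D.sign c ∧ idx (D.next (c, false)) = idx (c, true)) :
    Matrix.vecMul (fun y => s ^ (-2 * idx y)) (D.walkMatrix s S o) = 0 := by
  set w : Fin D.n × Bool → ℝ := fun y => s ^ (-2 * idx y) with hw
  have hstat : ∀ c y, w (D.next (c, y)) = w (c, y) * D.straightWeight s S o (c, y) +
      w (c, !y) * (1 - D.straightWeight s S o (c, !y)) := by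
    intro c y
    obtain ⟨h1, h2, h3⟩ := hidx c
    set q : ℝ := s ^ (-2 * D.sign c) with hq
    have hq0 : q ≠ 0 := zpow_ne_zero _ hs.ne'
    have hB : w (c, false) = w (c, true) * q := by
      rw [hw, hq]; simp only
      rw [h2, mul_add, Real.rpow_add hs, ← Real.rpow_intCast]; push_cast; rfl
    have hn1 : w (D.next (c, true)) = w (c, false) := by rw [hw]; simp only; rw [h1, h2]
    have hn2 : w (D.next (c, false)) = w (c, true) := by rw [hw]; simp only; rw [h3]
    by_cases hc : c ∈ S
    · cases y <;> simp [straightWeight, hc, hn1, hn2]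
    · have hqi : s ^ (2 * D.sign c) = q⁻¹ := by rw [hq, ← zpow_neg]; congr 1; ring
      cases ho : o c <;> cases y <;>
        simp only [straightWeight, hc, ho, signWith, hn1, hn2, if_true, if_false, Bool.not_true,
          Bool.not_false, Bool.false_eq_true, reduceCtorEq, neg_mul_neg, hqi, ← hq, hB]
      all_goals field_simp
      all_goals ring
  funext z
  obtain ⟨⟨c, y⟩, rfl⟩ := D.next.surjective z
  have h1 : ∀ x, w x * D.walkMatrix s S o x (D.next (c, y)) =
      (if x = D.next (c, y) then w x else 0) -
      (if x = (c, y) then w x * D.straightWeight s S o x else 0) -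
      (if x = (c, !y) then w x * (1 - D.straightWeight s S o x) else 0) := by
    rintro ⟨d, v⟩
    simp only [walkMatrix, Matrix.of_apply, Pi.sub_apply, Pi.smul_apply, Pi.single_apply,
      smul_eq_mul, EmbeddingLike.apply_eq_iff_eq]
    have e1 : (D.next (c, y) = (d, v)) = ((d, v) = D.next (c, y)) := propext eq_comm
    have e2 : ((c, y) = (d, v)) = ((d, v) = (c, y)) := propext eq_comm
    have e3 : ((c, y) = (d, !v)) = ((d, v) = (c, !y)) := propext (by
      rw [Prod.mk.injEq, Prod.mk.injEq]; cases y <;> cases v <;> simp [eq_comm])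
    simp only [e1, e2, e3]
    split_ifs <;> ring
  simp only [Matrix.vecMul, dotProduct, h1, Finset.sum_sub_distrib, Finset.sum_ite_eq',
    Finset.mem_univ, if_true, Pi.zero_apply]
  rw [hstat]; ring

/-- Independence of the base point at `z = s - s⁻¹`. The two descriptions of the determinant, by the
state sum and as a minor, depend on the base point by the same power of `s`. -/
theorem stateSum_base_real (hD : D.Planar) (hs : 0 < s) (S : Finset (Fin D.n))
    (o : Fin D.n → Bool) (b b' : Fin D.n × Bool) :
    stateSum (D.next * flipOn S) (fun c => (D.sign c : ℝ) * (s - s⁻¹)) o Sᶜ b =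
      stateSum (D.next * flipOn S) (fun c => (D.sign c : ℝ) * (s - s⁻¹)) o Sᶜ b' := by
  classical
  obtain ⟨idx, hidx⟩ := hD.exists_index
  by_cases h : ∃ S', S ⊆ S' ∧ ∀ x y, (D.next * flipOn S').SameCycle x y
  · obtain ⟨S₀, -, hS₀⟩ := h
    have key : ∀ b, D.walkDet s S o b = s ^ (D.whitneySum S₀ b' + 2 * idx b' - 2 * idx b) *
        stateSum (D.next * flipOn S) (fun c => (D.sign c : ℝ) * (s - s⁻¹)) o Sᶜ b := fun b =>
      walkDet_eq_stateSum hs _ (fun S' _ hS' => eq_sub_of_add_eq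
        (rotation_eq hD hidx hS' (hS₀ b'))) o
    have h1 := mul_det_updateCol_single (walkMatrix_mulVec_one (D := D) (s := s) (S := S) (o := o))
      (vecMul_walkMatrix hs hidx) b b'
    rw [← cutMatrix_eq_updateCol, ← cutMatrix_eq_updateCol] at h1
    have h2 : s ^ (-2 * idx b') * D.walkDet s S o b = s ^ (-2 * idx b) * D.walkDet s S o b' := by
      rw [walkDet, walkDet]; linear_combination (∏ c ∈ Sᶜ, s ^ D.signWith o c) * h1
    rw [key, key, ← mul_assoc, ← mul_assoc, ← Real.rpow_add hs, ← Real.rpow_add hs] at h2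
    refine mul_left_cancel₀ (Real.rpow_pos_of_pos hs _).ne' (h2.trans ?_)
    congr 2
    ring
  · have hzero : ∀ b, stateSum (D.next * flipOn S) (fun c => (D.sign c : ℝ) * (s - s⁻¹)) o Sᶜ b
        = 0 := by
      intro b
      refine Finset.sum_eq_zero fun T hT => if_neg fun hst => h ?_
      have hdis : symmDiff S T = S ∪ T :=
        (disjoint_compl_right.mono_right (Finset.mem_powerset.1 hT)).symmDiff_eq_sup
      refine ⟨S ∪ T, Finset.subset_union_left, fun x y => ?_⟩
      have h1 := hst.1
      rw [mul_assoc, flipOn_mul, hdis] at h1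
      exact (h1 x).symm.trans (h1 y)
    rw [hzero, hzero]

/-- The state sum of a smoothing of a planar diagram does not depend on the base point. -/
theorem stateSum_base (hD : D.Planar) (S : Finset (Fin D.n)) (o : Fin D.n → Bool)
    (b b' : Fin D.n × Bool) :
    stateSum (D.next * flipOn S) (fun c => C (D.sign c) * X) o Sᶜ b =
      stateSum (D.next * flipOn S) (fun c => C (D.sign c) * X) o Sᶜ b' := by
  apply Polynomial.map_injective (Int.castRingHom ℝ) Int.cast_injective
  refine Polynomial.funext fun z => ?_
  -- every real number is of the form `s - s⁻¹`
  set s : ℝ := (z + √(z ^ 2 + 4)) / 2 with hs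
  have h1 : √(z ^ 2 + 4) ^ 2 = z ^ 2 + 4 := Real.sq_sqrt (by positivity)
  have h2 : |z| < √(z ^ 2 + 4) := by
    rw [← Real.sqrt_sq_eq_abs]
    exact Real.sqrt_lt_sqrt (by positivity) (by linarith)
  have hs0 : 0 < s := by
    have := neg_abs_le z
    rw [hs]; linarith
  have hz : s - s⁻¹ = z := by
    have : s⁻¹ = s - z := inv_eq_of_mul_eq_one_right (by rw [hs]; linear_combination h1 / 4)
    rw [this]; ring
  have h3 : ∀ b, (Polynomial.map (Int.castRingHom ℝ)
      (stateSum (D.next * flipOn S) (fun c => C (D.sign c) * X) o Sᶜ b)).eval z =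
      stateSum (D.next * flipOn S) (fun c => (D.sign c : ℝ) * (s - s⁻¹)) o Sᶜ b := by
    intro b
    rw [eval_map, ← coe_eval₂RingHom, map_stateSum, hz]
    congr 1
    funext c
    rw [map_mul, coe_eval₂RingHom, eval₂_C, eval₂_X, Int.coe_castRingHom]
  rw [h3, h3]
  exact stateSum_base_real hD hs0 S o b b'

end GaussDiagram

/-! ### Marked points that are not live -/

/-- The map `ρ` describes, through `g`, where a walker who iterates `σ` returns to the range of `g`
for the first time. -/
def FirstReturn {α X : Type*} (σ : α → α) (g : X → α) (ρ : X → X) : Prop :=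
  ∀ ξ, ∃ k, σ^[k + 1] (g ξ) = g (ρ ξ) ∧ ∀ j < k, σ^[j + 1] (g ξ) ∉ Set.range g

namespace FirstReturn

variable {α X : Type*} {σ : α → α} {g : X → α} {ρ : X → X}

lemma reachesBefore_iff (h : FirstReturn σ g ρ) (hg : Function.Injective g) {b x y : X} :
    ReachesBefore σ (g b) (g x) (g y) ↔ ReachesBefore ρ b x y := by
  constructor
  · rintro ⟨k, hk, hk'⟩
    induction k using Nat.strong_induction_on generalizing b with
    | _ k ih =>
    rcases eq_or_ne b x with rfl | hbx
    · exact ReachesBefore.refl _ _ _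
    obtain ⟨k₀, h1, h2⟩ := h b
    have hk0 : k ≠ 0 := by
      rintro rfl
      exact hbx (hg hk)
    have hlt : k₀ + 1 ≤ k := by
      by_contra hcon
      refine h2 (k - 1) (by omega) ?_
      rw [Nat.sub_add_cancel (by omega), hk]
      exact ⟨x, rfl⟩
    have hby : y ≠ b := by
      rintro rfl
      exact hk' 0 (by omega) rfl
    refine ReachesBefore.of_next hby (ih (k - (k₀ + 1)) (by omega) ?_ fun j hj => ?_)
    · rw [← h1, ← Function.iterate_add_apply, Nat.sub_add_cancel hlt, hk]
    · rw [← h1, ← Function.iterate_add_apply]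
      exact hk' _ (by omega)
  · rintro ⟨k, hk, hk'⟩
    induction k generalizing b with
    | zero =>
      obtain rfl : b = x := hk
      exact ReachesBefore.refl _ _ _
    | succ k ih =>
      obtain ⟨l, hl, hl'⟩ := ih (b := ρ b) hk fun j hj => hk' (j + 1) (by omega)
      obtain ⟨k₀, h1, h2⟩ := h b
      refine ⟨l + (k₀ + 1), by rw [Function.iterate_add_apply, h1, hl], fun j hj => ?_⟩
      rcases Nat.lt_or_ge j (k₀ + 1) with h3 | h3
      · obtain _ | j := j
        · exact fun h4 => hk' 0 (by omega) (hg h4)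
        · exact fun h4 => h2 j (by omega) ⟨y, h4.symm⟩
      · have := hl' (j - (k₀ + 1)) (by omega)
        rwa [← h1, ← Function.iterate_add_apply, Nat.sub_add_cancel h3] at this

/-- Precomposition with a map that fixes the points outside the range of `g`. -/
lemma comp (h : FirstReturn σ g ρ) {φ : α → α} {ψ : X → X} (hφ : ∀ ξ, φ (g ξ) = g (ψ ξ))
    (hφ' : ∀ a, a ∉ Set.range g → φ a = a) : FirstReturn (σ ∘ φ) g (ρ ∘ ψ) := by
  intro ξ
  obtain ⟨k, h1, h2⟩ := h (ψ ξ)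
  have key : ∀ j ≤ k, (σ ∘ φ)^[j + 1] (g ξ) = σ^[j + 1] (g (ψ ξ)) := by
    intro j
    induction j with
    | zero => intro _; simp [hφ]
    | succ j ih =>
      intro hj
      rw [Function.iterate_succ_apply', ih (by omega), Function.comp_apply,
        hφ' _ (h2 j (by omega)), Function.iterate_succ_apply' σ (j + 1)]
  exact ⟨k, (key k le_rfl).trans h1, fun j hj => by rw [key j hj.le]; exact h2 j hj⟩

end FirstReturn

lemma exists_iterate_comp_mem {α : Type*} {σ φ : α → α} {Z : Set α} (hφ : ∀ a, a ∉ Z → φ a = a)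
    {y : α} (h : ∃ k, σ^[k] y ∈ Z) : ∃ k, (σ ∘ φ)^[k] y ∈ Z := by
  obtain ⟨k, hk⟩ := h
  induction k generalizing y with
  | zero => exact ⟨0, hk⟩
  | succ k ih =>
    by_cases hy : y ∈ Z
    · exact ⟨0, hy⟩
    · obtain ⟨l, hl⟩ := ih hk
      exact ⟨l + 1, by rwa [Function.iterate_succ_apply, Function.comp_apply, hφ y hy]⟩

lemma FirstReturn.forall_sameCycle_iff {α X : Type*} [Finite α] {σ : Equiv.Perm α} {g : X → α}
    {ρ : X → X} (h : FirstReturn σ g ρ) (hg : Function.Injective g)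
    (hr : ∀ y, ∃ k, (⇑σ)^[k] y ∈ Set.range g) {b : X} :
    (∀ y, σ.SameCycle (g b) y) ↔ ∀ ξ, ReachesBefore ρ b ξ ξ := by
  constructor
  · intro h1 ξ
    rw [← h.reachesBefore_iff hg, ← sameCycle_iff_reachesBefore]
    exact h1 _
  · intro h1 y
    obtain ⟨k, ξ, hk⟩ := hr y
    have h2 := h1 ξ
    rw [← h.reachesBefore_iff hg, ← sameCycle_iff_reachesBefore] at h2
    exact h2.trans (sameCycle_iff_exists_iterate.2 ⟨k, hk.symm⟩).symm

section transport
variable {n m : ℕ} {R : Type*} [CommRing R]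

/-- The state sum only depends on the cyclic sequences of live passages: here both `σ₁` and `σ₂` run
through the points of `X` in the order given by `ρ`. -/
theorem stateSum_transport {σ₁ : Equiv.Perm (Fin n × Bool)} {σ₂ : Equiv.Perm (Fin m × Bool)}
    {η₁ : Fin n → R} {η₂ : Fin m → R} {o₁ : Fin n → Bool} {o₂ : Fin m → Bool}
    {X : Type*} {g₁ : X → Fin n × Bool} {g₂ : X → Fin m × Bool} {ρ : X → X}
    (hg₁ : Function.Injective g₁) (hg₂ : Function.Injective g₂)
    (h₁ : FirstReturn σ₁ g₁ ρ) (h₂ : FirstReturn σ₂ g₂ ρ)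
    (hr₁ : ∀ y, ∃ k, (⇑σ₁)^[k] y ∈ Set.range g₁) (hr₂ : ∀ y, ∃ k, (⇑σ₂)^[k] y ∈ Set.range g₂)
    {f : Fin m → Fin n} {T : Finset (Fin m)}
    (hlive : ∀ c ∈ T, ∀ x, ∃ ξ, g₂ ξ = (c, x) ∧ g₁ ξ = (f c, x))
    (hη : ∀ c ∈ T, η₁ (f c) = η₂ c) (ho : ∀ c ∈ T, o₁ (f c) = o₂ c) (β : X) :
    stateSum σ₁ η₁ o₁ (T.image f) (g₁ β) = stateSum σ₂ η₂ o₂ T (g₂ β) := by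
  classical
  have hf : ∀ c ∈ T, ∀ d ∈ T, f c = f d → c = d := by
    intro c hc d hd hcd
    obtain ⟨ξ, h1, h2⟩ := hlive c hc true
    obtain ⟨ξ', h3, h4⟩ := hlive d hd true
    obtain rfl : ξ = ξ' := hg₁ (by rw [h2, h4, hcd])
    exact congrArg Prod.fst (h1.symm.trans h3)
  have hstate : ∀ S ⊆ T, IsState σ₂ o₂ (g₂ β) S ↔ IsState σ₁ o₁ (g₁ β) (S.image f) := by
    intro S hS
    -- smoothing at `S` corresponds to an operation on `X`
    have hψ : ∀ ξ, ∃ ξ', flipOn S (g₂ ξ) = g₂ ξ' ∧ flipOn (S.image f) (g₁ ξ) = g₁ ξ' := by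
      intro ξ
      by_cases hξ : (g₂ ξ).1 ∈ S
      · obtain ⟨ξ', h1, h2⟩ := hlive _ (hS hξ) (!(g₂ ξ).2)
        obtain ⟨ξ'', h3, h4⟩ := hlive _ (hS hξ) (g₂ ξ).2
        obtain rfl : ξ'' = ξ := hg₂ h3
        refine ⟨ξ', by rw [flipOn_of_mem hξ, h1], ?_⟩
        rw [flipOn_of_mem (by rw [h4]; exact Finset.mem_image_of_mem f hξ), h2, h4]
      · refine ⟨ξ, flipOn_of_notMem hξ, flipOn_of_notMem fun h => hξ ?_⟩
        obtain ⟨c, hc, hc'⟩ := Finset.mem_image.1 h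
        obtain ⟨ξ', h1, h2⟩ := hlive c (hS hc) (g₁ ξ).2
        obtain rfl : ξ' = ξ := hg₁ (by rw [h2, hc'])
        rwa [h1]
    choose ψ hψ₂ hψ₁ using hψ
    have hfix₂ : ∀ a, a ∉ Set.range g₂ → flipOn S a = a := by
      rintro ⟨c, x⟩ ha
      refine flipOn_of_notMem fun hc => ha ?_
      obtain ⟨ξ, h1, -⟩ := hlive c (hS hc) x
      exact ⟨ξ, h1⟩
    have hfix₁ : ∀ a, a ∉ Set.range g₁ → flipOn (S.image f) a = a := by
      rintro ⟨d, x⟩ ha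
      refine flipOn_of_notMem fun hd => ha ?_
      obtain ⟨c, hc, rfl⟩ := Finset.mem_image.1 hd
      obtain ⟨ξ, -, h1⟩ := hlive c (hS hc) x
      exact ⟨ξ, h1⟩
    have hF₂ : FirstReturn ⇑(σ₂ * flipOn S) g₂ (ρ ∘ ψ) := h₂.comp hψ₂ hfix₂
    have hF₁ : FirstReturn ⇑(σ₁ * flipOn (S.image f)) g₁ (ρ ∘ ψ) := h₁.comp hψ₁ hfix₁
    refine and_congr ?_ ?_
    · rw [hF₂.forall_sameCycle_iff hg₂ fun y => exists_iterate_comp_mem hfix₂ (hr₂ y),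
        hF₁.forall_sameCycle_iff hg₁ fun y => exists_iterate_comp_mem hfix₁ (hr₁ y)]
    · rw [Finset.forall_mem_image]
      refine forall₂_congr fun c hc => ?_
      rw [ho c (hS hc)]
      obtain ⟨ξ, h1, h2⟩ := hlive c (hS hc) (o₂ c)
      obtain ⟨ξ', h3, h4⟩ := hlive c (hS hc) (!o₂ c)
      rw [← h1, ← h2, ← h3, ← h4, hF₂.reachesBefore_iff hg₂, hF₁.reachesBefore_iff hg₁]
  symm
  refine Finset.sum_bij (fun S _ => S.image f) (fun S hS => ?_) (fun S hS S' hS' h => ?_)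
    (fun S' hS' => ?_) (fun S hS => ?_)
  · exact Finset.mem_powerset.2 (Finset.image_subset_image (Finset.mem_powerset.1 hS))
  · rw [Finset.mem_powerset] at hS hS'
    ext c
    constructor
    · intro hc
      obtain ⟨d, hd, hd'⟩ := Finset.mem_image.1 (h ▸ Finset.mem_image_of_mem f hc)
      rwa [← hf d (hS' hd) c (hS hc) hd']
    · intro hc
      obtain ⟨d, hd, hd'⟩ := Finset.mem_image.1 (h.symm ▸ Finset.mem_image_of_mem f hc)
      rwa [← hf d (hS hd) c (hS' hc) hd']
  · obtain ⟨S, hS, rfl⟩ := Finset.subset_image_iff.1 (Finset.mem_powerset.1 hS')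
    exact ⟨S, Finset.mem_powerset.2 (by exact_mod_cast hS), rfl⟩
  · rw [Finset.mem_powerset] at hS
    rw [if_congr (hstate S hS) rfl rfl, Finset.prod_image fun c hc d hd => hf c (hS hc) d (hS hd)]
    refine if_congr Iff.rfl (Finset.prod_congr rfl fun c hc => ?_) rfl
    rw [crossingWeight, crossingWeight, hη c (hS hc), ho c (hS hc)]

variable {σ : Equiv.Perm (Fin n × Bool)} {η : Fin n → R} {o : Fin n → Bool}
  {T : Finset (Fin n)} {b : Fin n × Bool}

/-- Marked points that are not live may be renamed. -/
lemma stateSum_conj (π : Equiv.Perm (Fin n × Bool)) (hπ : ∀ x, x.1 ∈ T → π x = x) :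
    stateSum (π * σ * π⁻¹) η o T (π b) = stateSum σ η o T b := by
  have h := stateSum_transport (σ₁ := σ) (σ₂ := π * σ * π⁻¹) (η₁ := η) (η₂ := η) (o₁ := o)
    (o₂ := o) (g₁ := id) (g₂ := π) (ρ := σ) (f := id) (T := T) Function.injective_id π.injective
    (fun ξ => ⟨0, rfl, by simp⟩) (fun ξ => ⟨0, by simp, by simp⟩)
    (fun y => ⟨0, by simp⟩) (fun y => ⟨0, by simp⟩)
    (fun c hc x => ⟨(c, x), hπ _ hc, rfl⟩) (fun _ _ => rfl) (fun _ _ => rfl) b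
  rw [Finset.image_id] at h
  exact h.symm

/-- A marked point `d` that is not live may slide over its neighbour `y`. -/
lemma stateSum_slide {d y : Fin n × Bool} (hd : d.1 ∉ T) (hb : b ≠ d) (hdy : d ≠ y)
    (h : σ d = y ∨ σ y = d) :
    stateSum (Equiv.swap d y * σ * (Equiv.swap d y)⁻¹) η o T b = stateSum σ η o T b := by
  wlog h1 : σ d = y generalizing σ with H
  · have h2 := h.resolve_left h1
    have h3 := H (σ := Equiv.swap d y * σ * (Equiv.swap d y)⁻¹) (Or.inl (by simp [h2]))
      (by simp [h2])
    rw [← h3, Equiv.swap_inv]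
    simp only [mul_assoc, Equiv.swap_mul_self, mul_one, Equiv.swap_mul_self_mul]
  clear h
  classical
  set σ' := Equiv.swap d y * σ * (Equiv.swap d y)⁻¹ with hσ'
  set ρ : {x // x ≠ d} → {x // x ≠ d} := fun ξ =>
    if hξ : σ ξ = d then ⟨y, hdy.symm⟩ else ⟨σ ξ, hξ⟩ with hρ
  have hval : ∀ z, z ∉ Set.range (Subtype.val : {x // x ≠ d} → Fin n × Bool) ↔ z = d := by
    intro z; simp
  have h2 : FirstReturn σ Subtype.val ρ := by
    intro ξ
    by_cases hξ : σ ξ = d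
    · refine ⟨1, by simp [hρ, hξ, h1], fun j hj => ?_⟩
      obtain rfl : j = 0 := by omega
      rw [hval]; exact hξ
    · exact ⟨0, by simp [hρ, hξ], by simp⟩
  have h3 : FirstReturn σ' Subtype.val ρ := by
    rintro ⟨x, hx⟩
    have hy : ∀ z, σ' z = Equiv.swap d y (σ (Equiv.swap d y z)) := fun z => by
      simp [hσ']
    by_cases hxy : x = y
    · subst hxy
      refine ⟨1, ?_, fun j hj => ?_⟩
      · simp only [hρ, Function.iterate_succ_apply', Function.iterate_zero, id, hy,
          Equiv.swap_apply_right, h1, Equiv.swap_apply_left]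
        by_cases hξ : σ x = d
        · simp [hξ]
        · have : σ x ≠ x := fun h => hdy (σ.injective (h1.trans h.symm))
          simp [hξ, Equiv.swap_apply_of_ne_of_ne hξ this]
      · obtain rfl : j = 0 := by omega
        rw [hval]
        simp [hy, h1]
    · refine ⟨0, ?_, by simp⟩
      simp only [hρ, Function.iterate_succ_apply', Function.iterate_zero, id, hy,
        Equiv.swap_apply_of_ne_of_ne hx hxy]
      by_cases hξ : σ x = d
      · simp [hξ]
      · have : σ x ≠ y := fun h => hx (σ.injective (h.trans h1.symm))
        simp [hξ, Equiv.swap_apply_of_ne_of_ne hξ this]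
  have hreach : ∀ τ : Equiv.Perm (Fin n × Bool), τ d ≠ d → ∀ y, ∃ k,
      (⇑τ)^[k] y ∈ Set.range (Subtype.val : {x // x ≠ d} → Fin n × Bool) := by
    intro τ hτ y
    by_cases hy : y = d
    · exact ⟨1, by simpa [hy] using hτ⟩
    · exact ⟨0, by simpa using hy⟩
  have hσd : σ d ≠ d := by rw [h1]; exact hdy.symm
  have hσ'd : σ' d ≠ d := by
    intro h4
    have h5 : σ y = y := by
      simpa [hσ', Equiv.swap_apply_eq_iff] using h4
    exact hdy (σ.injective (h1.trans h5.symm))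
  have key := stateSum_transport (σ₁ := σ') (σ₂ := σ) (η₁ := η) (η₂ := η) (o₁ := o)
    (o₂ := o) (f := id) (T := T) Subtype.val_injective Subtype.val_injective h3 h2
    (hreach _ hσ'd) (hreach _ hσd)
    (fun c hc x => ⟨⟨(c, x), by rintro rfl; exact hd hc⟩, rfl, rfl⟩) (fun _ _ => rfl)
    (fun _ _ => rfl) ⟨b, hb⟩
  rwa [Finset.image_id] at key

end transport

/-! ### Counting cycles -/

lemma numCycles_pos {α : Type} [Finite α] [Nonempty α] (σ : Equiv.Perm α) : 0 < numCycles σ := by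
  have : Nonempty (Quotient (Equiv.Perm.SameCycle.setoid σ)) := Nonempty.map (Quotient.mk _) ‹_›
  exact Nat.card_pos

lemma numCycles_eq_one_iff {α : Type} {σ : Equiv.Perm α} (b : α) :
    numCycles σ = 1 ↔ ∀ y, σ.SameCycle b y := by
  rw [numCycles, Nat.card_eq_one_iff_unique]
  constructor
  · rintro ⟨h, -⟩ y
    exact Quotient.exact (Subsingleton.elim (Quotient.mk (Equiv.Perm.SameCycle.setoid σ) b)
      (Quotient.mk (Equiv.Perm.SameCycle.setoid σ) y))
  · intro h
    refine ⟨⟨fun x y => ?_⟩, ⟨Quotient.mk _ b⟩⟩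
    induction x using Quotient.inductionOn
    induction y using Quotient.inductionOn
    exact Quotient.sound ((h _).symm.trans (h _))

lemma numCycles_of_isEmpty {α : Type} [IsEmpty α] (σ : Equiv.Perm α) : numCycles σ = 0 := by
  unfold numCycles
  have : IsEmpty (Quotient (Equiv.Perm.SameCycle.setoid σ)) :=
    ⟨fun x => Quotient.inductionOn x fun y => isEmptyElim y⟩
  exact Nat.card_of_isEmpty

namespace FirstReturn

variable {α X : Type} [Finite α] [Finite X] {σ : Equiv.Perm α} {ρ : Equiv.Perm X} {g : X → α}

lemma sameCycle_iff (h : FirstReturn σ g ρ) (hg : Function.Injective g) {ξ ξ' : X} :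
    σ.SameCycle (g ξ) (g ξ') ↔ ρ.SameCycle ξ ξ' := by
  rw [sameCycle_iff_reachesBefore, sameCycle_iff_reachesBefore, h.reachesBefore_iff hg]

lemma quotientMap_injective (h : FirstReturn σ g ρ) (hg : Function.Injective g) :
    Function.Injective (Quotient.map (sa := Equiv.Perm.SameCycle.setoid ρ)
      (sb := Equiv.Perm.SameCycle.setoid σ) g fun _ _ => (h.sameCycle_iff hg).2) := by
  intro x y
  induction x using Quotient.inductionOn
  induction y using Quotient.inductionOn
  intro hxy
  exact Quotient.sound ((h.sameCycle_iff hg).1 (Quotient.exact hxy))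

lemma numCycles_le (h : FirstReturn σ g ρ) (hg : Function.Injective g) :
    numCycles ρ ≤ numCycles σ :=
  Nat.card_le_card_of_injective _ (h.quotientMap_injective hg)

lemma numCycles_eq_iff (h : FirstReturn σ g ρ) (hg : Function.Injective g) :
    numCycles ρ = numCycles σ ↔ ∀ y, ∃ k, (⇑σ)^[k] y ∈ Set.range g := by
  constructor
  · intro hc y
    obtain ⟨x, hx⟩ := ((h.quotientMap_injective hg).bijective_of_nat_card_le hc.ge).2
      (Quotient.mk _ y)
    induction x using Quotient.inductionOn with
    | _ ξ =>
    have h1 : σ.SameCycle (g ξ) y := Quotient.exact hx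
    obtain ⟨k, hk⟩ := sameCycle_iff_exists_iterate.1 h1.symm
    exact ⟨k, ξ, hk.symm⟩
  · intro hr
    refine Nat.card_eq_of_bijective _ ⟨h.quotientMap_injective hg, fun y => ?_⟩
    induction y using Quotient.inductionOn with
    | _ y =>
    obtain ⟨k, ξ, hk⟩ := hr y
    exact ⟨Quotient.mk _ ξ, Quotient.sound
      (sameCycle_iff_exists_iterate.2 ⟨k, hk.symm⟩ : σ.SameCycle y (g ξ)).symm⟩

end FirstReturn

/-! ### The Conway polynomial as a state sum with base point -/

namespace GaussDiagram

/-- The state sum of a diagram with its signs, with base point before `b`, where only the crossings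
in `T` are live. -/
noncomputable def liveSum (D : GaussDiagram) (T : Finset (Fin D.n)) (b : Fin D.n × Bool) : ℤ[X] :=
  stateSum D.next (fun c => C (D.sign c) * X) (fun _ => true) T b

variable {D E : GaussDiagram}

lemma numComponents_smooth_eq_one_iff (S : Finset (Fin D.n)) (b : Fin D.n × Bool) :
    (D.smooth S).numComponents = 1 ↔
      D.circles = 0 ∧ ∀ y, (D.next * flipOn S).SameCycle b y := by
  rw [← numCycles_eq_one_iff]
  have h1 : 0 < numCycles (D.next * flipOn S) := by
    have : Nonempty (Fin D.n × Bool) := ⟨b⟩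
    exact numCycles_pos _
  change numCycles (D.next * flipOn S) + D.circles = 1 ↔ _
  omega

lemma conway_eq_liveSum (h : 0 < D.n) :
    D.conway = if D.circles = 0 then D.liveSum Finset.univ (⟨0, h⟩, true) else 0 := by
  classical
  have hprod : ∀ S : Finset (Fin D.n), C (∏ c ∈ S, D.sign c) * X ^ S.card =
      ∏ c ∈ S, crossingWeight (fun c => C (D.sign c) * X) (fun _ => true) c := by
    intro S
    simp only [crossingWeight, if_true]
    rw [Finset.prod_mul_distrib, Finset.prod_const, map_prod]
  have hasc : ∀ S : Finset (Fin D.n), D.Ascending S ↔ ∀ c ∈ S,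
      ReachesBefore ⇑(D.next * flipOn S) (⟨0, h⟩, true) (c, false) (c, true) := by
    intro S
    simp only [Ascending, ReachesBefore, Equiv.Perm.iterate_eq_pow]
    rfl
  rw [conway]
  split_ifs with hD
  · rw [liveSum, stateSum, Finset.powerset_univ]
    refine Finset.sum_congr rfl fun S _ => ?_
    rw [hprod]
    refine if_congr ?_ rfl rfl
    rw [numComponents_smooth_eq_one_iff S (⟨0, h⟩, true), hasc]
    simp only [hD, true_and]
    rfl
  · refine Finset.sum_eq_zero fun S _ => if_neg fun h1 => hD ?_
    exact ((numComponents_smooth_eq_one_iff S (⟨0, h⟩, true)).1 h1.1).1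

lemma conway_of_n_eq_zero (h : D.n = 0) : D.conway = if D.circles = 1 then 1 else 0 := by
  have : IsEmpty (Fin D.n) := by rw [h]; infer_instance
  have h1 : D.numComponents = D.circles := by
    rw [numComponents, numCycles_of_isEmpty, zero_add]
  rw [conway, Finset.univ_unique, Finset.sum_singleton,
    Subsingleton.elim (default : Finset (Fin D.n)) ∅]
  have h2 : (D.smooth ∅).numComponents = D.numComponents := by
    unfold smooth numComponents; rw [flipOn_empty, mul_one]
  have h3 : D.Ascending ∅ := by intro c hc; simp at hc
  simp [h2, h1, h3]

lemma liveSum_univ_base (hD : D.Planar) (b b' : Fin D.n × Bool) :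
    D.liveSum Finset.univ b = D.liveSum Finset.univ b' := by
  have := stateSum_base hD ∅ (fun _ => true) b b'
  rwa [flipOn_empty, mul_one, Finset.compl_empty] at this

lemma conway_eq_liveSum_of_planar (hD : D.Planar) (b : Fin D.n × Bool) :
    D.conway = if D.circles = 0 then D.liveSum Finset.univ b else 0 := by
  rw [conway_eq_liveSum (Fin.pos b.1), liveSum_univ_base hD]

lemma liveSum_over {T : Finset (Fin D.n)} (c : Fin D.n) :
    D.liveSum T (c, true) = D.liveSum (T.erase c) (c, true) := stateSum_over rfl

lemma liveSum_next {T : Finset (Fin D.n)} {b : Fin D.n × Bool} (h : b.1 ∉ T) :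
    D.liveSum T b = D.liveSum T (D.next b) := stateSum_next h

/-- A crossing may be dropped when its over-passage follows the base point, and then the base point
may pass on. -/
lemma liveSum_over_next {T : Finset (Fin D.n)} (c : Fin D.n) :
    D.liveSum T (c, true) = D.liveSum (T.erase c) (D.next (c, true)) := by
  rw [liveSum_over, liveSum_next (by simp)]

namespace Deletes

variable {T : Finset (Fin D.n)} {f : Fin E.n → Fin D.n}

lemma firstReturn (h : D.Deletes T E f) :
    FirstReturn D.next (fun x : Fin E.n × Bool => (f x.1, x.2)) E.next := by
  intro x
  obtain ⟨k, h1, h2⟩ := h.next x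
  refine ⟨k, by rw [Equiv.Perm.iterate_eq_pow]; exact h1, fun j hj => ?_⟩
  rintro ⟨y, hy⟩
  have h3 := h2 j hj
  rw [← Equiv.Perm.iterate_eq_pow, ← hy] at h3
  exact (h.range _).1 ⟨y.1, rfl⟩ h3

lemma injective_prod (h : D.Deletes T E f) :
    Function.Injective fun x : Fin E.n × Bool => (f x.1, x.2) := by
  rintro ⟨c, x⟩ ⟨d, y⟩ hxy
  simp only [Prod.mk.injEq] at hxy ⊢
  exact ⟨h.injective hxy.1, hxy.2⟩

lemma circles_le (h : D.Deletes T E f) : D.circles ≤ E.circles := by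
  have h1 := h.components
  have h2 := h.firstReturn.numCycles_le h.injective_prod
  unfold numComponents at h1
  omega

lemma circles_eq_iff (h : D.Deletes T E f) : E.circles = D.circles ↔
    ∀ y, ∃ k, (⇑D.next)^[k] y ∈ Set.range fun x : Fin E.n × Bool => (f x.1, x.2) := by
  have h1 := h.components
  rw [← h.firstReturn.numCycles_eq_iff h.injective_prod]
  unfold numComponents at h1
  omega

lemma sign_eq (h : D.Deletes T E f) (c : Fin E.n) : D.sign (f c) = E.sign c := by
  rw [sign, sign, h.positive]

lemma image_univ (h : D.Deletes T E f) : Finset.univ.image f = Tᶜ := by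
  ext c
  rw [Finset.mem_compl, ← h.range]
  simp

/-- Forgetting crossings agrees with keeping them as marked points that are not live. -/
lemma liveSum_eq (h : D.Deletes T E f) (hc : E.circles = D.circles) (x : Fin E.n × Bool) :
    D.liveSum Tᶜ (f x.1, x.2) = E.liveSum Finset.univ x := by
  have := stateSum_transport (σ₁ := D.next) (σ₂ := E.next) (η₁ := fun c => C (D.sign c) * X)
    (η₂ := fun c => C (E.sign c) * X) (o₁ := fun _ => true) (o₂ := fun _ => true)
    h.injective_prod Function.injective_id h.firstReturn (fun ξ => ⟨0, rfl, by simp⟩)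
    (h.circles_eq_iff.1 hc) (fun y => ⟨0, by simp⟩) (f := f) (T := Finset.univ)
    (fun c _ x => ⟨(c, x), rfl, rfl⟩) (fun c _ => by rw [h.sign_eq]) (fun _ _ => rfl) x
  rwa [h.image_univ] at this

/-- The Conway polynomial of a planar diagram that results from forgetting crossings. If a component
loses all its points, both sides are zero, unless the diagram has no other component. -/
theorem conway_eq (h : D.Deletes T E f) (hE : E.Planar) (b : Fin D.n × Bool) :
    E.conway = if D.circles = 0 then D.liveSum Tᶜ b else 0 := by
  classical
  by_cases hc : E.circles = D.circles
  · obtain ⟨k, hk⟩ := h.circles_eq_iff.1 hc b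
    -- the base point moves to the next crossing that is not forgotten
    obtain ⟨x, hx⟩ : ∃ x : Fin E.n × Bool, D.liveSum Tᶜ b = D.liveSum Tᶜ (f x.1, x.2) := by
      clear hc
      induction k generalizing b with
      | zero =>
        obtain ⟨x, hx⟩ := hk
        exact ⟨x, by rw [← show (f x.1, x.2) = b from hx]⟩
      | succ k ih =>
        by_cases hb : b.1 ∈ T
        · obtain ⟨x, hx⟩ := ih (D.next b) hk
          exact ⟨x, by rw [← hx, liveSum_next (by simpa using hb)]⟩
        · obtain ⟨c, hc⟩ := (h.range _).2 hb
          exact ⟨(c, b.2), by rw [hc]⟩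
    rw [hx, h.liveSum_eq hc, conway_eq_liveSum_of_planar hE x, hc]
  · have hle := h.circles_le
    have hlt : E.circles ≠ 0 := by omega
    -- a component through forgotten crossings only
    have hnot := hc
    rw [h.circles_eq_iff] at hnot
    push Not at hnot
    obtain ⟨y, hy⟩ := hnot
    set Z : Set (Fin D.n × Bool) := {z | D.next.SameCycle y z} with hZ
    have hZT : ∀ z ∈ Z, z.1 ∉ Tᶜ := by
      intro z hz hzT
      obtain ⟨k, hk⟩ := sameCycle_iff_exists_iterate.1 hz
      obtain ⟨c, hc⟩ := (h.range z.1).2 (Finset.mem_compl.1 hzT)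
      exact hy k ⟨(c, z.2), by rw [hk]; simp only [hc]⟩
    by_cases hn : E.n = 0
    · rw [conway_of_n_eq_zero hn]
      have : IsEmpty (Fin E.n) := by rw [hn]; infer_instance
      have hT : Tᶜ = ∅ := by rw [← h.image_univ, Finset.univ_eq_empty, Finset.image_empty]
      have h1 := h.components
      rw [numComponents, numCycles_of_isEmpty, zero_add, numComponents] at h1
      have h2 : 0 < numCycles D.next := by
        have : Nonempty (Fin D.n × Bool) := ⟨b⟩
        exact numCycles_pos _
      have h3 := numCycles_eq_one_iff (σ := D.next) b
      rw [hT, liveSum, stateSum, Finset.powerset_empty, Finset.sum_singleton]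
      have h4 : IsState D.next (fun _ => true) b ∅ ↔ numCycles D.next = 1 := by
        rw [h3, IsState, flipOn_empty, mul_one]; simp
      rw [if_congr h4 rfl rfl, Finset.prod_empty]
      split_ifs <;> first | rfl | omega
    · rw [conway_eq_liveSum (Nat.pos_of_ne_zero hn), if_neg hlt]
      split_ifs
      · symm
        refine stateSum_eq_zero_of_dead (Z := Z)
          (fun z hz => ⟨hZT z hz, Equiv.Perm.sameCycle_apply_right.2 hz⟩)
          ⟨y, Equiv.Perm.SameCycle.refl _ _⟩ ⟨(f ⟨0, Nat.pos_of_ne_zero hn⟩, true), fun hz => ?_⟩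
        exact hZT _ hz (by rw [← h.image_univ]; exact Finset.mem_image_of_mem f (Finset.mem_univ _))
      · rfl

end Deletes

end GaussDiagram

/-! ### Invariance under the Reidemeister moves -/

namespace GaussDiagram

variable {D E : GaussDiagram}

lemma conway_eq_of_iso (hE : E.Planar) (h : D.Iso E) : D.conway = E.conway := by
  obtain ⟨f, hf⟩ := h
  rcases Nat.eq_zero_or_pos D.n with hn | hn
  · have : IsEmpty (Fin D.n) := by rw [hn]; infer_instance
    have : IsEmpty (Fin E.n) := f.isEmpty
    have hn' : E.n = 0 := by
      by_contra h0
      exact isEmptyElim (⟨0, Nat.pos_of_ne_zero h0⟩ : Fin E.n)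
    have h1 := hf.components
    rw [numComponents, numComponents, numCycles_of_isEmpty, numCycles_of_isEmpty, zero_add,
      zero_add] at h1
    rw [conway_of_n_eq_zero hn, conway_of_n_eq_zero hn', h1]
  · rw [hf.conway_eq hE (⟨0, hn⟩, true), conway_eq_liveSum hn, Finset.compl_empty]

/-- With the base point before the over-passage of the kink, its crossing belongs to no state. -/
lemma conway_eq_of_reidemeisterOne (hD : D.Planar) (hE : E.Planar) (h : D.ReidemeisterOne E) :
    D.conway = E.conway := by
  obtain ⟨c, -, -, f, hf⟩ := h
  rw [hf.conway_eq hE (c, true), conway_eq_liveSum_of_planar hD (c, true), liveSum_over,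
    ← Finset.compl_singleton]

/-- With the base point before the two over-passages, the two crossings belong to no state. -/
lemma conway_eq_of_reidemeisterTwo (hD : D.Planar) (hE : E.Planar) (h : D.ReidemeisterTwo E) :
    D.conway = E.conway := by
  obtain ⟨c, d, -, -, h1, -, f, hf⟩ := h
  rw [hf.conway_eq hE (d, true), conway_eq_liveSum_of_planar hD (c, true), liveSum_over_next, h1,
    liveSum_over, ← Finset.compl_singleton, ← Finset.compl_insert, Finset.pair_comm]

/-- The strand that is over at both `p` and `q` is moved over the crossing of the passages `v` and
`w`: with the base point before its passages, the crossings `p` and `q` belong to no state, and the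
other two passages of these crossings may slide over `v` and `w`. -/
lemma liveSum_triangle (hD : D.Planar) (hE : E.Planar) {p q : Fin D.n} {v w : Fin D.n × Bool}
    (hpq : p ≠ q) (hvp : v.1 ≠ p) (hvq : v.1 ≠ q) (hwp : w.1 ≠ p) (hwq : w.1 ≠ q) (hvw : v ≠ w)
    (h1 : D.next (p, true) = (q, true) ∨ D.next (q, true) = (p, true))
    (h2 : D.next (p, false) = v ∨ D.next v = (p, false))
    (h3 : D.next (q, false) = w ∨ D.next w = (q, false))
    {π : Equiv.Perm (Fin D.n × Bool)}
    (hπ : π = Equiv.swap (p, true) (q, true) * Equiv.swap (p, false) v * Equiv.swap (q, false) w)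
    (hEn : E = { D with next := π * D.next * π⁻¹ }) : D.conway = E.conway := by
  wlog h1' : D.next (p, true) = (q, true) generalizing p q v w with H
  · refine H hpq.symm hwq hwp hvq hvp hvw.symm h1.symm h3 h2 ?_ (h1.resolve_left h1')
    rw [hπ, Equiv.swap_comm (p, true), mul_assoc, mul_assoc]
    congr 1
    refine (Equiv.Perm.Disjoint.commute ?_).eq
    intro z
    rcases eq_or_ne z (q, false) with rfl | hz1
    · left
      exact Equiv.swap_apply_of_ne_of_ne (by simp [hpq.symm]) (by rintro rfl; exact hvq rfl)
    rcases eq_or_ne z w with rfl | hz2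
    · left
      exact Equiv.swap_apply_of_ne_of_ne (by rintro rfl; exact hwp rfl) hvw.symm
    · exact Or.inr (Equiv.swap_apply_of_ne_of_ne hz1 hz2)
  clear h1
  subst hEn
  rw [conway_eq_liveSum_of_planar hD (p, true), conway_eq_liveSum_of_planar hE (q, true)]
  congr 1
  have hvp' : ∀ x, v ≠ (p, x) := by rintro x rfl; exact hvp rfl
  have hvq' : ∀ x, v ≠ (q, x) := by rintro x rfl; exact hvq rfl
  have hwp' : ∀ x, w ≠ (p, x) := by rintro x rfl; exact hwp rfl
  have hwq' : ∀ x, w ≠ (q, x) := by rintro x rfl; exact hwq rfl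
  set s₁ := Equiv.swap (p, true) (q, true) with hs₁
  set s₂ := Equiv.swap (p, false) v with hs₂
  set s₃ := Equiv.swap (q, false) w with hs₃
  have h₃v : s₃ v = v := Equiv.swap_apply_of_ne_of_ne (hvq' _) hvw
  have h₃p : ∀ x, s₃ (p, x) = (p, x) := fun x =>
    Equiv.swap_apply_of_ne_of_ne (by simp [hpq]) (hwp' _).symm
  have h₃q : s₃ (q, true) = (q, true) := Equiv.swap_apply_of_ne_of_ne (by simp) (hwq' _).symm
  have h₂p : s₂ (p, true) = (p, true) := Equiv.swap_apply_of_ne_of_ne (by simp) (hvp' _).symm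
  have h₂q : s₂ (q, true) = (q, true) :=
    Equiv.swap_apply_of_ne_of_ne (by simp) (hvq' _).symm
  have hE1 : (π * D.next * π⁻¹ : Equiv.Perm (Fin D.n × Bool)) (q, true) = (p, true) := by
    have hπp : π (p, true) = (q, true) := by
      rw [hπ, Equiv.Perm.mul_apply, Equiv.Perm.mul_apply, h₃p, h₂p, hs₁, Equiv.swap_apply_left]
    have hπq : π (q, true) = (p, true) := by
      rw [hπ, Equiv.Perm.mul_apply, Equiv.Perm.mul_apply, h₃q, h₂q, hs₁, Equiv.swap_apply_right]
    rw [Equiv.Perm.mul_apply, Equiv.Perm.mul_apply, Equiv.Perm.inv_eq_iff_eq.2 hπp.symm, h1', hπq]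
  rw [liveSum_over_next, h1', liveSum_over]
  refine Eq.trans ?_ ((liveSum_over_next (D := { D with next := π * D.next * π⁻¹ }) q).trans
    ((congrArg _ hE1).trans
      (liveSum_over (D := { D with next := π * D.next * π⁻¹ }) p))).symm
  rw [Finset.erase_right_comm (a := q)]
  set T := (Finset.univ.erase p).erase q with hT
  set η : Fin D.n → ℤ[X] := fun c => C (D.sign c) * X with hη
  change stateSum D.next η (fun _ => true) T (q, true) =
    stateSum (π * D.next * π⁻¹) η (fun _ => true) T (p, true)
  have hpT : p ∉ T := by simp [hT]
  have hqT : q ∉ T := by simp [hT]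
  have hadj : (s₃ * D.next * s₃⁻¹) (p, false) = v ∨ (s₃ * D.next * s₃⁻¹) v = (p, false) := by
    simp only [Equiv.Perm.mul_apply, Equiv.Perm.inv_eq_iff_eq.2 (h₃p false).symm,
      Equiv.Perm.inv_eq_iff_eq.2 h₃v.symm]
    exact h2.imp (fun h => by rw [h, h₃v]) fun h => by rw [h, h₃p]
  rw [← stateSum_slide (σ := D.next) (d := (q, false)) (y := w) (b := (q, true)) hqT (by simp)
      (hwq' _).symm h3,
    ← stateSum_slide (d := (p, false)) (y := v) (b := (q, true)) hpT (by simp)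
      (hvp' _).symm hadj,
    ← stateSum_conj s₁ fun x hx => Equiv.swap_apply_of_ne_of_ne
      (by rintro rfl; exact hpT hx) (by rintro rfl; exact hqT hx),
    hs₁, Equiv.swap_apply_right, hπ]
  simp only [mul_inv_rev, mul_assoc]
  rfl

/-- The product of the exchanges of the ends of the three edges of a triangle does not depend on the
order of the edges. -/
lemma swap_triangle_rotate {n : ℕ} {x y z : Fin n × Bool} (hxy : x.1 ≠ y.1) (hyz : y.1 ≠ z.1)
    (hzx : z.1 ≠ x.1) :
    Equiv.swap x (y.1, !y.2) * Equiv.swap y (z.1, !z.2) * Equiv.swap z (x.1, !x.2) =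
      Equiv.swap y (z.1, !z.2) * Equiv.swap z (x.1, !x.2) * Equiv.swap x (y.1, !y.2) := by
  have hcomm : ∀ a b c d : Fin n × Bool, a ≠ c → a ≠ d → b ≠ c → b ≠ d →
      Commute (Equiv.swap a b) (Equiv.swap c d) := by
    intro a b c d h1 h2 h3 h4
    refine Equiv.Perm.Disjoint.commute fun z => ?_
    by_cases hz : z = a ∨ z = b
    · right
      rcases hz with rfl | rfl
      · exact Equiv.swap_apply_of_ne_of_ne h1 h2
      · exact Equiv.swap_apply_of_ne_of_ne h3 h4
    · push Not at hz
      exact Or.inl (Equiv.swap_apply_of_ne_of_ne hz.1 hz.2)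
  rw [mul_assoc]
  exact ((hcomm x (y.1, !y.2) y (z.1, !z.2) (fun h => hxy (Prod.ext_iff.1 h).1)
    (fun h => hzx (Prod.ext_iff.1 h).1.symm) (fun h => Bool.not_ne_self y.2 (Prod.ext_iff.1 h).2)
    (fun h => hyz (Prod.ext_iff.1 h).1)).mul_right (hcomm x (y.1, !y.2) z (x.1, !x.2)
    (fun h => hzx (Prod.ext_iff.1 h).1.symm) (fun h => Bool.self_ne_not x.2 (Prod.ext_iff.1 h).2)
    (fun h => hyz (Prod.ext_iff.1 h).1) (fun h => hxy (Prod.ext_iff.1 h).1.symm))).eq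

/-- Invariance under the exchange along a triangle whose edge between `x` and `(y.1, !y.2)` is over
at both ends. -/
lemma conway_eq_of_triangle (hD : D.Planar) (hE : E.Planar) {x y z : Fin D.n × Bool}
    (hxy : x.1 ≠ y.1) (hyz : y.1 ≠ z.1) (hzx : z.1 ≠ x.1)
    (h1 : D.next x = (y.1, !y.2) ∨ D.next (y.1, !y.2) = x)
    (h2 : D.next y = (z.1, !z.2) ∨ D.next (z.1, !z.2) = y)
    (h3 : D.next z = (x.1, !x.2) ∨ D.next (x.1, !x.2) = z)
    (hx : x.2 = true) (hy : y.2 = false) {π : Equiv.Perm (Fin D.n × Bool)}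
    (hπ : π = Equiv.swap x (y.1, !y.2) * Equiv.swap y (z.1, !z.2) * Equiv.swap z (x.1, !x.2))
    (hEn : E = { D with next := π * D.next * π⁻¹ }) : D.conway = E.conway := by
  obtain ⟨p, x⟩ := x
  obtain ⟨q, y⟩ := y
  simp only at hx hy
  subst hx hy
  exact liveSum_triangle hD hE (p := q) (q := p) (v := (z.1, !z.2)) (w := z) hxy.symm hyz.symm
    hzx hyz.symm hzx (fun h => by simpa using congrArg Prod.snd h) h1.symm h2 h3.symm
    (by rw [hπ, Equiv.swap_comm (p, true), Equiv.swap_comm z]; rfl) hEn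

lemma conway_eq_of_reidemeisterThree (hD : D.Planar) (hE : E.Planar) (h : D.ReidemeisterThree E) :
    D.conway = E.conway := by
  obtain ⟨h₁, h₂, h₃, e1, e2, e3, n1, n2, n3, hover, -, hEn⟩ := h
  -- the corner at the end of an edge of a face
  have hend : ∀ h h' : D.HalfEdge, D.face h = h' → (D.otherEnd h).1 = (h'.1.1, !h'.1.2) := by
    rintro h _ rfl
    rw [face, Equiv.Perm.mul_apply]
    simp [rotate]
  have hadj : ∀ h : D.HalfEdge, D.next h.1 = (D.otherEnd h).1 ∨ D.next (D.otherEnd h).1 = h.1 := by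
    rintro ⟨x, d⟩
    cases d
    · right; simp [otherEnd]
    · left; simp [otherEnd]
  have E1 := hend _ _ e1
  have E2 := hend _ _ e2
  have E3 := hend _ _ e3
  have A1 := hadj h₁
  have A2 := hadj h₂
  have A3 := hadj h₃
  rw [swapEnds, swapEnds, swapEnds, E1, E2, E3] at hEn
  rw [E1] at A1
  rw [E2] at A2
  rw [E3] at A3
  obtain ⟨h, hh, t1, t2⟩ := hover
  rcases hh with rfl | rfl | rfl
  · rw [E1] at t2
    exact conway_eq_of_triangle hD hE n1 n2 n3 A1 A2 A3 t1 (by simpa using t2) rfl hEn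
  · rw [E2] at t2
    exact conway_eq_of_triangle hD hE n2 n3 n1 A2 A3 A1 t1 (by simpa using t2)
      (swap_triangle_rotate n1 n2 n3) hEn
  · rw [E3] at t2
    exact conway_eq_of_triangle hD hE n3 n1 n2 A3 A1 A2 t1 (by simpa using t2)
      ((swap_triangle_rotate n1 n2 n3).trans (swap_triangle_rotate n2 n3 n1)) hEn

end GaussDiagram

namespace LinkDiagram

lemma conway_eq_of_move {D E : LinkDiagram} (h : D.Move E) :
    D.toGaussDiagram.conway = E.toGaussDiagram.conway := by
  rcases h with h | h | h | h
  · exact GaussDiagram.conway_eq_of_iso E.planar h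
  · exact GaussDiagram.conway_eq_of_reidemeisterOne D.planar E.planar h
  · exact GaussDiagram.conway_eq_of_reidemeisterTwo D.planar E.planar h
  · exact GaussDiagram.conway_eq_of_reidemeisterThree D.planar E.planar h

/-- The Conway polynomial of a link may be computed from any diagram. -/
theorem link_conway (D : LinkDiagram) : D.link.conway = D.toGaussDiagram.conway := by
  have key : ∀ D E : LinkDiagram, Relation.EqvGen LinkDiagram.Move D E →
      D.toGaussDiagram.conway = E.toGaussDiagram.conway := by
    intro D E h
    induction h with
    | rel _ _ h => exact conway_eq_of_move h
    | refl _ => rfl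
    | symm _ _ _ ih => exact ih.symm
    | trans _ _ _ _ _ ih1 ih2 => exact ih1.trans ih2
  exact key _ _ (Quotient.exact (Quotient.out_eq D.link))

end LinkDiagram

/-! ### The skein relation -/

/-- A crossing change is the same as exchanging which of the two passages is over. -/
lemma stateSum_switch {n : ℕ} {R : Type*} [CommRing R] {σ : Equiv.Perm (Fin n × Bool)}
    {η : Fin n → R} {o : Fin n → Bool} (T : Finset (Fin n)) {c : Fin n} (b : Fin n × Bool) :
    stateSum (flipOn {c} * σ * flipOn {c}) (Function.update η c (-η c)) o T (flipOn {c} b) =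
      stateSum σ η (Function.update o c (!o c)) T b := by
  classical
  refine Finset.sum_congr rfl fun S _ => ?_
  have hconj : flipOn {c} * σ * flipOn {c} * flipOn S =
      flipOn {c} * (σ * flipOn S) * (flipOn {c})⁻¹ := by
    rw [flipOn_inv, mul_assoc, flipOn_comm, mul_assoc, mul_assoc, mul_assoc]
  have hstate : IsState (flipOn {c} * σ * flipOn {c}) o (flipOn {c} b) S ↔
      IsState σ (Function.update o c (!o c)) b S := by
    have hflip : ∀ d x, (d, x) = flipOn {c} (flipOn {c} (d, x)) := fun d x => by
      rw [← Equiv.Perm.mul_apply, flipOn_mul]; simp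
    have hupd : ∀ d, flipOn {c} (d, o d) = (d, Function.update o c (!o c) d) := by
      intro d
      by_cases hd : d = c
      · subst hd; rw [flipOn_of_mem (by simp), Function.update_self]
      · rw [flipOn_of_notMem (by simpa using hd), Function.update_of_ne hd]
    have hupd' : ∀ d, flipOn {c} (d, !o d) = (d, !Function.update o c (!o c) d) := by
      intro d
      by_cases hd : d = c
      · subst hd; rw [flipOn_of_mem (by simp), Function.update_self]
      · rw [flipOn_of_notMem (by simpa using hd), Function.update_of_ne hd]
    rw [IsState, IsState, hconj]
    refine and_congr ?_ (forall₂_congr fun d _ => ?_)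
    · rw [← (flipOn {c}).forall_congr_right]
      refine forall_congr' fun y => ?_
      rw [sameCycle_iff_reachesBefore, reachesBefore_conj, sameCycle_iff_reachesBefore]
    · rw [hflip d (o d), hflip d (!o d), reachesBefore_conj, hupd, hupd']
  refine if_congr hstate ?_ rfl
  · refine Finset.prod_congr rfl fun d _ => ?_
    rw [crossingWeight, crossingWeight]
    by_cases hd : d = c
    · subst hd; cases o d <;> simp
    · simp [hd]

namespace GaussDiagram

variable {D : GaussDiagram}

/-- The Conway polynomial after a crossing change, as a state sum on the same curves. -/
lemma conway_switch (hD : D.Planar) (c : Fin D.n) (b : Fin D.n × Bool) :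
    (D.switch c).conway = if D.circles = 0 then
      stateSum D.next (fun c => C (D.sign c) * X) (Function.update (fun _ => true) c false)
        Finset.univ b else 0 := by
  rw [conway_eq_liveSum (D := D.switch c) (Fin.pos c), liveSum]
  refine if_congr Iff.rfl ?_ rfl
  change stateSum (flipOn {c} * D.next * flipOn {c})
    (fun d : Fin D.n => C ((D.switch c).sign d) * X) (fun _ => true) Finset.univ
    ((⟨0, Fin.pos c⟩ : Fin D.n), true) = _
  have h1 : (fun d : Fin D.n => C ((D.switch c).sign d) * X) = Function.update
      (fun d => C (D.sign d) * X) c (-(C (D.sign c) * X)) := by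
    funext d
    by_cases hd : d = c
    · subst hd
      rw [Function.update_self, ← neg_mul, ← map_neg]
      congr 2
      simp only [sign, switch, Function.update_self]
      cases D.positive d <;> simp
    · rw [Function.update_of_ne hd]
      simp [sign, switch, hd]
  have h2 : ((⟨0, Fin.pos c⟩ : Fin D.n), true) =
      flipOn {c} (flipOn {c} ((⟨0, Fin.pos c⟩ : Fin D.n), true)) := by
    rw [← Equiv.Perm.mul_apply, flipOn_mul]; simp
  have h3 := stateSum_switch (σ := D.next) (η := fun d => C (D.sign d) * X) (o := fun _ => true)
    Finset.univ (c := c) (flipOn {c} ((⟨0, Fin.pos c⟩ : Fin D.n), true))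
  rw [← h2, ← h1] at h3
  refine h3.trans ?_
  have h4 := stateSum_base hD ∅ (Function.update (fun _ => true) c false)
    (flipOn {c} ((⟨0, Fin.pos c⟩ : Fin D.n), true)) b
  rwa [flipOn_empty, mul_one, Finset.compl_empty] at h4

end GaussDiagram

/-- The Conway polynomial has its defining properties: the diagrams of a skein triple may be given a
common base point, at which `stateSum_skein` applies. -/
theorem conway_isConwayPolynomial : OrientedLink.IsConwayPolynomial OrientedLink.conway where
  unknot D hn hc := by
    rw [LinkDiagram.link_conway, GaussDiagram.conway_of_n_eq_zero hn, if_pos hc]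
  skein Dpos Dneg Dzero c hc hneg hzero := by
    obtain ⟨f, hf⟩ := hzero
    rw [LinkDiagram.link_conway, LinkDiagram.link_conway, LinkDiagram.link_conway, hneg,
      GaussDiagram.conway_switch Dpos.planar c (c, true), hf.conway_eq Dzero.planar (c, true),
      GaussDiagram.conway_eq_liveSum_of_planar Dpos.planar (c, true)]
    change (if Dpos.circles = 0 then _ else _) - (if Dpos.circles = 0 then _ else _) =
      X * if Dpos.circles = 0 then _ else _
    split_ifs
    · rw [GaussDiagram.liveSum, stateSum_skein (Finset.mem_univ c) rfl, add_sub_cancel_left,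
        ← Finset.compl_singleton]
      have h1 : Dpos.sign c = 1 := by simp [GaussDiagram.sign, hc]
      rw [h1, map_one, one_mul]
      rfl
    · simp

/-! ### Lassos -/

/-- Iterating `τ` from `x`, one runs through the list `l` and then arrives at `y`. -/
lemma iterate_of_isChain {α : Type*} {τ : α → α} {x y : α} {l : List α}
    (h : List.IsChain (fun a b => τ a = b) (x :: (l ++ [y]))) :
    τ^[l.length + 1] x = y ∧ (∀ j < l.length, τ^[j + 1] x ∈ l) ∧
      (∀ z ∈ x :: l, ∃ k, τ^[k] z = y) ∧
      ∀ z ∈ x :: l, ∃ k ≤ l.length, τ^[k] x = z := by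
  induction l generalizing x with
  | nil =>
    have h1 : τ x = y := by simpa using h
    refine ⟨h1, by simp, fun z hz => ?_, fun z hz => ?_⟩
    · obtain rfl : z = x := by simpa using hz
      exact ⟨1, h1⟩
    · obtain rfl : z = x := by simpa using hz
      exact ⟨0, by simp, rfl⟩
  | cons a l ih =>
    rw [List.cons_append, List.isChain_cons_cons] at h
    obtain ⟨rfl, h⟩ := h
    obtain ⟨h1, h2, h3, h4⟩ := ih h
    refine ⟨h1, fun j hj => ?_, fun z hz => ?_, fun z hz => ?_⟩
    · obtain _ | j := j
      · exact List.mem_cons_self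
      · exact List.mem_cons_of_mem _ (h2 j (by simpa using hj))
    · rcases List.mem_cons.1 hz with rfl | hz
      · exact ⟨l.length + 1 + 1, h1⟩
      · exact h3 z hz
    · rcases List.mem_cons.1 hz with rfl | hz
      · exact ⟨0, by simp, rfl⟩
      · obtain ⟨k, hk, hk'⟩ := h4 z hz
        exact ⟨k + 1, by simpa using hk, hk'⟩

lemma stateSum_iterate {n : ℕ} {R : Type*} [CommRing R] {σ : Equiv.Perm (Fin n × Bool)}
    {η : Fin n → R} {o : Fin n → Bool} {T : Finset (Fin n)} (k : ℕ) (b : Fin n × Bool)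
    (h : ∀ j < k, ((⇑σ)^[j] b).1 ∉ T) :
    stateSum σ η o T b = stateSum σ η o T ((⇑σ)^[k] b) := by
  induction k generalizing b with
  | zero => rfl
  | succ k ih =>
    rw [stateSum_next (b := b) (h 0 (by omega)), ih (σ b) fun j hj => h (j + 1) (by omega)]
    rfl

namespace GaussDiagram

variable {D E : GaussDiagram}

/-- The first point of `E` that one meets on the way to the passage `x` of `D`: on the way to `p`
this is the crossing with the loop. -/
def lassoPoint (p : Fin D.n) (f : Fin D.n → Fin E.n) (ai bi : Fin E.n) (x : Fin D.n × Bool) :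
    Fin E.n × Bool :=
  if x.1 = p then (if x.2 then (ai, true) else (bi, false)) else (f x.1, x.2)

/-- How `E` results from `D` by lassoing at `p`, apart from the loop itself: the two strands through
`p` run through `ai`, `f p`, `ao` and through `bi`, `f p`, `bo`. -/
structure IsLasso (D E : GaussDiagram) (p : Fin D.n) (f : Fin D.n → Fin E.n)
    (ai ao bi bo : Fin E.n) : Prop where
  injective : Function.Injective f
  range : ∀ c, c ∈ Set.range f ↔ c ∉ ({ai, ao, bi, bo} : Finset (Fin E.n))
  nodup : [f p, ai, ao, bi, bo].Nodup
  sign : ∀ c, c ≠ p → E.sign (f c) = D.sign c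
  next_ai : E.next (ai, true) = (f p, false)
  next_a : E.next (f p, false) = (ao, true)
  next_ao : E.next (ao, true) = lassoPoint p f ai bi (D.next (p, true))
  next_bi : E.next (bi, false) = (f p, true)
  next_b : E.next (f p, true) = (bo, false)
  next_bo : E.next (bo, false) = lassoPoint p f ai bi (D.next (p, false))
  next_of_ne : ∀ c x, c ≠ p → E.next (f c, x) = lassoPoint p f ai bi (D.next (c, x))

namespace IsLasso

variable {p : Fin D.n} {f : Fin D.n → Fin E.n} {ai ao bi bo : Fin E.n}

lemma ne (h : IsLasso D E p f ai ao bi bo) :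
    (ai ≠ f p ∧ ao ≠ f p ∧ bi ≠ f p ∧ bo ≠ f p ∧ ao ≠ ai ∧ bi ≠ ai ∧ bo ≠ ai ∧ bi ≠ ao ∧ bo ≠ ao ∧
      bo ≠ bi) ∧
    f p ≠ ai ∧ f p ≠ ao ∧ f p ≠ bi ∧ f p ≠ bo ∧ ai ≠ ao ∧ ai ≠ bi ∧ ai ≠ bo ∧ ao ≠ bi ∧ ao ≠ bo ∧
      bi ≠ bo := by
  have := h.nodup
  simp only [List.nodup_cons, List.mem_cons, List.not_mem_nil, or_false, not_or] at this
  tauto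

lemma map_ne (h : IsLasso D E p f ai ao bi bo) {c : Fin D.n} (hc : c ≠ p) :
    f c ∉ ({f p, ai, ao, bi, bo} : Finset (Fin E.n)) := by
  rw [Finset.mem_insert, not_or]
  exact ⟨fun h' => hc (h.injective h'), (h.range _).1 ⟨c, rfl⟩⟩

lemma image_compl (h : IsLasso D E p f ai ao bi bo) :
    ({p}ᶜ : Finset (Fin D.n)).image f = {f p, ai, ao, bi, bo}ᶜ := by
  ext d
  constructor
  · intro hd
    obtain ⟨c, hc, rfl⟩ := Finset.mem_image.1 hd
    exact Finset.mem_compl.2 (h.map_ne (by simpa using hc))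
  · intro hd
    rw [Finset.mem_compl, Finset.mem_insert, not_or, ← h.range] at hd
    obtain ⟨hd, c, rfl⟩ := hd
    exact Finset.mem_image_of_mem f (by simpa using fun hc : c = p => hd (by rw [hc]))

lemma lassoPoint_injective (h : IsLasso D E p f ai ao bi bo) :
    Function.Injective (lassoPoint p f ai bi) := by
  have hne := h.ne
  have hf : ∀ c, c ≠ p → f c ≠ ai ∧ f c ≠ bi := fun c hc => by
    have := h.map_ne hc
    simp only [Finset.mem_insert, Finset.mem_singleton, not_or] at this
    tauto
  rintro ⟨c, x⟩ ⟨d, y⟩ hxy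
  unfold lassoPoint at hxy
  by_cases hc : c = p <;> by_cases hd : d = p
  · cases x <;> cases y <;> simp_all
  · have := hf d hd
    cases x <;> simp_all [eq_comm]
  · have := hf c hc
    cases y <;> simp_all [eq_comm]
  · simp only [hc, hd, if_false, Prod.mk.injEq] at hxy
    rw [h.injective hxy.1, hxy.2]

/-- A curve system `τ` on `E` that, apart from marked points, runs like the curve system `ρ` on `D`:
the lists `la` and `lb` are the points on the strands that `τ` follows from `(ai, true)` and
from `(bi, false)` on. -/
lemma stateSum_eq (h : IsLasso D E p f ai ao bi bo) {τ : Equiv.Perm (Fin E.n × Bool)}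
    {ρ : Equiv.Perm (Fin D.n × Bool)} {la lb : List (Fin E.n × Bool)}
    (hτ : ∀ c x, c ≠ p → τ (f c, x) = lassoPoint p f ai bi (ρ (c, x)))
    (ha : List.IsChain (fun a b => τ a = b)
      ((ai, true) :: (la ++ [lassoPoint p f ai bi (ρ (p, true))])))
    (hb : List.IsChain (fun a b => τ a = b)
      ((bi, false) :: (lb ++ [lassoPoint p f ai bi (ρ (p, false))])))
    (hl : ∀ z ∈ la ++ lb, z.1 ∈ ({f p, ai, ao, bi, bo} : Finset (Fin E.n)) ∧ z ≠ (ai, true) ∧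
      z ≠ (bi, false))
    (hcov : ∀ c ∈ ({f p, ai, ao, bi, bo} : Finset (Fin E.n)), ∀ x,
      (c, x) ∈ (ai, true) :: la ∨ (c, x) ∈ (bi, false) :: lb)
    {b : Fin E.n × Bool} (hbl : b ∈ (ai, true) :: la) :
    stateSum τ (fun c => C (E.sign c) * X) (fun _ => true) {f p, ai, ao, bi, bo}ᶜ b =
      stateSum ρ (fun c => C (D.sign c) * X) (fun _ => true) {p}ᶜ (p, true) := by
  set g := lassoPoint p f ai bi with hg
  have hga : g (p, true) = (ai, true) := by simp [hg, lassoPoint]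
  have hgb : g (p, false) = (bi, false) := by simp [hg, lassoPoint]
  have hgc : ∀ c x, c ≠ p → g (c, x) = (f c, x) := fun c x hc => by simp [hg, lassoPoint, hc]
  obtain ⟨ha1, ha2, ha3, ha4⟩ := iterate_of_isChain ha
  obtain ⟨hb1, hb2, hb3, -⟩ := iterate_of_isChain hb
  have hnot : ∀ z ∈ la ++ lb, z ∉ Set.range g := by
    rintro z hz ⟨⟨c, x⟩, rfl⟩
    obtain ⟨h1, h2, h3⟩ := hl _ hz
    by_cases hc : c = p
    · subst hc
      cases x
      · exact h3 hgb
      · exact h2 hga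
    · rw [hgc c x hc] at h1
      exact h.map_ne hc h1
  have hret : FirstReturn τ g ρ := by
    rintro ⟨c, x⟩
    by_cases hc : c = p
    · subst hc
      cases x
      · rw [hgb]
        exact ⟨lb.length, hb1, fun j hj => hnot _ (List.mem_append_right _ (hb2 j hj))⟩
      · rw [hga]
        exact ⟨la.length, ha1, fun j hj => hnot _ (List.mem_append_left _ (ha2 j hj))⟩
    · exact ⟨0, by rw [hgc c x hc]; exact hτ c x hc, by simp⟩
  have hreach : ∀ z, ∃ k, (⇑τ)^[k] z ∈ Set.range g := by
    rintro ⟨d, x⟩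
    by_cases hd : d ∈ ({f p, ai, ao, bi, bo} : Finset (Fin E.n))
    · rcases hcov d hd x with hz | hz
      · obtain ⟨k, hk⟩ := ha3 _ hz
        exact ⟨k, _, hk.symm⟩
      · obtain ⟨k, hk⟩ := hb3 _ hz
        exact ⟨k, _, hk.symm⟩
    · rw [← Finset.mem_compl, ← h.image_compl] at hd
      obtain ⟨c, hc, rfl⟩ := Finset.mem_image.1 hd
      exact ⟨0, (c, x), hgc c x (by simpa using hc)⟩
  have key := stateSum_transport (σ₁ := τ) (σ₂ := ρ) (η₁ := fun c => C (E.sign c) * X)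
    (η₂ := fun c => C (D.sign c) * X) (o₁ := fun _ => true) (o₂ := fun _ => true)
    h.lassoPoint_injective Function.injective_id hret (fun ξ => ⟨0, rfl, by simp⟩) hreach
    (fun y => ⟨0, by simp⟩) (f := f) (T := {p}ᶜ)
    (fun c hc x => ⟨(c, x), rfl, hgc c x (by simpa using hc)⟩)
    (fun c hc => by rw [h.sign c (by simpa using hc)]) (fun _ _ => rfl) (p, true)
  rw [h.image_compl, ← hg, hga] at key
  rw [← id_eq (p, true), ← key]
  obtain ⟨k, hk, rfl⟩ := ha4 b hbl
  refine (stateSum_iterate k _ fun j hj => ?_).symm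
  rw [Finset.mem_compl, not_not]
  obtain _ | j := j
  · simp
  · exact (hl _ (List.mem_append_left _ (ha2 j (by omega)))).1

end IsLasso

end GaussDiagram

/-! ### The Conway polynomial of a lassoed diagram -/

namespace GaussDiagram

/-- A component that is over at `u` and `w` and under at `v` and `x`, in the order `u`, `v`, `w`,
`x`. -/
def IsLoop (E : GaussDiagram) (u v w x : Fin E.n) : Prop :=
  E.next (u, true) = (v, false) ∧ E.next (v, false) = (w, true) ∧ E.next (w, true) = (x, false) ∧
    E.next (x, false) = (u, true)

namespace IsLasso

variable {D E : GaussDiagram} {p : Fin D.n} {f : Fin D.n → Fin E.n} {ai ao bi bo u w : Fin E.n}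

lemma map_ne' (h : IsLasso D E p f ai ao bi bo) {c : Fin D.n} (hc : c ≠ p) :
    f c ≠ f p ∧ f c ≠ ai ∧ f c ≠ ao ∧ f c ≠ bi ∧ f c ≠ bo := by
  have := h.map_ne hc
  simpa only [Finset.mem_insert, Finset.mem_singleton, not_or] using this

/-- Smoothing `ai` inserts the loop into the strand through `ai`. -/
lemma stateSum_flip_ai (h : IsLasso D E p f ai ao bi bo) (hl : E.IsLoop u ao w ai)
    (huw : u = bo ∧ w = bi ∨ u = bi ∧ w = bo) :
    stateSum (E.next * flipOn {ai}) (fun c => C (E.sign c) * X) (fun _ => true)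
        {f p, ai, ao, bi, bo}ᶜ (f p, false) = D.liveSum {p}ᶜ (p, true) := by
  obtain ⟨n1, n2⟩ := h.ne
  obtain ⟨l1, l2, l3, l4⟩ := hl
  refine h.stateSum_eq
    (la := [(u, true), (ao, false), (w, true), (ai, false), (f p, false), (ao, true)])
    (lb := [(f p, true), (bo, false)]) (fun c x hc => ?_) ?_ ?_ ?_ ?_ (by simp)
  · simp [flipOn_apply, h.map_ne' hc, h.next_of_ne c x hc]
  all_goals rcases huw with ⟨rfl, rfl⟩ | ⟨rfl, rfl⟩
  all_goals simp [flipOn_apply, n1, n2, l1, l2, l3, l4, h.next_ai, h.next_a, h.next_ao, h.next_bi,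
    h.next_b, h.next_bo]

/-- Smoothing `ai` and `f p` amounts to smoothing `p` in `D`. -/
lemma stateSum_flip_ai_p (h : IsLasso D E p f ai ao bi bo) (hl : E.IsLoop u ao w ai)
    (huw : u = bo ∧ w = bi ∨ u = bi ∧ w = bo) :
    stateSum (E.next * flipOn {ai} * flipOn {f p}) (fun c => C (E.sign c) * X) (fun _ => true)
        {f p, ai, ao, bi, bo}ᶜ (f p, false) =
      stateSum (D.next * flipOn {p}) (fun c => C (D.sign c) * X) (fun _ => true) {p}ᶜ
        (p, true) := by
  obtain ⟨n1, n2⟩ := h.ne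
  obtain ⟨l1, l2, l3, l4⟩ := hl
  refine h.stateSum_eq (ρ := D.next * flipOn {p})
    (la := [(u, true), (ao, false), (w, true), (ai, false), (f p, false), (bo, false)])
    (lb := [(f p, true), (ao, true)]) (fun c x hc => ?_) ?_ ?_ ?_ ?_ (by simp)
  · simp [flipOn_apply, h.map_ne' hc, h.next_of_ne c x hc, hc]
  all_goals rcases huw with ⟨rfl, rfl⟩ | ⟨rfl, rfl⟩
  all_goals simp [flipOn_apply, n1, n2, l1, l2, l3, l4, h.next_ai, h.next_a, h.next_ao, h.next_bi,
    h.next_b, h.next_bo]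

/-- Smoothing `ao` inserts the loop into the strand through `ao`. -/
lemma stateSum_flip_ao (h : IsLasso D E p f ai ao bi bo) (hl : E.IsLoop u ao w ai)
    (huw : u = bo ∧ w = bi ∨ u = bi ∧ w = bo) :
    stateSum (E.next * flipOn {ao}) (fun c => C (E.sign c) * X) (fun _ => true)
        {f p, ai, ao, bi, bo}ᶜ (u, true) = D.liveSum {p}ᶜ (p, true) := by
  obtain ⟨n1, n2⟩ := h.ne
  obtain ⟨l1, l2, l3, l4⟩ := hl
  refine h.stateSum_eq
    (la := [(f p, false), (ao, true), (w, true), (ai, false), (u, true), (ao, false)])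
    (lb := [(f p, true), (bo, false)]) (fun c x hc => ?_) ?_ ?_ ?_ ?_ (by simp)
  · simp [flipOn_apply, h.map_ne' hc, h.next_of_ne c x hc]
  all_goals rcases huw with ⟨rfl, rfl⟩ | ⟨rfl, rfl⟩
  all_goals simp [flipOn_apply, n1, n2, l1, l2, l3, l4, h.next_ai, h.next_a, h.next_ao, h.next_bi,
    h.next_b, h.next_bo]

/-- Smoothing `ao` and `f p` amounts to smoothing `p` in `D`. -/
lemma stateSum_flip_ao_p (h : IsLasso D E p f ai ao bi bo) (hl : E.IsLoop u ao w ai)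
    (huw : u = bo ∧ w = bi ∨ u = bi ∧ w = bo) :
    stateSum (E.next * flipOn {ao} * flipOn {f p}) (fun c => C (E.sign c) * X) (fun _ => true)
        {f p, ai, ao, bi, bo}ᶜ (bo, false) =
      stateSum (D.next * flipOn {p}) (fun c => C (D.sign c) * X) (fun _ => true) {p}ᶜ
        (p, true) := by
  obtain ⟨n1, n2⟩ := h.ne
  obtain ⟨l1, l2, l3, l4⟩ := hl
  refine h.stateSum_eq (ρ := D.next * flipOn {p}) (la := [(f p, false), (bo, false)])
    (lb := [(f p, true), (ao, true), (w, true), (ai, false), (u, true), (ao, false)])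
    (fun c x hc => ?_) ?_ ?_ ?_ ?_ (by simp)
  · simp [flipOn_apply, h.map_ne' hc, h.next_of_ne c x hc, hc]
  all_goals rcases huw with ⟨rfl, rfl⟩ | ⟨rfl, rfl⟩
  all_goals simp [flipOn_apply, n1, n2, l1, l2, l3, l4, h.next_ai, h.next_a, h.next_ao, h.next_bi,
    h.next_b, h.next_bo]

lemma compl_erase_bi : ({f p, ai, ao, bo}ᶜ : Finset (Fin E.n)).erase bi =
    {f p, ai, ao, bi, bo}ᶜ := by
  ext c
  simp only [Finset.mem_erase, Finset.mem_compl, Finset.mem_insert, Finset.mem_singleton]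
  tauto

/-- After smoothing `ao` and `f p`, the crossing `bi` is a kink. -/
lemma stateSum_flip_ao_p_kink (h : IsLasso D E p f ai ao bi bo) (hl : E.IsLoop u ao w ai)
    (huw : u = bo ∧ w = bi ∨ u = bi ∧ w = bo) :
    stateSum (E.next * flipOn {ao} * flipOn {f p}) (fun c => C (E.sign c) * X) (fun _ => true)
        {f p, ai, ao, bo}ᶜ (bo, false) =
      stateSum (D.next * flipOn {p}) (fun c => C (D.sign c) * X) (fun _ => true) {p}ᶜ
        (p, true) := by
  rw [← h.stateSum_flip_ao_p hl huw, ← compl_erase_bi]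
  obtain ⟨n1, n2⟩ := h.ne
  obtain ⟨l1, l2, l3, l4⟩ := hl
  rcases huw with ⟨rfl, rfl⟩ | ⟨rfl, rfl⟩
  · refine stateSum_kink (Z := {(w, true), (f p, true), (ao, true)}) ?_ ⟨_, Or.inl rfl⟩
      ⟨(w, false), by simp⟩
    simp [flipOn_apply, n1, n2, l2, h.next_a, h.next_bi]
  · refine stateSum_kink (Z := {(u, true), (f p, true), (ao, true), (w, true), (ai, false)}) ?_
      ⟨_, Or.inl rfl⟩ ⟨(u, false), by simp [n1, n2]⟩
    simp [flipOn_apply, n1, n2, l2, l3, l4, h.next_a, h.next_bi]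

/-- After smoothing `ao`, `f p` and `bo`, the crossing `bi` does not contribute. -/
lemma stateSum_flip_ao_p_bo (h : IsLasso D E p f ai ao bi bo) (hl : E.IsLoop u ao w ai)
    (huw : u = bo ∧ w = bi ∨ u = bi ∧ w = bo) :
    stateSum (E.next * flipOn {ao} * flipOn {f p} * flipOn {bo}) (fun c => C (E.sign c) * X)
      (fun _ => true) {f p, ai, ao, bo}ᶜ (bo, false) = D.liveSum {p}ᶜ (p, true) := by
  obtain ⟨n1, n2⟩ := h.ne
  obtain ⟨l1, l2, l3, l4⟩ := hl
  rcases huw with ⟨rfl, rfl⟩ | ⟨rfl, rfl⟩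
  · rw [stateSum_kink (c := w) (Z := {(w, true), (f p, true), (ao, true)}) (by
      simp [flipOn_apply, n1, n2, l2, h.next_a, h.next_bi]) ⟨_, Or.inl rfl⟩
      ⟨(w, false), by simp⟩, compl_erase_bi]
    refine h.stateSum_eq (la := [(f p, false), (u, false), (ao, false)])
      (lb := [(f p, true), (ao, true), (w, true), (ai, false), (u, true)])
      (fun c x hc => ?_) ?_ ?_ ?_ ?_ (by simp)
    · simp [flipOn_apply, h.map_ne' hc, h.next_of_ne c x hc]
    all_goals simp [flipOn_apply, n1, n2, l1, l2, l3, l4, h.next_ai, h.next_a, h.next_ao, h.next_bi,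
      h.next_b, h.next_bo]
  · -- here one arrives at `bi` for the first time along the loop, which is over
    rw [stateSum_next (by simp), stateSum_next (by simp [flipOn_apply, n1, l3])]
    have h1 : (E.next * flipOn {ao} * flipOn {f p} * flipOn {w})
        ((E.next * flipOn {ao} * flipOn {f p} * flipOn {w}) (w, false)) = (u, true) := by
      simp [flipOn_apply, n1, n2, l3, l4]
    rw [h1, stateSum_over rfl, compl_erase_bi]
    refine h.stateSum_eq (la := [(f p, false), (w, false), (ai, false), (u, true), (ao, false)])
      (lb := [(f p, true), (ao, true), (w, true)])
      (fun c x hc => ?_) ?_ ?_ ?_ ?_ (by simp)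
    · simp [flipOn_apply, h.map_ne' hc, h.next_of_ne c x hc]
    all_goals simp [flipOn_apply, n1, n2, l1, l2, l3, l4, h.next_ai, h.next_a, h.next_ao, h.next_bi,
      h.next_b, h.next_bo]

lemma erase_erase_erase_erase_erase (c₁ c₂ c₃ c₄ c₅ : Fin E.n) :
    ((((Finset.univ.erase c₁).erase c₂).erase c₃).erase c₄).erase c₅ = {c₅, c₄, c₃, c₂, c₁}ᶜ := by
  simp only [← Finset.compl_singleton, ← Finset.compl_insert]

/-- The Conway polynomial of the lassoed diagram. The base point is at an over-crossing `u` of the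
loop, and the state sum is expanded along the walk from there. -/
theorem liveSum_eq (h : IsLasso D E p f ai ao bi bo) (hl : E.IsLoop u ao w ai)
    (huw : u = bo ∧ w = bi ∨ u = bi ∧ w = bo) (hE : E.Planar) (hai : E.sign ai = -E.sign ao) :
    E.liveSum Finset.univ (u, true) =
      C (E.sign ao * E.sign (f p) * E.sign bo) * X ^ 3 * D.liveSum Finset.univ (p, true) := by
  have t1 := h.stateSum_flip_ai hl huw
  have t2 := h.stateSum_flip_ai_p hl huw
  have t3 := h.stateSum_flip_ao hl huw
  have t4 := h.stateSum_flip_ao_p_kink hl huw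
  have t5 := h.stateSum_flip_ao_p_bo hl huw
  rw [liveSum_over (D := D), ← Finset.compl_singleton]
  set η : Fin E.n → ℤ[X] := fun c => C (E.sign c) * X with hη
  set G := stateSum (D.next * flipOn {p}) (fun c => C (D.sign c) * X) (fun _ => true) {p}ᶜ (p, true)
  have hunder : ∀ (τ : Equiv.Perm (Fin E.n × Bool)) (T : Finset (Fin E.n)) (c : Fin E.n), c ∈ T →
      stateSum τ η (fun _ => true) T (c, false) =
        stateSum τ η (fun _ => true) (T.erase c) (c, false) +
        C (E.sign c) * X * stateSum (τ * flipOn {c}) η (fun _ => true) (T.erase c) (c, false) := by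
    intro τ T c hc
    have := stateSum_under (σ := τ) (η := η) (o := fun _ => true) (b := (c, false)) hc rfl
    rwa [crossingWeight, if_pos rfl] at this
  obtain ⟨n1, n2⟩ := h.ne
  obtain ⟨l1, l2, l3, l4⟩ := hl
  have hu : u ≠ ao ∧ u ≠ ai ∧ u ≠ f p ∧ w ≠ ao ∧ w ≠ ai ∧ w ≠ f p ∧ u ≠ w := by
    rcases huw with ⟨rfl, rfl⟩ | ⟨rfl, rfl⟩ <;> simp [n1, n2]
  have hT : ((((Finset.univ.erase u).erase ao).erase w).erase ai).erase (f p) =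
      {f p, ai, ao, bi, bo}ᶜ := by
    rw [erase_erase_erase_erase_erase]
    rcases huw with ⟨rfl, rfl⟩ | ⟨rfl, rfl⟩
    · rw [Finset.insert_comm w ao]
    · rw [Finset.insert_comm w ao, Finset.pair_comm w u]
  have hT' : ((((Finset.univ.erase ao).erase ai).erase (f p)).erase w).erase u =
      {f p, ai, ao, bi, bo}ᶜ := by
    rw [← hT, erase_erase_erase_erase_erase, erase_erase_erase_erase_erase,
      Finset.insert_comm u w, Finset.insert_comm u (f p), Finset.insert_comm w (f p),
      Finset.insert_comm u ai, Finset.insert_comm w ai, Finset.pair_comm u ao]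
  have hT'' : ((((Finset.univ : Finset (Fin E.n)).erase ao).erase ai).erase (f p)).erase bo =
      {f p, ai, ao, bo}ᶜ := by
    simp only [← Finset.compl_singleton, ← Finset.compl_insert]
    rw [Finset.insert_comm bo, Finset.insert_comm bo ai, Finset.pair_comm bo]
  -- The crossing `ao` is not smoothed. The loop splits off unless `ai` is smoothed.
  have k1 : stateSum E.next η (fun _ => true) ((Finset.univ.erase u).erase ao) (ao, false) =
      C (E.sign ai) * X * (D.liveSum {p}ᶜ (p, true) +
        C (E.sign (f p)) * X * G) := by
    rw [stateSum_next (by simp), l2, stateSum_over rfl, stateSum_next (by simp), l3,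
      hunder _ _ _ (by simp [n2, Ne.symm hu.2.1, Ne.symm hu.2.2.2.2.1]),
      stateSum_eq_zero_of_dead (Z := {(u, true), (ao, false), (w, true), (ai, false)})
        (by simp [l1, l2, l3, l4]) ⟨_, Or.inl rfl⟩
        ⟨(f p, true), by simp [n2, Ne.symm hu.2.2.1, Ne.symm hu.2.2.2.2.2.1]⟩,
      zero_add, stateSum_next (by simp)]
    have h1 : (E.next * flipOn {ai}) (ai, false) = (f p, false) := by
      simp [flipOn_apply, h.next_ai]
    rw [h1, hunder _ _ _ (by simp [n2, Ne.symm hu.2.2.1, Ne.symm hu.2.2.2.2.2.1]), hT,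
      t1, t2]
  -- the crossing `ao` is smoothed
  have k2 : stateSum (E.next * flipOn {ao}) η (fun _ => true) ((Finset.univ.erase u).erase ao)
        (ao, false) = D.liveSum {p}ᶜ (p, true) + C (E.sign (f p)) * X *
      (G + C (E.sign bo) * X * D.liveSum {p}ᶜ (p, true)) := by
    have h1 : (E.next * flipOn {ao}) (u, true) = (ao, false) := by
      simp [flipOn_apply, hu, l1]
    have h2 : (E.next * flipOn {ao}) (ai, true) = (f p, false) := by
      simp [flipOn_apply, n2, h.next_ai]
    have h3 : (E.next * flipOn {ao}) (f p, false) = (ao, true) := by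
      simp [flipOn_apply, n2, h.next_a]
    have h4 : (E.next * flipOn {ao}) (ao, true) = (w, true) := by
      simp [flipOn_apply, l2]
    have h5 : (E.next * flipOn {ao}) (w, true) = (ai, false) := by
      simp [flipOn_apply, hu, l3]
    have h6 : (E.next * flipOn {ao}) (ai, false) = (u, true) := by
      simp [flipOn_apply, n2, l4]
    have h7 : (E.next * flipOn {ao} * flipOn {f p}) (f p, false) = (bo, false) := by
      simp [flipOn_apply, n2, h.next_b]
    -- The base point moves to the over-passage at `ai`, which makes `ai` drop out.
    have hbase := stateSum_base hE {ao} (fun _ => true) (u, true) (ai, true)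
    rw [Finset.compl_singleton, ← hη, stateSum_over rfl, stateSum_next (by simp), h1,
      Finset.erase_right_comm] at hbase
    have k3 : stateSum (E.next * flipOn {ao}) η (fun _ => true)
        (((Finset.univ.erase ao).erase ai).erase (f p)) (f p, false) =
          D.liveSum {p}ᶜ (p, true) := by
      rw [stateSum_next (by simp), h3, stateSum_next (by simp), h4, stateSum_over rfl,
        stateSum_next (by simp), h5, stateSum_next (by simp), h6, stateSum_over rfl, hT', t3]
    have k4 : stateSum (E.next * flipOn {ao} * flipOn {f p}) η (fun _ => true)
        (((Finset.univ.erase ao).erase ai).erase (f p)) (f p, false) =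
        G + C (E.sign bo) * X * D.liveSum {p}ᶜ (p, true) := by
      rw [stateSum_next (by simp), h7, hunder _ _ _ (by simp [n1]), hT'', t4, t5]
    rw [hbase, stateSum_over rfl, stateSum_next (by simp), h2, hunder _ _ _ (by simp [n2]), k3, k4]
  rw [liveSum_over_next, l1, liveSum, hunder _ _ _ (by simp [Ne.symm hu.1]), k1, k2, hai]
  simp only [map_mul, map_neg]
  ring

end IsLasso
end GaussDiagram

/-! ### Lassoings of links -/

namespace GaussDiagram

variable {D E : GaussDiagram} {p : Fin D.n}

/-- A loop contains no other points than its own. -/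
lemma IsLoop.iterate_mem {u v w x : Fin E.n} (h : E.IsLoop u v w x) {y : Fin E.n × Bool}
    (hy : y ∈ ({(u, true), (v, false), (w, true), (x, false)} : Set (Fin E.n × Bool))) (k : ℕ) :
    (⇑E.next)^[k] y ∈ ({(u, true), (v, false), (w, true), (x, false)} : Set (Fin E.n × Bool)) := by
  obtain ⟨l1, l2, l3, l4⟩ := h
  induction k generalizing y with
  | zero => exact hy
  | succ k ih =>
    refine ih (y := E.next y) ?_
    rcases hy with rfl | rfl | rfl | rfl <;> simp [l1, l2, l3, l4]

/-- A lassoing replaces the crossing `p` by the crossings of the strands with the loop and with each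
other. -/
theorem IsLassoAt.exists_isLasso (h : D.IsLassoAt p E) :
    ∃ (f : Fin D.n → Fin E.n) (ai ao bi bo u w : Fin E.n), IsLasso D E p f ai ao bi bo ∧
      E.IsLoop u ao w ai ∧ (u = bo ∧ w = bi ∨ u = bi ∧ w = bo) ∧ E.sign ai = -E.sign ao ∧
      E.circles ≤ D.circles := by
  obtain ⟨f, ai, ao, bi, bo, ccw, hnd, hdel, e1, e2, e3, e4, hloop, s1, s2, s3, s4⟩ := h
  obtain ⟨u, w, hl, huw⟩ : ∃ u w, E.IsLoop u ao w ai ∧ (u = bo ∧ w = bi ∨ u = bi ∧ w = bo) := by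
    split_ifs at hloop with hc
    · exact ⟨bo, bi, hloop, Or.inl ⟨rfl, rfl⟩⟩
    · obtain ⟨l1, l2, l3, l4⟩ := hloop
      exact ⟨bi, bo, ⟨l3, l4, l1, l2⟩, Or.inr ⟨rfl, rfl⟩⟩
  set L : Set (Fin E.n × Bool) := {(u, true), (ao, false), (w, true), (ai, false)} with hL
  have hLT : ∀ y ∈ L, y.1 ∈ ({ai, ao, bi, bo} : Finset (Fin E.n)) := by
    rintro y (rfl | rfl | rfl | rfl) <;> rcases huw with ⟨rfl, rfl⟩ | ⟨rfl, rfl⟩ <;> simp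
  have hrest : ∀ (d : Fin E.n) (y : Bool), d ∈ ({ai, ao, bi, bo} : Finset (Fin E.n)) →
      (d, y) ∉ L → (d, y) ≠ (ao, true) → (d, y) ≠ (bo, false) →
      (d, y) = (ai, true) ∨ (d, y) = (bi, false) := by
    intro d y hd
    simp only [Finset.mem_insert, Finset.mem_singleton] at hd
    rcases hd with rfl | rfl | rfl | rfl <;> rcases huw with ⟨rfl, rfl⟩ | ⟨rfl, rfl⟩ <;>
      cases y <;> simp [hL]
  have hfT : ∀ c, f c ∉ ({ai, ao, bi, bo} : Finset (Fin E.n)) := fun c =>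
    (hdel.range _).1 ⟨c, rfl⟩
  have hfp := hfT p
  simp only [Finset.mem_insert, Finset.mem_singleton, not_or] at hfp
  -- the first step from a point away from `p` and the loop
  have hstep : ∀ (e : Fin E.n × Bool) (z : Fin D.n × Bool), e.1 ≠ f p → e ≠ (ai, true) →
      e ≠ (bi, false) → (∃ k, (⇑E.next)^[k + 1] e = (f (flipOn {p} z).1, (flipOn {p} z).2) ∧
        ∀ j < k, ((⇑E.next)^[j + 1] e).1 ∈ ({ai, ao, bi, bo} : Finset (Fin E.n))) →
      E.next e = lassoPoint p f ai bi z := by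
    rintro e ⟨c, x⟩ he hea heb ⟨k, hk, hk'⟩
    obtain _ | k := k
    · have hk1 : E.next e = (f (flipOn {p} (c, x)).1, (flipOn {p} (c, x)).2) := hk
      by_cases hc : c = p
      · subst hc
        rw [flipOn_of_mem (by simp)] at hk1
        cases x
        · exact absurd (E.next.injective (hk1.trans e3.symm)) heb
        · exact absurd (E.next.injective (hk1.trans e1.symm)) hea
      · rw [flipOn_of_notMem (by simpa using hc)] at hk1
        rw [hk1, lassoPoint, if_neg hc]
    · have hu : E.next e ∉ L := fun hu => by
        have h1 := hLT _ (hl.iterate_mem hu (k + 1))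
        rw [← Function.iterate_succ_apply, hk] at h1
        exact hfT _ h1
      have hz : ∀ y, E.next (E.next e) = (f p, y) → (c, x) = (p, !y) := by
        intro y hy
        obtain rfl : k = 0 := by
          by_contra hk0
          have h1 := hk' 1 (by omega)
          rw [Function.iterate_succ_apply, Function.iterate_succ_apply, hy] at h1
          exact hfT p h1
        have h2 : (f p, y) = (f (flipOn {p} (c, x)).1, (flipOn {p} (c, x)).2) := hy.symm.trans hk
        rw [Prod.mk.injEq] at h2
        have h3 := hdel.injective h2.1
        rw [flipOn_fst] at h3
        simp only at h3
        subst h3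
        rw [h2.2, flipOn_of_mem (by simp), Bool.not_not]
      have h1 := hk' 0 (by omega)
      have h2 : E.next e ≠ (ao, true) := fun h => he (by
        rw [E.next.injective (h.trans e2.symm)])
      have h3 : E.next e ≠ (bo, false) := fun h => he (by
        rw [E.next.injective (h.trans e4.symm)])
      have h4 : E.next e = (ai, true) ∨ E.next e = (bi, false) := by
        exact hrest _ _ h1 hu h2 h3
      rcases h4 with h4 | h4
      · rw [hz false (by rw [h4, e1]), h4]
        simp [lassoPoint]
      · rw [hz true (by rw [h4, e3]), h4]
        simp [lassoPoint]
  have hnext : ∀ x : Fin D.n × Bool, ∃ k, (⇑E.next)^[k + 1] (f x.1, x.2) =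
      (f (flipOn {p} (D.next (flipOn {p} x))).1, (flipOn {p} (D.next (flipOn {p} x))).2) ∧
      ∀ j < k, ((⇑E.next)^[j + 1] (f x.1, x.2)).1 ∈ ({ai, ao, bi, bo} : Finset (Fin E.n)) := by
    intro x
    simp only [Equiv.Perm.iterate_eq_pow]
    exact hdel.next x
  -- the first step from a point behind `p`
  have hexit : ∀ x (e : Fin E.n × Bool), E.next (f p, x) = e →
      e.1 ∈ ({ai, ao, bi, bo} : Finset (Fin E.n)) → e ≠ (ai, true) → e ≠ (bi, false) →
      E.next e = lassoPoint p f ai bi (D.next (p, !x)) := by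
    intro x e hxe heT hea heb
    refine hstep e _ (fun h => hfT p (h ▸ heT)) hea heb ?_
    obtain ⟨k, hk, hk'⟩ := hnext (p, x)
    rw [flipOn_of_mem (x := (p, x)) (by simp)] at hk
    obtain _ | k := k
    · exfalso
      have h1 := hxe.symm.trans hk
      rw [h1] at heT
      exact hfT _ heT
    · refine ⟨k, ?_, fun j hj => ?_⟩
      · rw [← hk, Function.iterate_succ_apply _ (k + 1), hxe]
      · have := hk' (j + 1) (by omega)
        rwa [Function.iterate_succ_apply _ (j + 1), hxe] at this
  have hnd' := hnd
  simp only [List.nodup_cons, List.mem_cons, List.not_mem_nil, or_false, not_or] at hnd'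
  refine ⟨f, ai, ao, bi, bo, u, w, ⟨hdel.injective, hdel.range, ?_, fun c hc => ?_, e1, e2, ?_, e3,
    e4, ?_, fun c x hc => ?_⟩, hl, huw, ?_, ?_⟩
  · rw [List.nodup_cons]
    exact ⟨by simpa using hfp, hnd⟩
  · have h1 := hdel.positive c
    rw [sign, sign, h1]
    simp [switch, Function.update_of_ne hc]
  · exact hexit false _ e2 (by simp) (by simp [Ne.symm hnd'.1.1]) (by simp)
  · exact hexit true _ e4 (by simp) (by simp) (by simp [Ne.symm hnd'.2.2.1])
  · have h1 := hfT c
    simp only [Finset.mem_insert, Finset.mem_singleton, not_or] at h1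
    refine hstep (f c, x) _ (fun h => hc (hdel.injective h)) (by simp [h1]) (by simp [h1]) ?_
    have := hnext (c, x)
    rwa [flipOn_of_notMem (x := (c, x)) (by simpa using hc)] at this
  · rw [sign, sign, s3, s1]
    cases ccw <;> simp
  · -- the loop is a component without any of the old crossings
    have h1 := hdel.firstReturn.numCycles_le hdel.injective_prod
    have h2 := (hdel.firstReturn.numCycles_eq_iff hdel.injective_prod).not.2 (fun hr => by
      obtain ⟨k, ⟨c, x⟩, hk⟩ := hr (u, true)
      have h3 := hLT _ (hl.iterate_mem (Or.inl rfl) k)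
      rw [← hk] at h3
      exact hfT c h3)
    have h3 := hdel.components
    unfold numComponents at h3
    simp only at h1 h2 h3
    omega

/-- Lassoing multiplies the Conway polynomial by `± z ^ 3`, so it does not make it vanish. -/
theorem IsLassoAt.conway_ne_zero (h : D.IsLassoAt p E) (hD : D.Planar) (hE : E.Planar)
    (h0 : D.conway ≠ 0) : E.conway ≠ 0 := by
  obtain ⟨f, ai, ao, bi, bo, u, w, hlasso, hloop, huw, hai, hcirc⟩ := h.exists_isLasso
  have hDc : D.circles = 0 := by
    by_contra hc
    exact h0 (by rw [conway_eq_liveSum_of_planar hD (p, true), if_neg hc])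
  rw [conway_eq_liveSum_of_planar hD (p, true), if_pos hDc] at h0
  rw [conway_eq_liveSum_of_planar hE (u, true), if_pos (by omega),
    hlasso.liveSum_eq hloop huw hE hai]
  have hs : ∀ c, E.sign c ≠ 0 := fun c => by
    rcases sign_eq (D := E) c with h | h <;> rw [h] <;> norm_num
  exact mul_ne_zero (mul_ne_zero (C_ne_zero.2 (mul_ne_zero (mul_ne_zero (hs _) (hs _)) (hs _)))
    (pow_ne_zero 3 X_ne_zero)) h0

/-- The Conway polynomial of a knot has the constant term one, which comes from the empty state. -/
lemma conway_ne_zero_of_knot (h : D.numComponents = 1) : D.conway ≠ 0 := by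
  intro h0
  have h1 := congrArg (Polynomial.eval 0) h0
  rw [conway, eval_finsetSum, Finset.sum_eq_single ∅] at h1
  · rw [if_pos] at h1
    · simp at h1
    · refine ⟨?_, by intro c hc; simp at hc⟩
      have h2 : (D.smooth ∅).numComponents = D.numComponents := by
        unfold smooth numComponents; rw [flipOn_empty, mul_one]
      rw [h2, h]
  · intro S _ hS
    split_ifs
    · rw [eval_mul, eval_pow, eval_X, zero_pow (Finset.card_ne_zero.2
        (Finset.nonempty_iff_ne_empty.2 hS)), mul_zero]
    · exact eval_zero
  · simp

end GaussDiagram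

theorem mainTheorem7 :
    OrientedLink.IsConwayPolynomial OrientedLink.conway ∧
    (∀ D : LinkDiagram, D.link.conway = D.toGaussDiagram.conway) ∧
    ∀ (r : ℕ) (K L : OrientedLink), OrientedLink.IsIteratedLassoing r K L →
      (K.conway ≠ 0 → L.conway ≠ 0) ∧ (K.IsKnot → L.conway ≠ 0) := by
  have key : ∀ (r : ℕ) (K L : OrientedLink), OrientedLink.IsIteratedLassoing r K L →
      K.conway ≠ 0 → L.conway ≠ 0 := by
    intro r
    induction r with
    | zero => rintro K _ rfl h; exact h
    | succ r ih =>
      rintro K L ⟨M, hKM, D, E, p, rfl, rfl, h⟩ hK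
      have hM := ih K _ hKM hK
      rw [LinkDiagram.link_conway] at hM ⊢
      exact h.conway_ne_zero D.planar E.planar hM
  refine ⟨conway_isConwayPolynomial, LinkDiagram.link_conway, fun r K L h => ⟨key r K L h, ?_⟩⟩
  rintro ⟨D, rfl, hD⟩
  refine key r _ L h ?_
  rw [LinkDiagram.link_conway]
  exact GaussDiagram.conway_ne_zero_of_knot hD
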